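/- For a subset $A$ of a finite abelian group $G$, let $$T(A)=\#\{(x,y,z)\in A^3 : x+z=2y\}$$ be the number of three-term arithmetic progressions in $A$, including the trivial ones $x=y=z$. The density of $A$ is $\alpha=|A|/|G|$. There are absolute constants $C_1,C_2,C_3>0$ (independent of $G$ and $A$) such that the following hold. (i) For every finite abelian group $G$ of odd order and every $A\subset G$ of density $\alpha>0$, $$T(A)\ \ge\ \exp\!\left(-C_1\,\alpha^{-1}\bigl(\log(2/\alpha)\bigr)^{C_2}\right)|A|^2 .$$ (ii) For every finite abelian group $G$ of odd order with $|G|\ge 17$ (equivalently, for odd orders, $|G|>e$ and $\log\log|G|>1$) and every $A\subset G$ of density $$\alpha\ \ge\ \frac{(\log\log|G|)^{C_3}}{\log|G|},$$ the set $A$ contains a non-trivial three-term arithmetic progression, that is, there are $x,y,z\in A$, not all equal, with $x+z=2y$. -/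

import Mathlib

/-- `threeAPCount A B C` is the number of triples `(x, y, z) ∈ A × B × C` with `x + z = 2y`:
three-term progressions (trivial ones included) with starting point in `A`, mid-point in `B` and
end-point in `C`. -/
def threeAPCount {G : Type*} [AddCommGroup G] [DecidableEq G] (A B C : Finset G) : ℕ :=
  ((A ×ˢ B ×ˢ C).filter fun p => p.1 + p.2.2 = 2 • p.2.1).card

/-- `A` contains a three-term progression `(x, y, z)` that is not trivial, i.e. for which
`x = y = z` fails. -/
def HasNontrivialThreeAP {G : Type*} [AddCommGroup G] (A : Finset G) : Prop :=
  ∃ x ∈ A, ∃ y ∈ A, ∃ z ∈ A, x + z = 2 • y ∧ ¬ (x = y ∧ y = z)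

/-- The density `|A| / |G|` of a subset of a finite type, as a real number. -/
noncomputable def density {G : Type*} [Fintype G] (A : Finset G) : ℝ :=
  (A.card : ℝ) / (Fintype.card G : ℝ)

/-! The proof iterates a density increment. Each step either multiplies the density seen by some
Bohr weight by `1 + 1/100`, at the cost of about `α⁻¹ log(8/α)^4` new frequencies, or produces many
progressions. Densities are at most 1, so there are `O(log(8/α))` steps. Rank `α⁻¹ log^5` together
with log-scale `log^2` then keeps the mass of every weight above `exp(-H)|G|` with `H` of order `α⁻¹
log^7`, whence the exponent 7.

Regular Bohr sets are replaced by weights proportional to `exp (-N)`, where `N` is a seminorm: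
translation by `t` changes such a weight pointwise by a factor at most `exp (N t)`, so no regularity
has to be arranged.

For one step, let `Φ` be the normalised convolution `weightedConv` of `h` with itself, and let `f`
be the weight of doubled mid-points (`exists_doubled_weight`). The progressions are counted by the
pairing of `f` with `Φ`, and `half_le_sum_mul_weightedConv` bounds it below. Croot–Sisask sampling
(`exists_shift_set`) gives a large set `T` of almost-periods of `Φ`, so replacing `f` by an iterated
smoothing `F` along `T` hardly increases the pairing. The Fourier transform of `F` is negligible off
the large spectrum of `T`, and a local form of Chang's theorem (`exists_finset_control_spectrum`)
controls this spectrum by few characters. Hence `Φ` may be averaged over a finer Bohr weight with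
those characters added. If that weight sees no increment, the averages of `h` along it are at most
slightly above the density while their mean is close to it, so they are nearly constant and the
averaged `Φ` is nearly the density (`le_sum_weightedConv_average`).

Part (ii) follows from (i), because a set without non-trivial progressions has at most `|A|`
progressions in all. -/

open Finset

/-! ### Exponential weights of seminorms and local densities. -/

section Weights

variable {G : Type*} [AddCommGroup G] [Fintype G]

/-- The total mass of the weight `exp (-N)`. -/
noncomputable def expMass (N : AddGroupSeminorm G) : ℝ := ∑ x, Real.exp (-N x)

/-- The probability weight on `G` proportional to `exp (-N)`. -/
noncomputable def expWeight (N : AddGroupSeminorm G) (x : G) : ℝ := Real.exp (-N x) / expMass N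

/-- The average of `h` around `x` with respect to the weight `expWeight N`. -/
noncomputable def localDensity (N : AddGroupSeminorm G) (h : G → ℝ) (x : G) : ℝ :=
  ∑ t, expWeight N t * h (x + t)

/-- `N'` is finer than `N` at accuracy `θ`: a random element for the weight of `N'` has `N`-seminorm
at most `θ`, except with probability at most `θ`. -/
def IsFiner (θ : ℝ) (N N' : AddGroupSeminorm G) : Prop :=
  ∑ t with θ < N t, expWeight N' t ≤ θ

lemma expMass_pos (N : AddGroupSeminorm G) : 0 < expMass N :=
  Finset.sum_pos (fun _ _ => Real.exp_pos _) ⟨0, mem_univ _⟩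

lemma expWeight_pos (N : AddGroupSeminorm G) (x : G) : 0 < expWeight N x :=
  div_pos (Real.exp_pos _) (expMass_pos N)

lemma expWeight_nonneg (N : AddGroupSeminorm G) (x : G) : 0 ≤ expWeight N x :=
  (expWeight_pos N x).le

lemma sum_expWeight (N : AddGroupSeminorm G) : ∑ x, expWeight N x = 1 := by
  unfold expWeight
  rw [← Finset.sum_div]
  exact div_self (expMass_pos N).ne'

lemma expWeight_neg (N : AddGroupSeminorm G) (x : G) : expWeight N (-x) = expWeight N x := by
  simp [expWeight]

lemma expWeight_add_le (N : AddGroupSeminorm G) (x t : G) :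
    expWeight N (x + t) ≤ Real.exp (N t) * expWeight N x := by
  unfold expWeight
  rw [← mul_div_assoc, ← Real.exp_add]
  have := map_add_le_add N (x + t) (-t)
  rw [add_neg_cancel_right, map_neg_eq_map] at this
  have hM := expMass_pos N
  gcongr
  linarith

lemma le_expWeight_add (N : AddGroupSeminorm G) (x t : G) :
    Real.exp (-N t) * expWeight N x ≤ expWeight N (x + t) := by
  unfold expWeight
  rw [← mul_div_assoc, ← Real.exp_add]
  have := map_add_le_add N x t
  have hM := expMass_pos N
  gcongr
  linarith

lemma expWeight_le_of_expMass {N : AddGroupSeminorm G} {H : ℝ}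
    (hN : Real.exp (-H) * Fintype.card G ≤ expMass N) (x : G) :
    expWeight N x ≤ Real.exp H / Fintype.card G := by
  have hc : (0 : ℝ) < Fintype.card G := by exact_mod_cast Fintype.card_pos
  unfold expWeight
  rw [div_le_div_iff₀ (expMass_pos N) hc]
  have h1 : Real.exp (-N x) ≤ 1 := Real.exp_le_one_iff.2 (neg_nonpos.2 (apply_nonneg N x))
  calc Real.exp (-N x) * Fintype.card G ≤ 1 * Fintype.card G := by gcongr
    _ = Real.exp H * (Real.exp (-H) * Fintype.card G) := by
      rw [← mul_assoc, ← Real.exp_add]; simp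
    _ ≤ Real.exp H * expMass N := by gcongr

/-- Where `N` exceeds `θ`, the weight `exp (-N')` is at most `θ * exp (-H)`; even summed over all of
`G` this is a proportion at most `θ` of the mass of `N'`. -/
lemma isFiner_of_le {N N' : AddGroupSeminorm G} {H l θ : ℝ} (hθ : 0 < θ) (hl : 0 ≤ l)
    (hN' : Real.exp (-H) * Fintype.card G ≤ expMass N')
    (hle : ∀ x, l * N x ≤ N' x) (hlθ : H + Real.log (1 / θ) ≤ l * θ) : IsFiner θ N N' := by
  unfold IsFiner expWeight
  rw [← Finset.sum_div, div_le_iff₀ (expMass_pos N')]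
  have hc : (0 : ℝ) ≤ Fintype.card G := by positivity
  calc ∑ t with θ < N t, Real.exp (-N' t)
      ≤ ∑ t with θ < N t, θ * Real.exp (-H) := by
        refine Finset.sum_le_sum fun t ht => ?_
        have ht := (mem_filter.1 ht).2
        have h1 : H + Real.log (1 / θ) ≤ N' t :=
          hlθ.trans ((mul_le_mul_of_nonneg_left ht.le hl).trans (hle t))
        have h2 : θ * Real.exp (-H) = Real.exp (-(H + Real.log (1 / θ))) := by
          rw [neg_add, Real.exp_add, one_div, Real.log_inv, neg_neg, Real.exp_log hθ, mul_comm]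
        rw [h2]
        gcongr
    _ = ((univ.filter fun t => θ < N t).card : ℝ) * (θ * Real.exp (-H)) := by
        rw [Finset.sum_const, nsmul_eq_mul]
    _ ≤ (Fintype.card G : ℝ) * (θ * Real.exp (-H)) := by
        gcongr
        exact Finset.card_le_univ _
    _ = θ * (Real.exp (-H) * Fintype.card G) := by ring
    _ ≤ θ * expMass N' := by gcongr

lemma IsFiner.one_sub_le {θ : ℝ} {N N' : AddGroupSeminorm G} (hf : IsFiner θ N N') :
    1 - θ ≤ ∑ t with N t ≤ θ, expWeight N' t := by
  have h := Finset.sum_filter_add_sum_filter_not univ (fun t => N t ≤ θ) (expWeight N')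
  rw [sum_expWeight] at h
  simp only [not_le] at h
  unfold IsFiner at hf
  linarith

lemma localDensity_nonneg (N : AddGroupSeminorm G) {h : G → ℝ} (h0 : ∀ x, 0 ≤ h x) (x : G) :
    0 ≤ localDensity N h x :=
  Finset.sum_nonneg fun t _ => mul_nonneg (expWeight_nonneg N t) (h0 _)

lemma localDensity_le_one (N : AddGroupSeminorm G) {h : G → ℝ} (h1 : ∀ x, h x ≤ 1) (x : G) :
    localDensity N h x ≤ 1 := by
  rw [← sum_expWeight N]
  exact Finset.sum_le_sum fun t _ => mul_le_of_le_one_right (expWeight_nonneg N t) (h1 _)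

lemma le_localDensity_add (N : AddGroupSeminorm G) {h : G → ℝ} (h0 : ∀ x, 0 ≤ h x) (x t : G) :
    Real.exp (-N t) * localDensity N h x ≤ localDensity N h (x + t) := by
  unfold localDensity
  rw [Finset.mul_sum, ← Equiv.sum_comp (Equiv.addRight (-t))
    (fun s => expWeight N s * h (x + t + s))]
  refine Finset.sum_le_sum fun s _ => ?_
  have h1 := le_expWeight_add N s (-t)
  rw [map_neg_eq_map] at h1
  have h2 : x + t + (Equiv.addRight (-t)) s = x + s := by
    simp only [Equiv.coe_addRight]; abel
  rw [h2, ← mul_assoc]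
  exact mul_le_mul_of_nonneg_right h1 (h0 _)

lemma one_sub_two_mul_le_exp_neg {θ : ℝ} (hθ0 : 0 ≤ θ) (hθ1 : θ ≤ 1) :
    1 - 2 * θ ≤ (1 - θ) * Real.exp (-θ) := by
  have := Real.add_one_le_exp (-θ)
  nlinarith

lemma exp_le_one_add_two_mul {x : ℝ} (h0 : 0 ≤ x) (h1 : x ≤ 1) : Real.exp x ≤ 1 + 2 * x := by
  have h := Real.abs_exp_sub_one_sub_id_le (x := x) (by rwa [abs_of_nonneg h0])
  have := (abs_le.1 h).2
  nlinarith

/-- Most of the weight of `N'` sits where `N t ≤ θ`, and a shift by such `t` lowers a local density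
for `N` by a factor at least `exp (-θ)`. -/
lemma IsFiner.le_sum_localDensity {θ : ℝ} {N N' : AddGroupSeminorm G} (hf : IsFiner θ N N')
    (hθ0 : 0 ≤ θ) (hθ1 : θ ≤ 1) {h : G → ℝ} (h0 : ∀ x, 0 ≤ h x) (x : G) :
    (1 - 2 * θ) * localDensity N h x ≤ ∑ t, expWeight N' t * localDensity N h (x + t) := by
  have hd := localDensity_nonneg N h0 x
  calc (1 - 2 * θ) * localDensity N h x
      ≤ ((1 - θ) * Real.exp (-θ)) * localDensity N h x := by
        gcongr; exact one_sub_two_mul_le_exp_neg hθ0 hθ1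
    _ ≤ ((∑ t with N t ≤ θ, expWeight N' t) * Real.exp (-θ)) * localDensity N h x := by
        gcongr; exact hf.one_sub_le
    _ = ∑ t with N t ≤ θ, expWeight N' t * (Real.exp (-θ) * localDensity N h x) := by
        rw [mul_assoc, Finset.sum_mul]
    _ ≤ ∑ t with N t ≤ θ, expWeight N' t * localDensity N h (x + t) := by
        refine Finset.sum_le_sum fun t ht => ?_
        refine mul_le_mul_of_nonneg_left ?_ (expWeight_nonneg _ _)
        refine le_trans ?_ (le_localDensity_add N h0 x t)
        have := (mem_filter.1 ht).2
        gcongr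
    _ ≤ ∑ t, expWeight N' t * localDensity N h (x + t) := by
        refine Finset.sum_le_sum_of_subset_of_nonneg (filter_subset _ _) fun t _ _ => ?_
        exact mul_nonneg (expWeight_nonneg _ _) (localDensity_nonneg N h0 _)

/-- The two averaging operators commute, so a bound on averages for the coarse weight becomes a
bound on the mean of the fine local densities. -/
lemma sum_expWeight_mul_localDensity_comm (N N' : AddGroupSeminorm G) (h : G → ℝ) (x : G) :
    ∑ t, expWeight N' t * localDensity N h (x + t) =
      ∑ t, expWeight N t * localDensity N' h (x + t) := by
  unfold localDensity
  simp only [Finset.mul_sum]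
  rw [Finset.sum_comm]
  refine Finset.sum_congr rfl fun s _ => Finset.sum_congr rfl fun t _ => ?_
  rw [add_right_comm]
  ring

lemma exists_le_of_le_sum_mul {ι : Type*} [Fintype ι] {p f : ι → ℝ} (hp : ∀ i, 0 ≤ p i)
    (hp1 : ∑ i, p i = 1) {v : ℝ} (hv : v ≤ ∑ i, p i * f i) : ∃ i, v ≤ f i := by
  by_contra! hcon
  have hne : ∃ i ∈ (univ : Finset ι), 0 < p i := by
    by_contra! hz
    have : ∑ i, p i ≤ 0 := Finset.sum_nonpos fun i hi => hz i hi
    linarith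
  have : ∑ i, p i * f i < ∑ i, p i * v := by
    obtain ⟨i, hi, hpi⟩ := hne
    exact Finset.sum_lt_sum (fun j _ => mul_le_mul_of_nonneg_left (hcon j).le (hp j))
      ⟨i, hi, mul_lt_mul_of_pos_left (hcon i) hpi⟩
  rw [← Finset.sum_mul, hp1, one_mul] at this
  linarith

/-- If neither of two finer weights sees a density increment, then both see almost the full density
around a common point. -/
lemma exists_simultaneous_localDensity {θ c a : ℝ} {N N₁ N₂ : AddGroupSeminorm G}
    (hf₁ : IsFiner θ N N₁) (hf₂ : IsFiner θ N N₂) (hθ0 : 0 ≤ θ) (hθ1 : θ ≤ 1)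
    (hθc : 4 * θ ≤ c) (ha : 0 ≤ a) {h : G → ℝ} (h0 : ∀ x, 0 ≤ h x) {x : G}
    (hx : a ≤ localDensity N h x) (h₁ : ∀ y, localDensity N₁ h y ≤ (1 + c) * a)
    (h₂ : ∀ y, localDensity N₂ h y ≤ (1 + c) * a) :
    ∃ y, (1 - 2 * c) * a ≤ localDensity N₁ h y ∧ (1 - 2 * c) * a ≤ localDensity N₂ h y := by
  by_cases hθ2 : 1 - 2 * θ ≤ 0
  · refine ⟨x, ?_, ?_⟩ <;>
    · refine le_trans ?_ (localDensity_nonneg _ h0 _)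
      nlinarith
  push Not at hθ2
  have e₁ := hf₁.le_sum_localDensity hθ0 hθ1 h0 x
  have e₂ := hf₂.le_sum_localDensity hθ0 hθ1 h0 x
  rw [sum_expWeight_mul_localDensity_comm] at e₁ e₂
  -- At some point the two fine densities sum to at least `2(1 - 2θ)a`. Neither exceeds `(1 + c)a`,
  -- so each is at least `(1 - c - 4θ)a`.
  have hv : 2 * ((1 - 2 * θ) * a) ≤
      ∑ t, expWeight N t * (localDensity N₁ h (x + t) + localDensity N₂ h (x + t)) := by
    simp only [mul_add, Finset.sum_add_distrib]
    nlinarith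
  obtain ⟨t, ht⟩ := exists_le_of_le_sum_mul (expWeight_nonneg N) (sum_expWeight N) hv
  refine ⟨x + t, ?_, ?_⟩
  · have := h₂ (x + t); nlinarith
  · have := h₁ (x + t); nlinarith

end Weights

/-! ### Chernoff bounds for sampling. -/

section Sampling

lemma sum_prod_mul_exp_sum {ι : Type*} [Fintype ι] (p X : ι → ℝ) (k : ℕ) (s : ℝ) :
    ∑ x : Fin k → ι, (∏ i, p (x i)) * Real.exp (s * ∑ i, X (x i)) =
      (∑ y, p y * Real.exp (s * X y)) ^ k := by
  rw [Fintype.sum_pow]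
  refine Finset.sum_congr rfl fun x _ => ?_
  rw [Finset.prod_mul_distrib, Finset.mul_sum, Real.exp_sum]

lemma sum_prod_eq_one {ι : Type*} [Fintype ι] {p : ι → ℝ} (hp1 : ∑ y, p y = 1) (k : ℕ) :
    ∑ x : Fin k → ι, ∏ i, p (x i) = 1 := by
  rw [← Fintype.sum_pow, hp1, one_pow]

/-- On `[0, 1]` the exponential lies below its chord, which makes the moment depend only on the
mean. -/
lemma sum_mul_exp_le {ι : Type*} [Fintype ι] {p X : ι → ℝ} (hp : ∀ y, 0 ≤ p y)
    (hp1 : ∑ y, p y = 1) (hX0 : ∀ y, 0 ≤ X y) (hX1 : ∀ y, X y ≤ 1) {s : ℝ} (hs : |s| ≤ 1) :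
    ∑ y, p y * Real.exp (s * X y) ≤ Real.exp ((∑ y, p y * X y) * (s + s ^ 2)) := by
  have hconv : ∀ y, Real.exp (s * X y) ≤ 1 + X y * (Real.exp s - 1) := fun y => by
    have := convexOn_exp.2 (Set.mem_univ 0) (Set.mem_univ s) (sub_nonneg.2 (hX1 y)) (hX0 y)
      (by ring)
    simp only [smul_eq_mul, mul_zero, zero_add, Real.exp_zero, mul_one] at this
    rw [mul_comm s]
    linarith
  have hq : 0 ≤ ∑ y, p y * X y := Finset.sum_nonneg fun y _ => mul_nonneg (hp y) (hX0 y)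
  have hexp : Real.exp s - 1 ≤ s + s ^ 2 := by
    have := (abs_le.1 (Real.abs_exp_sub_one_sub_id_le hs)).2
    linarith
  calc ∑ y, p y * Real.exp (s * X y) ≤ ∑ y, p y * (1 + X y * (Real.exp s - 1)) :=
        Finset.sum_le_sum fun y _ => mul_le_mul_of_nonneg_left (hconv y) (hp y)
    _ = 1 + (∑ y, p y * X y) * (Real.exp s - 1) := by
        simp only [mul_add, mul_one, Finset.sum_add_distrib, hp1, Finset.sum_mul, mul_assoc]
    _ ≤ 1 + (∑ y, p y * X y) * (s + s ^ 2) := by gcongr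
    _ ≤ _ := by
        have := Real.add_one_le_exp ((∑ y, p y * X y) * (s + s ^ 2))
        linarith

/-- Chernoff's bound with an error relative to the mean plus `a`. -/
lemma chernoff_relative {ι : Type*} [Fintype ι] {p X : ι → ℝ} (hp : ∀ y, 0 ≤ p y)
    (hp1 : ∑ y, p y = 1) (hX0 : ∀ y, 0 ≤ X y) (hX1 : ∀ y, X y ≤ 1) {ε a : ℝ} (hε0 : 0 ≤ ε)
    (hε1 : ε ≤ 1) (ha : 0 ≤ a) (k : ℕ) :
    ∑ x : Fin k → ι with k * (ε * (∑ y, p y * X y + a)) < |∑ i, X (x i) - k * ∑ y, p y * X y|,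
      ∏ i, p (x i) ≤ 2 * Real.exp (-(k * ε ^ 2 * a / 4)) := by
  set q := ∑ y, p y * X y with hqdef
  have hq : 0 ≤ q := Finset.sum_nonneg fun y _ => mul_nonneg (hp y) (hX0 y)
  have tail : ∀ s : ℝ, |s| = ε / 2 →
      ∑ x : Fin k → ι, (∏ i, p (x i)) *
        Real.exp (s * ∑ i, X (x i) - s * (k * q) - |s| * (k * (ε * (q + a)))) ≤
        Real.exp (-(k * ε ^ 2 * a / 4)) := by
    intro s hs
    have h1 : ∀ x : Fin k → ι, (∏ i, p (x i)) *
        Real.exp (s * ∑ i, X (x i) - s * (k * q) - |s| * (k * (ε * (q + a)))) =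
        ((∏ i, p (x i)) * Real.exp (s * ∑ i, X (x i))) *
          Real.exp (- s * (k * q) - |s| * (k * (ε * (q + a)))) := fun x => by
      rw [mul_assoc, ← Real.exp_add]; congr 2; ring
    simp only [h1]
    rw [← Finset.sum_mul, sum_prod_mul_exp_sum]
    have h2 := sum_mul_exp_le hp hp1 hX0 hX1 (s := s) (by rw [hs]; linarith)
    have h3 : 0 ≤ ∑ y, p y * Real.exp (s * X y) :=
      Finset.sum_nonneg fun y _ => mul_nonneg (hp y) (Real.exp_pos _).le
    calc _ ≤ Real.exp (q * (s + s ^ 2)) ^ k *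
          Real.exp (- s * (k * q) - |s| * (k * (ε * (q + a)))) := by gcongr
      _ = Real.exp (k * q * s ^ 2 - |s| * (k * (ε * (q + a)))) := by
          rw [← Real.exp_nat_mul, ← Real.exp_add]; congr 1; ring
      _ ≤ _ := by
          rw [← sq_abs, hs]
          apply Real.exp_le_exp.2
          have : 0 ≤ k * q * ε ^ 2 := by positivity
          have : 0 ≤ k * a * ε ^ 2 := by positivity
          nlinarith
  have t1 := tail (ε / 2) (abs_of_nonneg (by linarith))
  have t2 := tail (-(ε / 2)) (by rw [abs_neg, abs_of_nonneg (by linarith)])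
  rw [Finset.sum_filter]
  have key : ∀ x : Fin k → ι,
      (if k * (ε * (q + a)) < |∑ i, X (x i) - k * q| then ∏ i, p (x i) else 0) ≤
      (∏ i, p (x i)) * Real.exp (ε / 2 * ∑ i, X (x i) - ε / 2 * (k * q) -
          |ε / 2| * (k * (ε * (q + a)))) +
      (∏ i, p (x i)) * Real.exp (-(ε / 2) * ∑ i, X (x i) - -(ε / 2) * (k * q) -
          |-(ε / 2)| * (k * (ε * (q + a)))) := by
    intro x
    have hP : 0 ≤ ∏ i, p (x i) := Finset.prod_nonneg fun i _ => hp _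
    split_ifs with hx
    · have hε2 : |ε / 2| = ε / 2 := abs_of_nonneg (by linarith)
      rw [abs_neg, hε2]
      rcases lt_abs.1 hx with hx | hx
      · have : (1 : ℝ) ≤ Real.exp (ε / 2 * ∑ i, X (x i) - ε / 2 * (k * q) -
            ε / 2 * (k * (ε * (q + a)))) := by
          apply Real.one_le_exp
          have := mul_le_mul_of_nonneg_left hx.le (show 0 ≤ ε / 2 by linarith)
          linarith
        have h4 := mul_le_mul_of_nonneg_left this hP
        have h5 := mul_nonneg hP (Real.exp_pos (-(ε / 2) * ∑ i, X (x i) - -(ε / 2) * (k * q) -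
            ε / 2 * (k * (ε * (q + a))))).le
        linarith
      · have : (1 : ℝ) ≤ Real.exp (-(ε / 2) * ∑ i, X (x i) - -(ε / 2) * (k * q) -
            ε / 2 * (k * (ε * (q + a)))) := by
          apply Real.one_le_exp
          have := mul_le_mul_of_nonneg_left hx.le (show 0 ≤ ε / 2 by linarith)
          linarith
        have h4 := mul_le_mul_of_nonneg_left this hP
        have h5 := mul_nonneg hP (Real.exp_pos (ε / 2 * ∑ i, X (x i) - (ε / 2) * (k * q) -
            ε / 2 * (k * (ε * (q + a))))).le
        linarith
    · positivity
  refine (Finset.sum_le_sum fun x _ => key x).trans ?_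
  rw [Finset.sum_add_distrib]
  linarith

end Sampling

/-! ### Croot–Sisask almost-periodicity. -/

section ShiftSet

variable {G : Type*} [AddCommGroup G] [Fintype G]

lemma prod_expWeight_add_ge (N : AddGroupSeminorm G) {k : ℕ} (x : Fin k → G) (t : G) :
    Real.exp (-(k * N t)) * ∏ i, expWeight N (x i) ≤ ∏ i, expWeight N (x i + t) := by
  have : Real.exp (-(k * N t)) = ∏ _i : Fin k, Real.exp (-N t) := by
    rw [Finset.prod_const, ← Real.exp_nat_mul, card_univ, Fintype.card_fin]
    congr 1; ring
  rw [this, ← Finset.prod_mul_distrib]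
  exact Finset.prod_le_prod
    (fun i _ => mul_nonneg (Real.exp_pos _).le (expWeight_nonneg _ _))
    (fun i _ => le_expWeight_add N (x i) t)

/-- Sampling `k` points yields a large set `T` of shifts under which the weighted convolution of `h`
with itself is close, in measure, to one and the same function. -/
lemma exists_shift_set {N : AddGroupSeminorm G} {h ω r : G → ℝ} (h0 : ∀ x, 0 ≤ h x)
    (h1 : ∀ x, h x ≤ 1) (hω : ∀ x, 0 ≤ ω x) (hω1 : ∑ x, ω x = 1) (hr : ∀ x, 0 ≤ r x)
    {S : Finset G} (hrS : 1 / 2 ≤ ∑ t ∈ S, r t) {θ : ℝ} (hS : ∀ t ∈ S, N t ≤ θ) {k : ℕ}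
    (hkθ : k * θ ≤ 1 / 2) {ε a b : ℝ} (hε0 : 0 ≤ ε) (hε1 : ε ≤ 1) (ha : 0 ≤ a)
    (hb : ∑ x, expWeight N x * h x = b) (hb0 : 0 < b) {Φ : G → ℝ}
    (hΦ : ∀ u, Φ u = ∑ x, (expWeight N x * h x / b) * h (u - x)) :
    ∃ g : G → ℝ, ∃ T ⊆ S, b ^ k / 8 ≤ ∑ t ∈ T, r t ∧
      ∀ t ∈ T, ∑ u with k * (ε * (Φ u + a)) < |g (u + t) - k * Φ u|, ω u ≤
        4 * Real.exp (-(k * ε ^ 2 * a / 4)) := by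
  classical
  set p : G → ℝ := fun x => expWeight N x * h x / b with hp
  have hp0 : ∀ x, 0 ≤ p x := fun x => div_nonneg (mul_nonneg (expWeight_nonneg _ _) (h0 _)) hb0.le
  have hp1 : ∑ x, p x = 1 := by
    simp only [hp]
    rw [← Finset.sum_div, hb, div_self hb0.ne']
  have hΦ' : ∀ u, Φ u = ∑ y, p y * h (u - y) := hΦ
  set e := Real.exp (-(k * ε ^ 2 * a / 4)) with he
  have he0 : 0 < e := Real.exp_pos _
  let bad : (Fin k → G) → ℝ := fun x =>
    ∑ u with k * (ε * (Φ u + a)) < |∑ i, h (u - x i) - k * Φ u|, ω u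
  have hbad0 : ∀ x, 0 ≤ bad x := fun x => Finset.sum_nonneg fun u _ => hω u
  have hP0 : ∀ x : Fin k → G, 0 ≤ ∏ i, p (x i) := fun x => Finset.prod_nonneg fun i _ => hp0 _
  have hmean : ∑ x : Fin k → G, (∏ i, p (x i)) * bad x ≤ 2 * e := by
    simp only [bad, Finset.sum_filter, Finset.mul_sum]
    rw [Finset.sum_comm]
    calc _ = ∑ u, ω u * ∑ x : Fin k → G with
            k * (ε * (Φ u + a)) < |∑ i, h (u - x i) - k * Φ u|, ∏ i, p (x i) := by
          refine Finset.sum_congr rfl fun u _ => ?_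
          rw [Finset.sum_filter, Finset.mul_sum]
          refine Finset.sum_congr rfl fun x _ => ?_
          split_ifs <;> ring
      _ ≤ ∑ u, ω u * (2 * e) := by
          refine Finset.sum_le_sum fun u _ => mul_le_mul_of_nonneg_left ?_ (hω u)
          have := chernoff_relative (X := fun x => h (u - x)) hp0 hp1 (fun _ => h0 _)
            (fun _ => h1 _) hε0 hε1 ha k
          rwa [← hΦ' u] at this
      _ = 2 * e := by rw [← Finset.sum_mul, hω1, one_mul]
  -- The good samples: by Markov's inequality they have probability at least 1/2.
  let L : Finset (Fin k → G) := univ.filter fun x => bad x ≤ 4 * e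
  have hL : 1 / 2 ≤ ∑ x ∈ L, ∏ i, p (x i) := by
    have hsplit := Finset.sum_filter_add_sum_filter_not univ (fun x => bad x ≤ 4 * e)
      (fun x : Fin k → G => ∏ i, p (x i))
    rw [sum_prod_eq_one hp1] at hsplit
    have : (∑ x with ¬ bad x ≤ 4 * e, ∏ i, p (x i)) * (4 * e) ≤ 2 * e := by
      refine le_trans ?_ hmean
      rw [Finset.sum_mul]
      refine le_trans (Finset.sum_le_sum fun x hx => ?_)
        (Finset.sum_le_sum_of_subset_of_nonneg (filter_subset _ _)
          fun x _ _ => mul_nonneg (hP0 x) (hbad0 x))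
      exact mul_le_mul_of_nonneg_left (not_le.1 (mem_filter.1 hx).2).le (hP0 x)
    have h2 : (∑ x with ¬ bad x ≤ 4 * e, ∏ i, p (x i)) ≤ 1 / 2 := by
      refine le_of_mul_le_mul_right (this.trans_eq ?_) (show 0 < 4 * e by positivity)
      ring
    linarith
  let V : (Fin k → G) → ℝ := fun x => ∏ i, expWeight N (x i)
  have hV0 : ∀ x, 0 ≤ V x := fun x => Finset.prod_nonneg fun i _ => expWeight_nonneg _ _
  -- Since `b * p ≤ expWeight N`, passing from the sampling measure to the product of the weights
  -- costs only `b ^ k`.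
  have hVL : b ^ k / 2 ≤ ∑ x ∈ L, V x := by
    have hle : ∀ x, b ^ k * ∏ i, p (x i) ≤ V x := fun x => by
      have : b ^ k * ∏ i, p (x i) = ∏ i, b * p (x i) := by
        rw [Finset.prod_mul_distrib, Finset.prod_const, card_univ, Fintype.card_fin]
      rw [this]
      refine Finset.prod_le_prod (fun i _ => mul_nonneg hb0.le (hp0 _)) fun i _ => ?_
      simp only [hp]
      rw [mul_div_cancel₀ _ hb0.ne']
      exact mul_le_of_le_one_right (expWeight_nonneg _ _) (h1 _)
    calc b ^ k / 2 = b ^ k * (1 / 2) := by ring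
      _ ≤ b ^ k * ∑ x ∈ L, ∏ i, p (x i) := by gcongr
      _ ≤ _ := by rw [Finset.mul_sum]; exact Finset.sum_le_sum fun x _ => hle x
  -- Shifting all `k` coordinates by `t` costs at most `exp (-k θ) ≥ 1/2`, so the translate of the
  -- good set is still large for each `t`.
  have hshift : ∀ t ∈ S, b ^ k / 4 ≤ ∑ x, V x * if (fun i => x i - t) ∈ L then 1 else 0 := by
    intro t ht
    rw [← Equiv.sum_comp (Equiv.addRight (fun _ : Fin k => t))]
    have e1 : ∀ x : Fin k → G, (fun i => (Equiv.addRight (fun _ : Fin k => t)) x i - t) = x := by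
      intro x; ext i; simp
    simp only [e1, mul_ite, mul_one, mul_zero]
    rw [← Finset.sum_filter, Finset.filter_mem_eq_inter, Finset.univ_inter]
    have hexp : 1 / 2 ≤ Real.exp (-(k * N t)) := by
      have h3 : (k : ℝ) * N t ≤ 1 / 2 :=
        (mul_le_mul_of_nonneg_left (hS t ht) (Nat.cast_nonneg k)).trans hkθ
      have := Real.add_one_le_exp (-(k * N t))
      linarith
    calc b ^ k / 4 = 1 / 2 * (b ^ k / 2) := by ring
      _ ≤ Real.exp (-(k * N t)) * ∑ x ∈ L, V x := by gcongr
      _ ≤ _ := by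
        rw [Finset.mul_sum]
        exact Finset.sum_le_sum fun x _ => prod_expWeight_add_ge N x t
  have havg : b ^ k / 8 ≤ ∑ x, V x * ∑ t ∈ S, r t * if (fun i => x i - t) ∈ L then 1 else 0 := by
    calc b ^ k / 8 = 1 / 2 * (b ^ k / 4) := by ring
      _ ≤ (∑ t ∈ S, r t) * (b ^ k / 4) := by gcongr
      _ ≤ ∑ t ∈ S, r t * ∑ x, V x * if (fun i => x i - t) ∈ L then 1 else 0 := by
        rw [Finset.sum_mul]
        exact Finset.sum_le_sum fun t ht => mul_le_mul_of_nonneg_left (hshift t ht) (hr t)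
      _ = _ := by
        simp only [Finset.mul_sum]
        rw [Finset.sum_comm]
        refine Finset.sum_congr rfl fun x _ => Finset.sum_congr rfl fun t _ => ?_
        ring
  -- One tuple `y` is good after many shifts `t` at once. The sample sum of `y - t` at `u` is the
  -- sample sum `g` of `y` at `u + t`, so the same `g` serves all `t ∈ T`.
  obtain ⟨y, hy⟩ := exists_le_of_le_sum_mul hV0 (sum_prod_eq_one (sum_expWeight N) k) havg
  refine ⟨fun v => ∑ i, h (v - y i), S.filter fun t => (fun i => y i - t) ∈ L,
    filter_subset _ _, ?_, ?_⟩
  · simpa [Finset.sum_filter] using hy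
  · intro t ht
    have := (mem_filter.1 (mem_filter.1 ht).2).2
    simp only [bad] at this
    convert! this using 6
    refine Finset.sum_congr rfl fun i _ => ?_
    congr 1; abel

end ShiftSet

/-! ### Iterated smoothing along almost-periods. -/

section Smoothing

variable {G : Type*} [AddCommGroup G] [Fintype G]

/-- The convolution of `f` with `p` and with the reflection of `p`. -/
noncomputable def smoothing (p f : G → ℝ) (u : G) : ℝ :=
  ∑ t, ∑ t', p t * p t' * f (u + t - t')

lemma sum_sum_mul_le {ι : Type*} [Fintype ι] {p : ι → ℝ} (hp : ∀ i, 0 ≤ p i)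
    (hp1 : ∑ i, p i = 1) {X : ι → ι → ℝ} {C : ℝ}
    (hX : ∀ i j, p i ≠ 0 → p j ≠ 0 → X i j ≤ C) : ∑ i, ∑ j, p i * p j * X i j ≤ C := by
  calc ∑ i, ∑ j, p i * p j * X i j ≤ ∑ i, ∑ j, p i * p j * C := by
        refine Finset.sum_le_sum fun i _ => Finset.sum_le_sum fun j _ => ?_
        by_cases hi : p i = 0
        · simp [hi]
        by_cases hj : p j = 0
        · simp [hj]
        exact mul_le_mul_of_nonneg_left (hX i j hi hj) (mul_nonneg (hp i) (hp j))
    _ = C := by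
        simp only [← Finset.sum_mul, ← Finset.mul_sum, hp1, mul_one, one_mul]

lemma smoothing_nonneg {p f : G → ℝ} (hp : ∀ t, 0 ≤ p t) (hf : ∀ u, 0 ≤ f u) (u : G) :
    0 ≤ smoothing p f u :=
  Finset.sum_nonneg fun t _ => Finset.sum_nonneg fun t' _ =>
    mul_nonneg (mul_nonneg (hp t) (hp t')) (hf _)

/-- Convolving with `p` and with its reflection is a self-adjoint operation, so the smoothing can be
moved onto `φ`. -/
lemma sum_smoothing_mul (p f φ : G → ℝ) :
    ∑ u, smoothing p f u * φ u = ∑ t, ∑ t', p t * p t' * ∑ u, f u * φ (u + t - t') := by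
  calc ∑ u, smoothing p f u * φ u = ∑ t, ∑ t', ∑ u, p t * p t' * f (u + t - t') * φ u := by
        unfold smoothing
        simp only [Finset.sum_mul]
        rw [Finset.sum_comm]
        exact Finset.sum_congr rfl fun t _ => Finset.sum_comm
    _ = ∑ t, ∑ t', p t' * p t * ∑ u, f u * φ (u + t' - t) := by
        refine Finset.sum_congr rfl fun t _ => Finset.sum_congr rfl fun t' _ => ?_
        rw [← Equiv.sum_comp (Equiv.addRight (t' - t)), Finset.mul_sum]
        refine Finset.sum_congr rfl fun u _ => ?_
        simp only [Equiv.coe_addRight]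
        rw [show u + (t' - t) + t - t' = u by abel, add_sub_assoc]
        ring
    _ = _ := Finset.sum_comm

lemma sum_smoothing {p : G → ℝ} (hp1 : ∑ t, p t = 1) (f : G → ℝ) :
    ∑ u, smoothing p f u = ∑ u, f u := by
  have := sum_smoothing_mul p f 1
  simp only [Pi.one_apply, mul_one] at this
  rw [this]
  simp only [← Finset.sum_mul, ← Finset.mul_sum, hp1, mul_one, one_mul]

lemma smoothing_le {p f : G → ℝ} (hp : ∀ t, 0 ≤ p t) (hp1 : ∑ t, p t = 1)
    {Q : AddGroupSeminorm G} {θ B : ℝ} (hpQ : ∀ t, p t ≠ 0 → Q t ≤ θ) (hB : 0 ≤ B)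
    (hf : ∀ u, f u ≤ B * expWeight Q u) (u : G) :
    smoothing p f u ≤ B * Real.exp (2 * θ) * expWeight Q u := by
  refine sum_sum_mul_le hp hp1 fun t t' ht ht' => (hf _).trans ?_
  rw [mul_assoc]
  refine mul_le_mul_of_nonneg_left ?_ hB
  rw [add_sub_assoc]
  refine (expWeight_add_le Q u (t - t')).trans ?_
  have h1 := map_sub_le_add Q t t'
  have h2 := hpQ t ht
  have h3 := hpQ t' ht'
  have := expWeight_nonneg Q u
  gcongr
  linarith

lemma smoothing_ne_zero {p f : G → ℝ} {N : AddGroupSeminorm G} {θ r : ℝ}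
    (hpN : ∀ t, p t ≠ 0 → N t ≤ θ) (hf : ∀ u, f u ≠ 0 → N u ≤ r) {u : G}
    (hu : smoothing p f u ≠ 0) : N u ≤ r + 2 * θ := by
  obtain ⟨t, _, ht⟩ := Finset.exists_ne_zero_of_sum_ne_zero hu
  obtain ⟨t', _, ht'⟩ := Finset.exists_ne_zero_of_sum_ne_zero ht
  have h1 := hpN t (left_ne_zero_of_mul (left_ne_zero_of_mul ht'))
  have h2 := hpN t' (right_ne_zero_of_mul (left_ne_zero_of_mul ht'))
  have h3 := hf _ (right_ne_zero_of_mul ht')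
  have h4 := map_add_le_add N (u + t - t') (t' - t)
  rw [show u + t - t' + (t' - t) = u by abel] at h4
  have h5 := map_sub_le_add N t' t
  linarith

/-- If `Φ (u - t)` is close to `g u` for most `u`, for each `t` in the support of `p`, then
averaging along `p` twice barely increases `Φ`. -/
lemma sum_smoothing_mul_le {p f Φ g : G → ℝ} (hp : ∀ t, 0 ≤ p t) (hp1 : ∑ t, p t = 1)
    {Q : AddGroupSeminorm G} {θ B : ℝ} (hpQ : ∀ t, p t ≠ 0 → Q t ≤ θ) (hB : 0 ≤ B)
    (hf0 : ∀ u, 0 ≤ f u) (hf : ∀ u, f u ≤ B * expWeight Q u) (hΦ0 : ∀ u, 0 ≤ Φ u)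
    (hΦ1 : ∀ u, Φ u ≤ 1) {k ε a e : ℝ} (hk : 0 < k) (hε0 : 0 ≤ ε) (hε1 : ε ≤ 1 / 3) (ha : 0 ≤ a)
    (hbad : ∀ t, p t ≠ 0 →
      ∑ u with k * (ε * (Φ u + a)) < |g (u + t) - k * Φ u|, expWeight Q u ≤ e) :
    ∑ u, smoothing p f u * Φ u ≤
      (1 + 3 * ε) * ∑ u, f u * Φ u + 3 * ε * a * ∑ u, f u + B * (1 + Real.exp (2 * θ)) * e := by
  rw [sum_smoothing_mul]
  refine sum_sum_mul_le hp hp1 fun t t' ht ht' => ?_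
  -- Both `k Φ u` and `k Φ (u + t - t')` are compared with the same value `g (u + t)`. At
  -- exceptional points the trivial bound `Φ ≤ 1` is used, which is why `f ≤ B * expWeight Q` is
  -- needed.
  have hpt : ∀ u, f u * Φ (u + t - t') ≤ ((1 + 3 * ε) * (f u * Φ u) + 3 * ε * a * f u) +
      (B * (if k * (ε * (Φ u + a)) < |g (u + t) - k * Φ u| then expWeight Q u else 0) +
       B * (if k * (ε * (Φ (u + t - t') + a)) < |g (u + t - t' + t') - k * Φ (u + t - t')|
        then expWeight Q u else 0)) := by
    intro u
    have hw := expWeight_nonneg Q u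
    have hBw : 0 ≤ B * expWeight Q u := mul_nonneg hB hw
    have h1 : f u * Φ (u + t - t') ≤ B * expWeight Q u :=
      (mul_le_of_le_one_right (hf0 u) (hΦ1 _)).trans (hf u)
    have h2 : 0 ≤ (1 + 3 * ε) * (f u * Φ u) + 3 * ε * a * f u := by
      have := hf0 u; have := hΦ0 u; positivity
    split_ifs with h3 h4 h4
    · linarith
    · linarith
    · linarith
    · rw [show u + t - t' + t' = u + t by abel] at h4
      have e1 := (abs_le.1 (not_lt.1 h3)).2
      have e2 := (abs_le.1 (not_lt.1 h4)).1
      have e3 : k * Φ (u + t - t') - k * Φ u ≤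
          k * (ε * (Φ (u + t - t') + a)) + k * (ε * (Φ u + a)) := by linarith
      have e4 : Φ (u + t - t') - Φ u ≤ ε * (Φ (u + t - t') + a) + ε * (Φ u + a) := by
        refine le_of_mul_le_mul_left ?_ hk
        linarith
      -- This is `(1 + ε)/(1 - ε) ≤ 1 + 3ε` and `2ε/(1 - ε) ≤ 3ε`, valid for `ε ≤ 1/3`.
      have e5 : (1 - ε) * Φ (u + t - t') ≤ (1 - ε) * ((1 + 3 * ε) * Φ u + 3 * ε * a) := by
        have p1 : 0 ≤ (ε - 3 * ε ^ 2) * Φ u := mul_nonneg (by nlinarith) (hΦ0 u)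
        have p2 : 0 ≤ (ε - 3 * ε ^ 2) * a := mul_nonneg (by nlinarith) ha
        nlinarith
      have e6 := le_of_mul_le_mul_left e5 (by linarith)
      have e7 := mul_le_mul_of_nonneg_left e6 (hf0 u)
      linarith
  refine (Finset.sum_le_sum fun u _ => hpt u).trans ?_
  rw [Finset.sum_add_distrib, Finset.sum_add_distrib, Finset.sum_add_distrib, ← Finset.mul_sum,
    ← Finset.mul_sum, ← Finset.mul_sum, ← Finset.mul_sum, ← Finset.sum_filter]
  have hb1 := hbad t ht
  -- The second exceptional set is a translate by `t - t'` of the one for `t'`, whose `Q`-weight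
  -- grows by at most `exp (2θ)`.
  have hb2 : ∑ u, (if k * (ε * (Φ (u + t - t') + a)) <
      |g (u + t - t' + t') - k * Φ (u + t - t')| then expWeight Q u else 0) ≤
      Real.exp (2 * θ) * e := by
    refine le_trans ?_ (mul_le_mul_of_nonneg_left (hbad t' ht') (Real.exp_pos _).le)
    rw [Finset.sum_filter, Finset.mul_sum,
      ← Equiv.sum_comp (Equiv.addRight (t - t')) (fun u => Real.exp (2 * θ) * _)]
    refine Finset.sum_le_sum fun u _ => ?_
    simp only [Equiv.coe_addRight, ← add_sub_assoc]
    split_ifs with h5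
    · have h6 := expWeight_add_le Q (u + t - t') (t' - t)
      rw [show u + t - t' + (t' - t) = u by abel] at h6
      refine h6.trans ?_
      have h7 := map_sub_le_add Q t' t
      have h8 := hpQ t ht
      have h9 := hpQ t' ht'
      have := expWeight_nonneg Q (u + t - t')
      gcongr
      linarith
    · simp
  have m1 := mul_le_mul_of_nonneg_left hb1 hB
  have m2 := mul_le_mul_of_nonneg_left hb2 hB
  linarith

lemma iterate_smoothing_nonneg {p f : G → ℝ} (hp : ∀ t, 0 ≤ p t) (hf : ∀ u, 0 ≤ f u) (j : ℕ)
    (u : G) : 0 ≤ (smoothing p)^[j] f u := by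
  induction j generalizing u with
  | zero => exact hf u
  | succ j ih => rw [Function.iterate_succ_apply']; exact smoothing_nonneg hp ih u

lemma sum_iterate_smoothing {p : G → ℝ} (hp1 : ∑ t, p t = 1) (f : G → ℝ) (j : ℕ) :
    ∑ u, (smoothing p)^[j] f u = ∑ u, f u := by
  induction j with
  | zero => rfl
  | succ j ih => rw [Function.iterate_succ_apply', sum_smoothing hp1, ih]

lemma iterate_smoothing_le {p f : G → ℝ} (hp : ∀ t, 0 ≤ p t) (hp1 : ∑ t, p t = 1)
    {Q : AddGroupSeminorm G} {θ B : ℝ} (hpQ : ∀ t, p t ≠ 0 → Q t ≤ θ) (hB : 0 ≤ B)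
    (hf : ∀ u, f u ≤ B * expWeight Q u) (j : ℕ) (u : G) :
    (smoothing p)^[j] f u ≤ B * Real.exp (2 * θ * j) * expWeight Q u := by
  induction j generalizing u with
  | zero => simpa using hf u
  | succ j ih =>
    rw [Function.iterate_succ_apply']
    refine (smoothing_le hp hp1 hpQ (by positivity) ih u).trans_eq ?_
    rw [mul_assoc B, ← Real.exp_add]
    congr 3
    push_cast; ring

lemma iterate_smoothing_ne_zero {p f : G → ℝ} {N : AddGroupSeminorm G} {θ r : ℝ}
    (hpN : ∀ t, p t ≠ 0 → N t ≤ θ) (hf : ∀ u, f u ≠ 0 → N u ≤ r) (j : ℕ) {u : G}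
    (hu : (smoothing p)^[j] f u ≠ 0) : N u ≤ r + 2 * θ * j := by
  induction j generalizing u with
  | zero => simpa using hf u hu
  | succ j ih =>
    rw [Function.iterate_succ_apply'] at hu
    refine (smoothing_ne_zero hpN (fun v hv => ih hv) hu).trans_eq ?_
    push_cast; ring

/-- Each round costs a factor `1 + 3ε` and an additive error. The domination by `expWeight Q`
worsens by `exp (2θ)` per round, hence stays below `3B` while `2θl ≤ 1`; the constant 12 is `3 * (1
+ 3)`. -/
lemma sum_iterate_smoothing_mul_le {p f Φ g : G → ℝ} (hp : ∀ t, 0 ≤ p t) (hp1 : ∑ t, p t = 1)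
    {Q : AddGroupSeminorm G} {θ B : ℝ} (hθ : 0 ≤ θ) (hpQ : ∀ t, p t ≠ 0 → Q t ≤ θ) (hB : 0 ≤ B)
    (hf0 : ∀ u, 0 ≤ f u) (hf1 : ∑ u, f u = 1) (hf : ∀ u, f u ≤ B * expWeight Q u)
    (hΦ0 : ∀ u, 0 ≤ Φ u) (hΦ1 : ∀ u, Φ u ≤ 1) {k ε a e : ℝ} (hk : 0 < k) (hε0 : 0 ≤ ε)
    (hε1 : ε ≤ 1 / 3) (ha : 0 ≤ a) (he : 0 ≤ e)
    (hbad : ∀ t, p t ≠ 0 →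
      ∑ u with k * (ε * (Φ u + a)) < |g (u + t) - k * Φ u|, expWeight Q u ≤ e)
    {l : ℕ} (hl : 2 * θ * l ≤ 1) (hθ1 : 2 * θ ≤ 1) :
    ∑ u, (smoothing p)^[l] f u * Φ u ≤
      (1 + 3 * ε) ^ l * (∑ u, f u * Φ u + l * (3 * ε * a + 12 * B * e)) := by
  have hexp : ∀ x : ℝ, x ≤ 1 → Real.exp x ≤ 3 := fun x hx =>
    (Real.exp_le_exp.2 hx).trans (Real.exp_one_lt_d9.le.trans (by norm_num))
  have key : ∀ j : ℕ, j ≤ l → ∑ u, (smoothing p)^[j] f u * Φ u ≤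
      (1 + 3 * ε) ^ j * (∑ u, f u * Φ u + j * (3 * ε * a + 12 * B * e)) := by
    intro j
    induction j with
    | zero => intro _; simp
    | succ j ih =>
      intro hj
      have ih := ih (by omega)
      have hjl : 2 * θ * j ≤ 1 := by
        refine le_trans ?_ hl
        gcongr
        omega
      have hB' : ∀ u, (smoothing p)^[j] f u ≤ (3 * B) * expWeight Q u := fun u => by
        refine (iterate_smoothing_le hp hp1 hpQ hB hf j u).trans ?_
        have := expWeight_nonneg Q u
        have := hexp _ hjl
        rw [mul_comm 3 B]
        gcongr
      have step := sum_smoothing_mul_le hp hp1 hpQ (by positivity)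
        (iterate_smoothing_nonneg hp hf0 j) hB' hΦ0 hΦ1 hk hε0 hε1 ha hbad
      rw [sum_iterate_smoothing hp1, hf1] at step
      rw [Function.iterate_succ_apply']
      have h3 : 3 * B * (1 + Real.exp (2 * θ)) * e ≤ 12 * B * e := by
        have := hexp _ hθ1
        have : 3 * B * (1 + Real.exp (2 * θ)) ≤ 12 * B := by nlinarith
        gcongr
      have h4 : 1 ≤ (1 + 3 * ε) ^ (j + 1) := one_le_pow₀ (by linarith)
      have h5 : 0 ≤ 3 * ε * a + 12 * B * e := by positivity
      calc _ ≤ (1 + 3 * ε) * ∑ u, (smoothing p)^[j] f u * Φ u + 1 * (3 * ε * a + 12 * B * e) := by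
            linarith
        _ ≤ (1 + 3 * ε) * ((1 + 3 * ε) ^ j * (∑ u, f u * Φ u + j * (3 * ε * a + 12 * B * e))) +
            (1 + 3 * ε) ^ (j + 1) * (3 * ε * a + 12 * B * e) := by gcongr
        _ = _ := by push_cast; ring
  exact key l le_rfl

end Smoothing

/-! ### Characters and Parseval. -/

section Fourier

variable {G : Type*} [AddCommGroup G] [Fintype G]

/-- The Fourier transform of a real function on a finite abelian group. -/
noncomputable def charSum (f : G → ℝ) (χ : AddChar G ℂ) : ℂ := ∑ x, (f x : ℂ) * χ x

lemma norm_charSum_le {f : G → ℝ} (hf : ∀ x, 0 ≤ f x) (χ : AddChar G ℂ) :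
    ‖charSum f χ‖ ≤ ∑ x, f x := by
  refine (norm_sum_le _ _).trans_eq (Finset.sum_congr rfl fun x _ => ?_)
  rw [norm_mul, AddChar.norm_apply, mul_one, Complex.norm_real, Real.norm_of_nonneg (hf x)]

lemma conj_charSum (f : G → ℝ) (χ : AddChar G ℂ) :
    starRingEnd ℂ (charSum f χ) = ∑ x, (f x : ℂ) * χ (-x) := by
  simp [charSum, map_sum, AddChar.map_neg_eq_conj]

lemma charSum_smoothing (p f : G → ℝ) (χ : AddChar G ℂ) :
    charSum (smoothing p f) χ = charSum f χ * (charSum p χ * starRingEnd ℂ (charSum p χ)) := by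
  rw [conj_charSum]
  have h : charSum (smoothing p f) χ =
      ∑ t, ∑ t', ((p t : ℂ) * p t') * ∑ u, (f (u + t - t') : ℂ) * χ u := by
    unfold charSum smoothing
    push_cast
    simp only [Finset.sum_mul, Finset.mul_sum]
    rw [Finset.sum_comm]
    refine Finset.sum_congr rfl fun t _ => ?_
    rw [Finset.sum_comm]
    exact Finset.sum_congr rfl fun t' _ => Finset.sum_congr rfl fun u _ => by ring
  have h' : ∀ t t', ∑ u, (f (u + t - t') : ℂ) * χ u = charSum f χ * (χ (-t) * χ t') := by
    intro t t'
    rw [← Equiv.sum_comp (Equiv.addRight (t' - t)), charSum, Finset.sum_mul]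
    refine Finset.sum_congr rfl fun u _ => ?_
    simp only [Equiv.coe_addRight]
    rw [show u + (t' - t) + t - t' = u by abel, AddChar.map_add_eq_mul, sub_eq_add_neg,
      AddChar.map_add_eq_mul]
    ring
  rw [h, charSum.eq_1 p, Finset.sum_mul_sum, Finset.sum_comm]
  simp only [h', Finset.mul_sum]
  refine Finset.sum_congr rfl fun t _ => Finset.sum_congr rfl fun t' _ => ?_
  ring

/-- Each smoothing multiplies the transform by the squared modulus of that of `p`, so `l` rounds
damp every character outside the 1/2-spectrum of `p` by `4 ^ (-l)`. -/
lemma norm_charSum_iterate_smoothing (p f : G → ℝ) (χ : AddChar G ℂ) (j : ℕ) :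
    ‖charSum ((smoothing p)^[j] f) χ‖ = ‖charSum f χ‖ * ‖charSum p χ‖ ^ (2 * j) := by
  induction j with
  | zero => simp
  | succ j ih =>
    rw [Function.iterate_succ_apply', charSum_smoothing, norm_mul, norm_mul, RCLike.norm_conj, ih]
    ring

lemma charSum_shift_sub (f : G → ℝ) (t : G) (χ : AddChar G ℂ) :
    charSum (fun v => f (v - t) - f v) χ = (χ t - 1) * charSum f χ := by
  unfold charSum
  push_cast
  simp only [sub_mul, Finset.sum_sub_distrib, one_mul, Finset.mul_sum]
  congr 1
  rw [← Equiv.sum_comp (Equiv.addRight t)]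
  refine Finset.sum_congr rfl fun x _ => ?_
  simp only [Equiv.coe_addRight, add_sub_cancel_right, AddChar.map_add_eq_mul]
  ring

lemma sum_norm_charSum_sq (f : G → ℝ) :
    ∑ χ, ‖charSum f χ‖ ^ 2 = Fintype.card G * ∑ x, f x ^ 2 := by
  classical
  have h : ∀ χ : AddChar G ℂ, ((‖charSum f χ‖ ^ 2 : ℝ) : ℂ) =
      ∑ x, ∑ y, (f x : ℂ) * f y * χ (x - y) := by
    intro χ
    push_cast
    rw [← Complex.mul_conj', conj_charSum, charSum, Finset.sum_mul_sum]
    refine Finset.sum_congr rfl fun x _ => Finset.sum_congr rfl fun y _ => ?_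
    rw [sub_eq_add_neg, AddChar.map_add_eq_mul]; ring
  have : ((∑ χ, ‖charSum f χ‖ ^ 2 : ℝ) : ℂ) = ((Fintype.card G * ∑ x, f x ^ 2 : ℝ) : ℂ) := by
    rw [Complex.ofReal_sum]
    simp only [h]
    rw [Finset.sum_comm, Finset.sum_congr rfl fun x _ => Finset.sum_comm]
    simp only [← Finset.mul_sum, AddChar.sum_apply_eq_ite, sub_eq_zero, mul_ite, mul_zero,
      Finset.sum_ite_eq, Finset.mem_univ, if_true]
    push_cast
    rw [Finset.mul_sum]
    exact Finset.sum_congr rfl fun x _ => by ring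
  exact_mod_cast this

/-- The trilinear form `∑ ψ (x + y) f x f y` is bounded by the sup norm of the Fourier transform of
`ψ`. -/
lemma abs_sum_sum_mul_le {f ψ : G → ℝ} {M : ℝ} (hM : ∀ χ, ‖charSum ψ χ‖ ≤ M) :
    |∑ v, ∑ x, ψ v * (f x * f (v - x))| ≤ M * ∑ x, f x ^ 2 := by
  classical
  have hc : (0 : ℝ) < Fintype.card G := by exact_mod_cast Fintype.card_pos
  -- Fourier inversion of the trilinear form; Parseval then handles the two factors of `f`.
  have key : ∑ χ, charSum ψ χ * (starRingEnd ℂ (charSum f χ)) ^ 2 =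
      ((Fintype.card G * ∑ v, ∑ x, ψ v * (f x * f (v - x)) : ℝ) : ℂ) := by
    have h : ∀ χ : AddChar G ℂ, charSum ψ χ * (starRingEnd ℂ (charSum f χ)) ^ 2 =
        ∑ v, ∑ x, ∑ y, (ψ v : ℂ) * f x * f y * χ (v - x - y) := by
      intro χ
      rw [sq, conj_charSum, charSum, Finset.sum_mul_sum, Finset.sum_mul]
      simp only [Finset.mul_sum]
      refine Finset.sum_congr rfl fun v _ => Finset.sum_congr rfl fun x _ =>
        Finset.sum_congr rfl fun y _ => ?_
      rw [sub_eq_add_neg, sub_eq_add_neg, AddChar.map_add_eq_mul, AddChar.map_add_eq_mul]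
      ring
    simp only [h]
    rw [Finset.sum_comm]
    push_cast
    rw [Finset.mul_sum]
    refine Finset.sum_congr rfl fun v _ => ?_
    rw [Finset.sum_comm, Finset.mul_sum]
    refine Finset.sum_congr rfl fun x _ => ?_
    rw [Finset.sum_comm]
    simp only [← Finset.mul_sum, AddChar.sum_apply_eq_ite, sub_eq_zero, mul_ite, mul_zero,
      Finset.sum_ite_eq, Finset.mem_univ, if_true]
    ring
  have h1 : ‖∑ χ, charSum ψ χ * (starRingEnd ℂ (charSum f χ)) ^ 2‖ ≤
      M * (Fintype.card G * ∑ x, f x ^ 2) := by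
    rw [← sum_norm_charSum_sq, Finset.mul_sum]
    refine (norm_sum_le _ _).trans (Finset.sum_le_sum fun χ _ => ?_)
    rw [norm_mul, norm_pow, RCLike.norm_conj]
    exact mul_le_mul_of_nonneg_right (hM χ) (by positivity)
  rw [key, Complex.norm_real, Real.norm_eq_abs, abs_mul, abs_of_pos hc] at h1
  refine le_of_mul_le_mul_left (h1.trans_eq ?_) hc
  ring

end Fourier

/-! ### Riesz products and a local Chang theorem. -/

section Chang

variable {G : Type*} [AddCommGroup G] [Fintype G]

/-- Averaging against a weight is diagonal on characters, with the transform of the weight as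
eigenvalues. -/
lemma ofReal_iterate_localDensity {ι : Type*} [Fintype ι] (N : AddGroupSeminorm G) {f : G → ℝ}
    {w : ι → ℂ} {χ : ι → AddChar G ℂ} (hf : ∀ x, (f x : ℂ) = ∑ i, w i * χ i x) (m : ℕ) (x : G) :
    (((localDensity N)^[m] f x : ℝ) : ℂ) =
      ∑ i, w i * charSum (expWeight N) (χ i) ^ m * χ i x := by
  induction m generalizing x with
  | zero => simpa using hf x
  | succ m ih =>
    rw [Function.iterate_succ_apply', localDensity]
    push_cast
    simp only [ih, Finset.mul_sum]
    rw [Finset.sum_comm]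
    refine Finset.sum_congr rfl fun i _ => ?_
    rw [pow_succ, ← mul_assoc]
    generalize charSum (expWeight N) (χ i) ^ m = A
    rw [charSum, Finset.mul_sum, Finset.sum_mul]
    refine Finset.sum_congr rfl fun t _ => ?_
    rw [AddChar.map_add_eq_mul]
    ring

lemma iterate_localDensity_nonneg (N : AddGroupSeminorm G) {f : G → ℝ} (hf : ∀ x, 0 ≤ f x) (m : ℕ)
    (x : G) : 0 ≤ (localDensity N)^[m] f x := by
  induction m generalizing x with
  | zero => exact hf x
  | succ m ih => rw [Function.iterate_succ_apply']; exact localDensity_nonneg N ih x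

lemma IsFiner.le_sum_iterate_localDensity {θ : ℝ} {N N' : AddGroupSeminorm G}
    (hf : IsFiner θ N N') (hθ0 : 0 ≤ θ) (hθ1 : θ ≤ 1 / 2) {f : G → ℝ} (h0 : ∀ x, 0 ≤ f x) (m : ℕ) :
    (1 - 2 * θ) ^ m * ∑ x, expWeight N x * f x ≤
      ∑ x, expWeight N x * (localDensity N')^[m] f x := by
  induction m with
  | zero => simp
  | succ m ih =>
    have h := hf.le_sum_localDensity hθ0 (by linarith) (iterate_localDensity_nonneg N' h0 m) 0
    rw [sum_expWeight_mul_localDensity_comm] at h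
    simp only [localDensity.eq_1 N, zero_add] at h
    rw [Function.iterate_succ_apply', pow_succ']
    refine le_trans ?_ h
    rw [mul_assoc]
    exact mul_le_mul_of_nonneg_left ih (by linarith)

/-- An exponential lower bound for a Riesz factor, which makes Jensen's inequality applicable to the
whole product. -/
lemma exp_sub_le_one_add {z : ℝ} (hz : |z| ≤ 1 / 8) : Real.exp (z - 2 * z ^ 2) ≤ 1 + z := by
  obtain ⟨h1, h2⟩ := abs_le.1 hz
  have hy : |z - 2 * z ^ 2| ≤ 1 := abs_le.2 ⟨by nlinarith, by nlinarith⟩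
  have h3 := (abs_le.1 (Real.abs_exp_sub_one_sub_id_le hy)).2
  have h4 : (z - 2 * z ^ 2) ^ 2 ≤ 2 * z ^ 2 := by
    have : (z - 2 * z ^ 2) ^ 2 = z ^ 2 * (1 - 2 * z) ^ 2 := by ring
    have h5 : (1 - 2 * z) ^ 2 ≤ 2 := by nlinarith
    have := mul_le_mul_of_nonneg_left h5 (sq_nonneg z)
    linarith
  linarith

lemma exp_sum_mul_le {ι : Type*} [Fintype ι] {p Y : ι → ℝ} (hp : ∀ i, 0 ≤ p i)
    (hp1 : ∑ i, p i = 1) : Real.exp (∑ i, p i * Y i) ≤ ∑ i, p i * Real.exp (Y i) := by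
  have := convexOn_exp.map_sum_le (t := univ) (w := p) (p := Y) (fun i _ => hp i) hp1
    (fun i _ => Set.mem_univ _)
  simpa using this

/-- The coefficients of the factor `1 + Re (c z) / 8` of a Riesz product, as a trigonometric
polynomial in `z`. -/
noncomputable def rieszCoeff (c : ℂ) : SignType → ℂ
  | 0 => 1
  | 1 => c / 16
  | -1 => starRingEnd ℂ c / 16

lemma norm_rieszCoeff_le {c : ℂ} (hc : ‖c‖ ≤ 1) (s : SignType) : ‖rieszCoeff c s‖ ≤ 1 := by
  cases s
  · change ‖(1 : ℂ)‖ ≤ 1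
    simp
  · change ‖starRingEnd ℂ c / 16‖ ≤ 1
    rw [norm_div, RCLike.norm_conj]
    norm_num
    linarith
  · change ‖c / 16‖ ≤ 1
    rw [norm_div]
    norm_num
    linarith

lemma sum_rieszCoeff_mul {c z : ℂ} (hz : ‖z‖ = 1) :
    ∑ s : SignType, rieszCoeff c s * z ^ (s : ℤ) = ((1 + (c * z).re / 8 : ℝ) : ℂ) := by
  have hu : (univ : Finset SignType) = {0, -1, 1} := rfl
  rw [hu, Finset.sum_insert (by decide), Finset.sum_insert (by decide), Finset.sum_singleton]
  have h1 : rieszCoeff c 0 = 1 := rfl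
  have h2 : rieszCoeff c (-1) = starRingEnd ℂ c / 16 := rfl
  have h3 : rieszCoeff c 1 = c / 16 := rfl
  have h4 : z⁻¹ = starRingEnd ℂ z := Complex.inv_eq_conj hz
  have h5 : ((c * z).re : ℂ) = (c * z + starRingEnd ℂ (c * z)) / 2 := by
    rw [Complex.re_eq_add_conj]
  rw [h1, h2, h3]
  push_cast
  rw [h5]
  simp only [SignType.coe_zero, zpow_zero, zpow_neg_one, SignType.coe_one,
    zpow_one, h4, map_mul]
  ring

/-- Many dissociated characters in the large spectrum of `p` force `p` to be concentrated. -/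
lemma exp_card_le_of_dissociated {ι : Type*} [Fintype ι] {θ τ : ℝ}
    {N N' : AddGroupSeminorm G} (hf : IsFiner θ N N') (hθ0 : 0 ≤ θ)
    (hm : Fintype.card ι * θ ≤ 1 / 4) (hθ1 : θ ≤ 1 / 2) {p : G → ℝ} (hp : ∀ x, 0 ≤ p x)
    (hp1 : ∑ x, p x = 1) (hτ : 0 < τ) (hpN : ∀ x, p x ≤ τ⁻¹ * expWeight N x)
    (χ : ι → AddChar G ℂ) (hχ : ∀ i, 1 / 2 ≤ ‖charSum p (χ i)‖)
    (hdis : ∀ e : ι → SignType, e ≠ 0 →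
      ‖charSum (expWeight N') (∏ i, χ i ^ (e i : ℤ))‖ ≤ 1 / 3) :
    Real.exp (Fintype.card ι / 32) ≤ 4 / τ := by
  classical
  set m := Fintype.card ι with hmdef
  -- Phases chosen so that each `c i * χ i` has mean `‖charSum p (χ i)‖`, a real number at least
  -- 1/2, under `p`.
  let c : ι → ℂ := fun i => starRingEnd ℂ (charSum p (χ i)) / ‖charSum p (χ i)‖
  have hpos : ∀ i, 0 < ‖charSum p (χ i)‖ := fun i => lt_of_lt_of_le (by norm_num) (hχ i)
  have hc : ∀ i, ‖c i‖ = 1 := fun i => by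
    simp only [c, norm_div, RCLike.norm_conj, Complex.norm_real, norm_norm]
    exact div_self (hpos i).ne'
  let z : ι → G → ℝ := fun i x => (c i * χ i x).re / 8
  have hz : ∀ i x, |z i x| ≤ 1 / 8 := fun i x => by
    have : |(c i * χ i x).re| ≤ 1 := (Complex.abs_re_le_norm _).trans_eq (by
      rw [norm_mul, hc, AddChar.norm_apply, one_mul])
    simp only [z, abs_div]
    rw [abs_of_pos (show (0 : ℝ) < 8 by norm_num)]
    linarith
  have hzmean : ∀ i, 1 / 16 ≤ ∑ x, p x * z i x := fun i => by
    have h1 : ∑ x, p x * z i x = ‖charSum p (χ i)‖ / 8 := by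
      have h2 : ((‖charSum p (χ i)‖ : ℝ) : ℂ) = c i * charSum p (χ i) := by
        simp only [c]
        rw [div_mul_eq_mul_div, Complex.conj_mul', sq,
          mul_div_assoc, div_self (by exact_mod_cast (hpos i).ne'), mul_one]
      have h3 : ‖charSum p (χ i)‖ = (c i * charSum p (χ i)).re := by
        rw [← h2, Complex.ofReal_re]
      rw [h3, charSum, Finset.mul_sum, Complex.re_sum, Finset.sum_div]
      refine Finset.sum_congr rfl fun x _ => ?_
      simp only [z]
      rw [mul_left_comm, Complex.re_ofReal_mul]
      ring
    rw [h1]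
    have := hχ i
    linarith
  let P : G → ℝ := fun x => ∏ i, (1 + z i x)
  have hP0 : ∀ x, 0 ≤ P x := fun x => Finset.prod_nonneg fun i _ => by
    have := (abs_le.1 (hz i x)).1
    linarith
  -- Each factor contributes its mean, at least 1/16, minus a quadratic error at most `2 / 8² =
  -- 1/32`.
  have lower : Real.exp (m / 32) ≤ ∑ x, p x * P x := by
    have h1 : (m : ℝ) / 32 ≤ ∑ x, p x * ∑ i, (z i x - 2 * z i x ^ 2) := by
      simp only [Finset.mul_sum]
      rw [Finset.sum_comm]
      calc (m : ℝ) / 32 = ∑ _i : ι, (1 / 32 : ℝ) := by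
            rw [Finset.sum_const, card_univ, nsmul_eq_mul]; ring
        _ ≤ _ := by
            refine Finset.sum_le_sum fun i _ => ?_
            have h2 : ∑ x, p x * (2 * z i x ^ 2) ≤ ∑ x, p x * (1 / 32) := by
              refine Finset.sum_le_sum fun x _ => mul_le_mul_of_nonneg_left ?_ (hp x)
              have := sq_le_sq' (by linarith [(abs_le.1 (hz i x)).1]) (abs_le.1 (hz i x)).2
              linarith
            rw [← Finset.sum_mul, hp1] at h2
            simp only [mul_sub, Finset.sum_sub_distrib]
            have := hzmean i
            linarith
    refine (Real.exp_le_exp.2 h1).trans ((exp_sum_mul_le hp hp1).trans ?_)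
    refine Finset.sum_le_sum fun x _ => mul_le_mul_of_nonneg_left ?_ (hp x)
    rw [Real.exp_sum]
    exact Finset.prod_le_prod (fun i _ => (Real.exp_pos _).le)
      fun i _ => exp_sub_le_one_add (hz i x)
  have hexpand : ∀ x, (P x : ℂ) = ∑ e : ι → SignType,
      (∏ i, rieszCoeff (c i) (e i)) * (∏ i, χ i ^ (e i : ℤ)) x := by
    intro x
    simp only [P, z]
    rw [Complex.ofReal_prod]
    have : ∀ i, ((1 + (c i * χ i x).re / 8 : ℝ) : ℂ) =
        ∑ s : SignType, rieszCoeff (c i) s * (χ i x) ^ (s : ℤ) := fun i =>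
      (sum_rieszCoeff_mul (AddChar.norm_apply _ _)).symm
    simp only [this]
    rw [Fintype.prod_sum]
    refine Finset.sum_congr rfl fun e _ => ?_
    rw [Finset.prod_mul_distrib, AddChar.prod_apply]
    simp only [AddChar.zpow_apply]
  -- The trivial term contributes at most 1. The expansion has `3 ^ m` terms, and by dissociativity
  -- `m` averagings along `N'` shrink each non-trivial one to at most `3 ^ (-m)`. Local
  -- dissociativity thus replaces the exact orthogonality of the global argument.
  have upper : ∑ x, expWeight N x * (localDensity N')^[m] P x ≤ 2 := by
    have h1 : ((∑ x, expWeight N x * (localDensity N')^[m] P x : ℝ) : ℂ) =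
        ∑ e : ι → SignType, (∏ i, rieszCoeff (c i) (e i)) *
          charSum (expWeight N') (∏ i, χ i ^ (e i : ℤ)) ^ m *
          charSum (expWeight N) (∏ i, χ i ^ (e i : ℤ)) := by
      push_cast
      simp only [ofReal_iterate_localDensity N' hexpand m, Finset.mul_sum]
      rw [Finset.sum_comm]
      refine Finset.sum_congr rfl fun e _ => ?_
      rw [charSum.eq_1 (expWeight N), Finset.mul_sum]
      exact Finset.sum_congr rfl fun x _ => by ring
    have hN1 : ∀ χ, ‖charSum (expWeight N) χ‖ ≤ 1 := fun χ =>
      (norm_charSum_le (expWeight_nonneg N) χ).trans_eq (sum_expWeight N)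
    have hN2 : ∀ χ, ‖charSum (expWeight N') χ‖ ≤ 1 := fun χ =>
      (norm_charSum_le (expWeight_nonneg N') χ).trans_eq (sum_expWeight N')
    have hcoef : ∀ e : ι → SignType, ‖∏ i, rieszCoeff (c i) (e i)‖ ≤ 1 := fun e => by
      rw [norm_prod]
      exact Finset.prod_le_one (fun i _ => norm_nonneg _)
        fun i _ => norm_rieszCoeff_le (hc i).le _
    have hterm : ∀ e : ι → SignType, ‖(∏ i, rieszCoeff (c i) (e i)) *
          charSum (expWeight N') (∏ i, χ i ^ (e i : ℤ)) ^ m *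
          charSum (expWeight N) (∏ i, χ i ^ (e i : ℤ))‖ ≤
          (if e = 0 then 1 else 0) + (1 / 3) ^ m := by
      intro e
      rw [norm_mul, norm_mul, norm_pow]
      have k1 : ‖∏ i, rieszCoeff (c i) (e i)‖ *
          ‖charSum (expWeight N') (∏ i, χ i ^ (e i : ℤ))‖ ^ m *
          ‖charSum (expWeight N) (∏ i, χ i ^ (e i : ℤ))‖ ≤
          1 * ‖charSum (expWeight N') (∏ i, χ i ^ (e i : ℤ))‖ ^ m * 1 := by
        gcongr
        · exact hcoef e
        · exact hN1 _
      rw [one_mul, mul_one] at k1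
      refine k1.trans ?_
      split_ifs with he
      · have := pow_le_one₀ (n := m) (norm_nonneg _) (hN2 (∏ i, χ i ^ (e i : ℤ)))
        have : (0 : ℝ) ≤ (1 / 3) ^ m := by positivity
        linarith
      · rw [zero_add]
        gcongr
        exact hdis e he
    have h2 := congrArg norm h1
    rw [Complex.norm_real] at h2
    refine (le_abs_self _).trans ?_
    rw [← Real.norm_eq_abs, h2]
    refine (norm_sum_le _ _).trans ((Finset.sum_le_sum fun e _ => hterm e).trans ?_)
    rw [Finset.sum_add_distrib, Finset.sum_ite_eq' univ (0 : ι → SignType), if_pos (mem_univ _),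
      Finset.sum_const, card_univ, Fintype.card_fun]
    have h3 : Fintype.card SignType = 3 := rfl
    rw [h3, nsmul_eq_mul, ← hmdef]
    push_cast
    rw [← mul_pow]
    norm_num
  have mid := hf.le_sum_iterate_localDensity hθ0 hθ1 hP0 m
  have hhalf : 1 / 2 ≤ (1 - 2 * θ) ^ m := by
    have := one_add_mul_le_pow (a := -(2 * θ)) (by linarith) m
    have e1 : (1 : ℝ) + -(2 * θ) = 1 - 2 * θ := by ring
    rw [e1] at this
    linarith
  have hE0 : 0 ≤ ∑ x, expWeight N x * P x :=
    Finset.sum_nonneg fun x _ => mul_nonneg (expWeight_nonneg N x) (hP0 x)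
  have hE : ∑ x, expWeight N x * P x ≤ 4 := by
    have := mul_le_mul_of_nonneg_right hhalf hE0
    linarith
  calc Real.exp (m / 32) ≤ ∑ x, p x * P x := lower
    _ ≤ ∑ x, τ⁻¹ * expWeight N x * P x :=
        Finset.sum_le_sum fun x _ => mul_le_mul_of_nonneg_right (hpN x) (hP0 x)
    _ = τ⁻¹ * ∑ x, expWeight N x * P x := by simp only [Finset.mul_sum, mul_assoc]
    _ ≤ τ⁻¹ * 4 := by gcongr
    _ = 4 / τ := by ring

lemma norm_zpow_sign_sub_one_le {z : ℂ} (hz : ‖z‖ = 1) (s : SignType) :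
    ‖z ^ (s : ℤ) - 1‖ ≤ ‖z - 1‖ := by
  have hz0 : z ≠ 0 := by
    rintro rfl
    simp at hz
  cases s
  · change ‖z ^ (0 : ℤ) - 1‖ ≤ _
    simp
  · change ‖z ^ (-1 : ℤ) - 1‖ ≤ _
    rw [zpow_neg_one, show z⁻¹ - 1 = z⁻¹ * (1 - z) by rw [mul_sub, inv_mul_cancel₀ hz0, mul_one],
      norm_mul, norm_inv, hz, inv_one, one_mul, norm_sub_rev]
  · change ‖z ^ (1 : ℤ) - 1‖ ≤ _
    simp

lemma norm_prod_sub_one_le {ι : Type*} (s : Finset ι) {z : ι → ℂ} (hz : ∀ i, ‖z i‖ = 1) :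
    ‖∏ i ∈ s, z i - 1‖ ≤ ∑ i ∈ s, ‖z i - 1‖ := by
  classical
  induction s using Finset.induction_on with
  | empty => simp
  | insert i s hi ih =>
    rw [Finset.prod_insert hi, Finset.sum_insert hi]
    have : z i * ∏ j ∈ s, z j - 1 = z i * (∏ j ∈ s, z j - 1) + (z i - 1) := by ring
    rw [this]
    refine (norm_add_le _ _).trans ?_
    rw [norm_mul, hz, one_mul]
    linarith

/-- The weight is nearly invariant under a shift by `t`, while the shift multiplies the transform by
`χ t`. A character with a large transform must therefore be close to 1 at `t`. -/
lemma norm_apply_sub_one_mul_le (N : AddGroupSeminorm G) (χ : AddChar G ℂ) (t : G) :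
    ‖χ t - 1‖ * ‖charSum (expWeight N) χ‖ ≤ Real.exp (N t) - 1 := by
  rw [← norm_mul, ← charSum_shift_sub, charSum]
  refine (norm_sum_le _ _).trans ?_
  calc _ ≤ ∑ v, (Real.exp (N t) - 1) * expWeight N v := by
        refine Finset.sum_le_sum fun v _ => ?_
        rw [norm_mul, AddChar.norm_apply, mul_one, Complex.norm_real, Real.norm_eq_abs]
        have h1 := expWeight_add_le N v (-t)
        have h2 := le_expWeight_add N v (-t)
        rw [map_neg_eq_map, ← sub_eq_add_neg] at h1 h2
        have h3 := expWeight_nonneg N v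
        have h4 : 1 - Real.exp (-N t) ≤ Real.exp (N t) - 1 := by
          have := Real.add_one_le_exp (N t)
          have := Real.add_one_le_exp (-N t)
          linarith
        rw [abs_le]
        constructor <;> nlinarith
    _ = _ := by rw [← Finset.mul_sum, sum_expWeight, mul_one]

/-- The products of distinct elements of `Λ` or their inverses lie outside the large spectrum of
the weight of `N`. -/
def IsDissociated (N : AddGroupSeminorm G) (Λ : Finset (AddChar G ℂ)) : Prop :=
  ∀ e : AddChar G ℂ → SignType, (∃ γ ∈ Λ, e γ ≠ 0) →
    ‖charSum (expWeight N) (∏ γ ∈ Λ, γ ^ (e γ : ℤ))‖ ≤ 1 / 3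

lemma IsDissociated.subset {N : AddGroupSeminorm G} {Λ Λ' : Finset (AddChar G ℂ)}
    (h : IsDissociated N Λ) (hsub : Λ' ⊆ Λ) : IsDissociated N Λ' := by
  rintro e ⟨γ, hγ, hγ0⟩
  have := h (fun χ => if χ ∈ Λ' then e χ else 0) ⟨γ, hsub hγ, by simpa [hγ] using hγ0⟩
  convert this using 3
  rw [← Finset.prod_subset hsub]
  · exact Finset.prod_congr rfl fun χ hχ => by simp [hχ]
  · intro χ _ hχ
    simp [hχ]

/-- A local version of Chang's theorem: the characters in the large spectrum of `p` are controlled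
by few characters, up to the scale of `N'`. -/
lemma exists_finset_control_spectrum {θ τ : ℝ} {n : ℕ}
    {N N' : AddGroupSeminorm G} (hf : IsFiner θ N N') (hθ0 : 0 ≤ θ)
    (hn : n * θ ≤ 1 / 4) (hθ1 : θ ≤ 1 / 2) {p : G → ℝ} (hp : ∀ x, 0 ≤ p x)
    (hp1 : ∑ x, p x = 1) (hτ : 0 < τ) (hpN : ∀ x, p x ≤ τ⁻¹ * expWeight N x)
    (hnτ : 4 / τ < Real.exp (n / 32)) :
    ∃ Λ : Finset (AddChar G ℂ), Λ.card ≤ n ∧ ∀ γ, 1 / 2 ≤ ‖charSum p γ‖ → ∀ t,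
      ‖γ t - 1‖ ≤ 3 * (Real.exp (N' t) - 1) + ∑ χ ∈ Λ, ‖χ t - 1‖ := by
  classical
  let Δ : Finset (AddChar G ℂ) := univ.filter fun γ => 1 / 2 ≤ ‖charSum p γ‖
  obtain ⟨Λ, hΛ, hmax⟩ := Finset.exists_max_image
    (Δ.powerset.filter fun Λ => IsDissociated N' Λ) Finset.card
    ⟨∅, by simp [IsDissociated]⟩
  obtain ⟨hΛΔ, hdis⟩ := mem_filter.1 hΛ
  rw [mem_powerset] at hΛΔ
  refine ⟨Λ, ?_, ?_⟩
  · by_contra! hcard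
    obtain ⟨Λ', hsub, hΛ'⟩ := Finset.exists_subset_card_eq hcard.le
    have hd' := hdis.subset hsub
    have := exp_card_le_of_dissociated (ι := Λ') hf hθ0 (by simpa [hΛ'] using hn) hθ1 hp hp1 hτ hpN
      (fun γ => (γ : AddChar G ℂ)) (fun γ => (mem_filter.1 (hΛΔ (hsub γ.2))).2) (by
        intro e he
        obtain ⟨γ, hγ⟩ := Function.ne_iff.1 he
        have := hd' (fun χ => if h : χ ∈ Λ' then e ⟨χ, h⟩ else 0) ⟨γ, γ.2, by simpa using hγ⟩
        rw [← Finset.prod_coe_sort] at this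
        simpa using this)
    rw [Fintype.card_coe, hΛ'] at this
    linarith
  · intro γ hγ t
    have hexp : 0 ≤ Real.exp (N' t) - 1 := by
      have := Real.one_le_exp (apply_nonneg N' t)
      linarith
    by_cases hmem : γ ∈ Λ
    · have := Finset.single_le_sum (f := fun χ : AddChar G ℂ => ‖χ t - 1‖)
        (fun χ _ => norm_nonneg _) hmem
      linarith
    -- Maximality of `Λ` yields a signed product of `γ` and elements of `Λ` lying in the large
    -- spectrum of `N'`. By dissociativity of `Λ` the exponent of `γ` is non-zero, so the relation
    -- can be solved for `γ`.
    have hnot : ¬ IsDissociated N' (insert γ Λ) := by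
      intro hcon
      have := hmax (insert γ Λ) (mem_filter.2 ⟨mem_powerset.2 (Finset.insert_subset
        (mem_filter.2 ⟨mem_univ _, hγ⟩) hΛΔ), hcon⟩)
      rw [Finset.card_insert_of_notMem hmem] at this
      omega
    unfold IsDissociated at hnot
    push Not at hnot
    obtain ⟨e, ⟨δ, hδ, hδ0⟩, he⟩ := hnot
    rw [Finset.prod_insert hmem] at he
    have heγ : e γ ≠ 0 := by
      intro h0
      rw [h0] at he
      simp only [SignType.coe_zero, zpow_zero, one_mul] at he
      rcases Finset.mem_insert.1 hδ with rfl | hδ'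
      · exact hδ0 h0
      · exact absurd (hdis e ⟨δ, hδ', hδ0⟩) (not_le.2 he)
    set χ := γ ^ (e γ : ℤ) * ∏ δ ∈ Λ, δ ^ (e δ : ℤ) with hχ
    have h1 := norm_apply_sub_one_mul_le N' χ t
    have h2 : ‖χ t - 1‖ ≤ 3 * (Real.exp (N' t) - 1) := by
      have := norm_nonneg (χ t - 1)
      nlinarith
    have h3 : χ t = γ t ^ (e γ : ℤ) * ∏ δ ∈ Λ, δ t ^ (e δ : ℤ) := by
      rw [hχ, AddChar.mul_apply, AddChar.prod_apply]
      simp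
    have hunit : ∀ δ : AddChar G ℂ, ‖δ t ^ (e δ : ℤ)‖ = 1 := fun δ => by
      rw [norm_zpow, AddChar.norm_apply, one_zpow]
    have h4 : ‖∏ δ ∈ Λ, δ t ^ (e δ : ℤ) - 1‖ ≤ ∑ δ ∈ Λ, ‖δ t - 1‖ :=
      (norm_prod_sub_one_le Λ hunit).trans
        (Finset.sum_le_sum fun δ _ => norm_zpow_sign_sub_one_le (AddChar.norm_apply _ _) _)
    have h5 : ‖∏ δ ∈ Λ, δ t ^ (e δ : ℤ)‖ = 1 := by
      rw [norm_prod]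
      exact Finset.prod_eq_one fun δ _ => hunit δ
    have h6 : ‖γ t ^ (e γ : ℤ) - 1‖ ≤ ‖χ t - 1‖ + ‖∏ δ ∈ Λ, δ t ^ (e δ : ℤ) - 1‖ := by
      have : ‖γ t ^ (e γ : ℤ) - 1‖ = ‖χ t - ∏ δ ∈ Λ, δ t ^ (e δ : ℤ)‖ := by
        rw [h3, ← sub_one_mul, norm_mul, h5, mul_one]
      rw [this]
      have := norm_sub_le (χ t - 1) (∏ δ ∈ Λ, δ t ^ (e δ : ℤ) - 1)
      rwa [sub_sub_sub_cancel_right] at this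
    -- A non-zero sign is its own inverse, so taking the signed power again recovers `γ t`.
    have h7 : ‖γ t - 1‖ ≤ ‖γ t ^ (e γ : ℤ) - 1‖ := by
      have := norm_zpow_sign_sub_one_le (hunit γ) (e γ)
      have h8 : (γ t ^ (e γ : ℤ)) ^ (e γ : ℤ) = γ t := by
        rw [← zpow_mul]
        have : (e γ : ℤ) * (e γ : ℤ) = 1 := by
          revert heγ
          cases e γ <;> intro heγ
          · exact absurd rfl heγ
          · rfl
          · rfl
        rw [this, zpow_one]
      rwa [h8] at this
    linarith

end Chang

/-! ### Shifts and averages of the weighted convolution. -/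

section Increment

variable {G : Type*} [AddCommGroup G] [Fintype G]

/-- `h` weighted by `expWeight N` and normalised, convolved with `h`. -/
noncomputable def weightedConv (N : AddGroupSeminorm G) (h : G → ℝ) (u : G) : ℝ :=
  ∑ x, (expWeight N x * h x / localDensity N h 0) * h (u - x)

lemma localDensity_zero (N : AddGroupSeminorm G) (h : G → ℝ) :
    localDensity N h 0 = ∑ x, expWeight N x * h x := by
  simp [localDensity]

lemma sum_weight_div_localDensity {N : AddGroupSeminorm G} {h : G → ℝ}
    (hb : 0 < localDensity N h 0) : ∑ x, expWeight N x * h x / localDensity N h 0 = 1 := by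
  rw [← Finset.sum_div, ← localDensity_zero, div_self hb.ne']

lemma weightedConv_nonneg (N : AddGroupSeminorm G) {h : G → ℝ} (h0 : ∀ x, 0 ≤ h x) (u : G) :
    0 ≤ weightedConv N h u :=
  Finset.sum_nonneg fun x _ => mul_nonneg
    (div_nonneg (mul_nonneg (expWeight_nonneg N x) (h0 x)) (localDensity_nonneg N h0 0)) (h0 _)

lemma weightedConv_le_one {N : AddGroupSeminorm G} {h : G → ℝ} (h0 : ∀ x, 0 ≤ h x)
    (h1 : ∀ x, h x ≤ 1) (hb : 0 < localDensity N h 0) (u : G) : weightedConv N h u ≤ 1 := by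
  rw [← sum_weight_div_localDensity hb]
  exact Finset.sum_le_sum fun x _ => mul_le_of_le_one_right
    (div_nonneg (mul_nonneg (expWeight_nonneg N x) (h0 x)) hb.le) (h1 _)

lemma sqrt_expWeight_add_le (N : AddGroupSeminorm G) (x t : G) :
    √(expWeight N (x + t)) ≤ Real.exp (N t) * √(expWeight N x) := by
  have h1 : expWeight N (x + t) ≤ Real.exp (N t) ^ 2 * expWeight N x := by
    refine (expWeight_add_le N x t).trans ?_
    have h2 := expWeight_nonneg N x
    have h3 := Real.one_le_exp (apply_nonneg N t)
    gcongr
    nlinarith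
  refine (Real.sqrt_le_sqrt h1).trans_eq ?_
  rw [Real.sqrt_mul (by positivity), Real.sqrt_sq (Real.exp_pos _).le]

/-- The product of square roots is symmetric under `x ↦ v - x`. It turns the one-sided weight in
`weightedConv` into a genuine self-convolution, to which the Fourier bound applies. -/
lemma abs_expWeight_sub_sqrt_mul_le (N : AddGroupSeminorm G) {R : ℝ} (hR : R ≤ 1) (v x : G)
    (hv : N v ≤ R) :
    |expWeight N x - √(expWeight N x) * √(expWeight N (v - x))| ≤ 2 * R * expWeight N x := by
  have hR0 : 0 ≤ R := (apply_nonneg N v).trans hv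
  have hneg : expWeight N (v - x) = expWeight N (x - v) := by rw [← expWeight_neg, neg_sub]
  rw [hneg]
  set s := √(expWeight N x) with hs
  set s' := √(expWeight N (x - v)) with hs'
  have hs0 : 0 ≤ s := Real.sqrt_nonneg _
  have hs0' : 0 ≤ s' := Real.sqrt_nonneg _
  have hss : s * s = expWeight N x := Real.mul_self_sqrt (expWeight_nonneg N x)
  have hE : Real.exp (N v) ≤ 1 + 2 * R :=
    (Real.exp_le_exp.2 hv).trans (exp_le_one_add_two_mul hR0 hR)
  have u1 : s' ≤ Real.exp (N v) * s := by
    have := sqrt_expWeight_add_le N x (-v)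
    rwa [map_neg_eq_map, ← sub_eq_add_neg] at this
  have u2 : s ≤ Real.exp (N v) * s' := by
    have := sqrt_expWeight_add_le N (x - v) v
    rwa [sub_add_cancel] at this
  have u3 : s' ≤ (1 + 2 * R) * s := u1.trans (by gcongr)
  have u4 : s - s' ≤ 2 * R * s := by
    have hinv : Real.exp (-N v) * s ≤ s' := by
      have := mul_le_mul_of_nonneg_left u2 (Real.exp_pos (-N v)).le
      rwa [← mul_assoc, ← Real.exp_add, neg_add_cancel, Real.exp_zero, one_mul] at this
    have : 1 - R ≤ Real.exp (-N v) := by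
      have := Real.add_one_le_exp (-N v)
      linarith
    have := mul_le_mul_of_nonneg_right this hs0
    nlinarith
  rw [← hss, show s * s - s * s' = s * (s - s') by ring, abs_mul, abs_of_nonneg hs0,
    show 2 * R * (s * s) = s * (2 * R * s) by ring]
  gcongr
  rw [abs_le]
  constructor <;> linarith

/-- Pairing the shifts of `weightedConv` against a local weight `f` whose Fourier transform barely
changes under the shift. -/
lemma abs_sum_weightedConv_shift_sub_le {N : AddGroupSeminorm G} {h f : G → ℝ}
    (h0 : ∀ x, 0 ≤ h x) (h1 : ∀ x, h x ≤ 1) (hb : 0 < localDensity N h 0) (hf0 : ∀ v, 0 ≤ f v)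
    (hf1 : ∑ v, f v = 1) {R M : ℝ} (hR : R ≤ 1) {t : G} (hfR : ∀ v, f v ≠ 0 → N v + N t ≤ R)
    (hM : ∀ χ, ‖charSum (fun v => f (v - t) - f v) χ‖ ≤ M) :
    |∑ v, f v * weightedConv N h (v + t) - ∑ v, f v * weightedConv N h v| ≤ M + 4 * R := by
  set b := localDensity N h 0 with hbdef
  have hM0 : 0 ≤ M := (norm_nonneg _).trans (hM 1)
  have hR0 : 0 ≤ R := by
    obtain ⟨v, _, hv⟩ := Finset.exists_ne_zero_of_sum_ne_zero (hf1.trans_ne one_ne_zero)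
    exact (add_nonneg (apply_nonneg N v) (apply_nonneg N t)).trans (hfR v hv)
  let ψ : G → ℝ := fun v => f (v - t) - f v
  let B : G → ℝ := fun x => √(expWeight N x) * h x
  have hshift : ∑ v, f v * weightedConv N h (v + t) = ∑ v, f (v - t) * weightedConv N h v := by
    rw [← Equiv.sum_comp (Equiv.addRight t) (fun v => f (v - t) * weightedConv N h v)]
    simp
  have hD : ∑ v, f v * weightedConv N h (v + t) - ∑ v, f v * weightedConv N h v =
      b⁻¹ * ∑ v, ∑ x, ψ v * (expWeight N x * h x * h (v - x)) := by
    rw [hshift, ← Finset.sum_sub_distrib, Finset.mul_sum]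
    refine Finset.sum_congr rfl fun v _ => ?_
    simp only [ψ, weightedConv, ← hbdef]
    rw [← sub_mul, Finset.mul_sum, Finset.mul_sum]
    exact Finset.sum_congr rfl fun x _ => by ring
  -- This factor `b` cancels the normalisation `b⁻¹`, so no power of the density is lost in the
  -- final error.
  have hB2 : ∑ x, B x ^ 2 ≤ b := by
    rw [hbdef, localDensity_zero]
    refine Finset.sum_le_sum fun x _ => ?_
    simp only [B]
    rw [mul_pow, Real.sq_sqrt (expWeight_nonneg N x)]
    refine mul_le_mul_of_nonneg_left ?_ (expWeight_nonneg N x)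
    have := h0 x; have := h1 x
    nlinarith
  have hmain : |∑ v, ∑ x, ψ v * (B x * B (v - x))| ≤ M * b :=
    (abs_sum_sum_mul_le hM).trans (mul_le_mul_of_nonneg_left hB2 hM0)
  have hψ : ∀ v, ψ v ≠ 0 → N v ≤ R := fun v hv => by
    by_cases hv1 : f v = 0
    · have hv2 : f (v - t) ≠ 0 := fun h => hv (by simp [ψ, h, hv1])
      have := hfR _ hv2
      have h2 := map_add_le_add N (v - t) t
      rw [sub_add_cancel] at h2
      linarith
    · have := hfR _ hv1
      have := apply_nonneg N t
      linarith
  have herr : |∑ v, ∑ x, ψ v * (expWeight N x * h x * h (v - x)) -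
      ∑ v, ∑ x, ψ v * (B x * B (v - x))| ≤ 4 * R * b := by
    rw [← Finset.sum_sub_distrib]
    calc _ ≤ ∑ v, |ψ v| * (2 * R * b) := by
          refine (Finset.abs_sum_le_sum_abs _ _).trans (Finset.sum_le_sum fun v _ => ?_)
          by_cases hv : ψ v = 0
          · simp [hv]
          rw [← Finset.sum_sub_distrib]
          refine (Finset.abs_sum_le_sum_abs _ _).trans ?_
          rw [hbdef, localDensity_zero, Finset.mul_sum, Finset.mul_sum]
          refine Finset.sum_le_sum fun x _ => ?_
          have e1 : ψ v * (expWeight N x * h x * h (v - x)) - ψ v * (B x * B (v - x)) =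
              ψ v * ((expWeight N x - √(expWeight N x) * √(expWeight N (v - x))) *
                (h x * h (v - x))) := by
            simp only [B]; ring
          rw [e1, abs_mul]
          refine mul_le_mul_of_nonneg_left ?_ (abs_nonneg _)
          rw [abs_mul, abs_of_nonneg (mul_nonneg (h0 x) (h0 (v - x)))]
          have e2 := abs_expWeight_sub_sqrt_mul_le N hR v x (hψ v hv)
          have e3 : h x * h (v - x) ≤ h x := mul_le_of_le_one_right (h0 x) (h1 _)
          calc _ ≤ (2 * R * expWeight N x) * h x :=
                mul_le_mul e2 e3 (mul_nonneg (h0 x) (h0 _)) ((abs_nonneg _).trans e2)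
            _ = _ := by ring
      _ = (∑ v, |ψ v|) * (2 * R * b) := by rw [Finset.sum_mul]
      _ ≤ 2 * (2 * R * b) := by
          gcongr
          calc ∑ v, |ψ v| ≤ ∑ v, (f (v - t) + f v) := by
                refine Finset.sum_le_sum fun v _ => ?_
                have := hf0 v; have := hf0 (v - t)
                simp only [ψ, abs_le]
                constructor <;> linarith
            _ = 2 := by
                rw [Finset.sum_add_distrib, hf1,
                  ← Equiv.sum_comp (Equiv.addRight t) (fun v => f (v - t))]
                simp only [Equiv.coe_addRight, add_sub_cancel_right, hf1]
                norm_num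
      _ = 4 * R * b := by ring
  rw [hD, abs_mul, abs_of_pos (inv_pos.2 hb), inv_mul_le_iff₀ hb]
  have h3 := abs_le.1 hmain
  have h4 := abs_le.1 herr
  rw [abs_le]
  constructor <;> nlinarith

/-- If the averages of `h` along a local weight `q` never exceed `β`, then `weightedConv N h`,
averaged twice along `q`, is not much smaller than `β`. -/
lemma le_sum_weightedConv_average {N : AddGroupSeminorm G} {h q : G → ℝ} (h0 : ∀ x, 0 ≤ h x)
    (hb : 0 < localDensity N h 0) (hq0 : ∀ t, 0 ≤ q t) (hq1 : ∑ t, q t = 1) {θ β R : ℝ}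
    (hqθ : ∀ t, q t ≠ 0 → N t ≤ θ) (hβ : ∀ z, ∑ t, q t * h (z + t) ≤ β) (hβ0 : 0 ≤ β)
    {v : G} (hv : N v ≤ R) :
    β - Real.exp (θ + R) * (β / localDensity N h 0) *
        (β - Real.exp (-θ) * localDensity N h 0) ≤
      ∑ t, ∑ t', q t * q t' * weightedConv N h (v + t + t') := by
  set b := localDensity N h 0 with hbdef
  let φ : G → ℝ := fun z => ∑ t, q t * h (z + t)
  let ψ : G → ℝ := fun z => β - φ z
  have hψ0 : ∀ z, 0 ≤ ψ z := fun z => sub_nonneg.2 (hβ z)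
  let μ : G → ℝ := fun x => expWeight N x * h x / b
  have hμ1 : ∑ x, μ x = 1 := sum_weight_div_localDensity hb
  have e1 : ∑ t, ∑ t', q t * q t' * weightedConv N h (v + t + t') =
      ∑ t, q t * ∑ x, μ x * φ (v + t - x) := by
    refine Finset.sum_congr rfl fun t _ => ?_
    simp only [weightedConv, φ, Finset.mul_sum]
    rw [Finset.sum_comm]
    refine Finset.sum_congr rfl fun x _ => Finset.sum_congr rfl fun t' _ => ?_
    rw [show v + t - x + t' = v + t + t' - x by abel]
    simp only [μ]
    ring
  have e2 : ∑ t, q t * ∑ x, μ x * φ (v + t - x) =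
      β - ∑ t, q t * ∑ x, μ x * ψ (v + t - x) := by
    simp only [ψ, mul_sub, Finset.sum_sub_distrib, ← Finset.sum_mul, hμ1, hq1]
    ring
  -- The deficit `ψ` is non-negative, so its measure may be enlarged. Averaging `μ` along `q`
  -- replaces `h` by an average at most `β`, after which `μ` is dominated by `β / b` times the
  -- weight of `N`.
  have e3 : ∑ t, q t * ∑ x, μ x * ψ (v + t - x) ≤
      ∑ z, Real.exp θ * (β / b) * expWeight N z * ψ (v - z) := by
    calc _ = ∑ t, ∑ z, q t * (μ (z + t) * ψ (v - z)) := by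
          refine Finset.sum_congr rfl fun t _ => ?_
          rw [← Equiv.sum_comp (Equiv.addRight t), Finset.mul_sum]
          refine Finset.sum_congr rfl fun z _ => ?_
          simp only [Equiv.coe_addRight]
          rw [show v + t - (z + t) = v - z by abel]
      _ = ∑ z, (∑ t, q t * μ (z + t)) * ψ (v - z) := by
          rw [Finset.sum_comm]
          refine Finset.sum_congr rfl fun z _ => ?_
          rw [Finset.sum_mul]
          exact Finset.sum_congr rfl fun t _ => by ring
      _ ≤ _ := by
          refine Finset.sum_le_sum fun z _ => mul_le_mul_of_nonneg_right ?_ (hψ0 _)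
          calc ∑ t, q t * μ (z + t)
              ≤ ∑ t, Real.exp θ * expWeight N z / b * (q t * h (z + t)) := by
                refine Finset.sum_le_sum fun t _ => ?_
                by_cases ht : q t = 0
                · simp [ht]
                have h3 : expWeight N (z + t) ≤ Real.exp θ * expWeight N z := by
                  refine (expWeight_add_le N z t).trans ?_
                  have := expWeight_nonneg N z
                  gcongr
                  exact hqθ t ht
                have h4 : μ (z + t) ≤ Real.exp θ * expWeight N z * h (z + t) / b := by
                  simp only [μ]
                  have := h0 (z + t)
                  gcongr
                calc q t * μ (z + t) ≤ q t * (Real.exp θ * expWeight N z * h (z + t) / b) :=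
                      mul_le_mul_of_nonneg_left h4 (hq0 t)
                  _ = _ := by ring
            _ = Real.exp θ * expWeight N z / b * ∑ t, q t * h (z + t) := by
                rw [Finset.mul_sum]
            _ ≤ Real.exp θ * expWeight N z / b * β := by
                have := expWeight_nonneg N z
                gcongr
                exact hβ z
            _ = _ := by ring
  have e4 : ∑ z, Real.exp θ * (β / b) * expWeight N z * ψ (v - z) ≤
      ∑ w, Real.exp (θ + R) * (β / b) * (expWeight N w * ψ w) := by
    rw [← Equiv.sum_comp (Equiv.subLeft v)
      (fun w => Real.exp (θ + R) * (β / b) * (expWeight N w * ψ w))]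
    refine Finset.sum_le_sum fun z _ => ?_
    simp only [Equiv.subLeft_apply]
    have h5 : expWeight N z ≤ Real.exp R * expWeight N (v - z) := by
      have := expWeight_add_le N (v - z) (-v)
      rw [map_neg_eq_map, show v - z + -v = -z by abel, expWeight_neg] at this
      refine this.trans ?_
      have := expWeight_nonneg N (v - z)
      gcongr
    have h6 : Real.exp θ * (β / b) * expWeight N z ≤
        Real.exp θ * (β / b) * (Real.exp R * expWeight N (v - z)) := by gcongr
    refine (mul_le_mul_of_nonneg_right h6 (hψ0 _)).trans_eq ?_
    rw [Real.exp_add]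
    ring
  -- The mean of `φ` is nearly `b`, so the total deficit is small when `b` is close to `β`.
  have e5 : ∑ w, expWeight N w * ψ w ≤ β - Real.exp (-θ) * b := by
    have h7 : ∑ w, expWeight N w * ψ w = β - ∑ t, q t * localDensity N h t := by
      simp only [ψ, mul_sub, Finset.sum_sub_distrib, ← Finset.sum_mul, sum_expWeight, one_mul]
      congr 1
      simp only [φ, localDensity, Finset.mul_sum]
      rw [Finset.sum_comm]
      refine Finset.sum_congr rfl fun t _ => Finset.sum_congr rfl fun w _ => ?_
      rw [add_comm t w]
      ring
    have h8 : Real.exp (-θ) * b ≤ ∑ t, q t * localDensity N h t := by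
      calc Real.exp (-θ) * b = ∑ t, q t * (Real.exp (-θ) * b) := by
            rw [← Finset.sum_mul, hq1, one_mul]
        _ ≤ _ := by
            refine Finset.sum_le_sum fun t _ => ?_
            by_cases ht : q t = 0
            · simp [ht]
            refine mul_le_mul_of_nonneg_left ?_ (hq0 t)
            have h9 := le_localDensity_add N h0 0 t
            rw [zero_add] at h9
            refine le_trans ?_ h9
            have := hqθ t ht
            gcongr
    linarith
  rw [← Finset.mul_sum] at e4
  have e6 : Real.exp (θ + R) * (β / b) * ∑ w, expWeight N w * ψ w ≤
      Real.exp (θ + R) * (β / b) * (β - Real.exp (-θ) * b) := by gcongr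
  rw [e1, e2]
  linarith

end Increment

/-! ### Weights conditioned on a subset. -/

section CondWeight

variable {G : Type*}

/-- The restriction of a weight to a finite set, normalised. -/
noncomputable def condWeight (r : G → ℝ) (T : Finset G) (t : G) : ℝ :=
  haveI := Classical.dec (t ∈ T)
  if t ∈ T then r t / ∑ s ∈ T, r s else 0

lemma condWeight_nonneg {r : G → ℝ} (hr : ∀ t, 0 ≤ r t) (T : Finset G) (t : G) :
    0 ≤ condWeight r T t := by
  unfold condWeight
  split_ifs
  · exact div_nonneg (hr t) (Finset.sum_nonneg fun s _ => hr s)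
  · exact le_rfl

lemma sum_condWeight_mul [Fintype G] (r : G → ℝ) (T : Finset G) (f : G → ℝ) :
    ∑ t, condWeight r T t * f t = (∑ t ∈ T, r t * f t) / ∑ s ∈ T, r s := by
  classical
  simp only [condWeight, ite_mul, zero_mul]
  rw [Finset.sum_div, Finset.sum_ite_mem, Finset.univ_inter]
  exact Finset.sum_congr rfl fun t _ => by ring

lemma sum_condWeight [Fintype G] {r : G → ℝ} {T : Finset G} (hT : 0 < ∑ s ∈ T, r s) :
    ∑ t, condWeight r T t = 1 := by
  have := sum_condWeight_mul r T (fun _ => 1)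
  simp only [mul_one] at this
  rw [this, div_self hT.ne']

lemma mem_of_condWeight_ne_zero {r : G → ℝ} {T : Finset G} {t : G} (ht : condWeight r T t ≠ 0) :
    t ∈ T := by
  by_contra h
  exact ht (by simp [condWeight, h])

lemma condWeight_le {r : G → ℝ} (hr : ∀ t, 0 ≤ r t) {T : Finset G} (t : G) :
    condWeight r T t ≤ (∑ s ∈ T, r s)⁻¹ * r t := by
  have h0 : 0 ≤ ∑ s ∈ T, r s := Finset.sum_nonneg fun s _ => hr s
  unfold condWeight
  split_ifs
  · rw [div_eq_inv_mul]
  · exact mul_nonneg (inv_nonneg.2 h0) (hr t)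

end CondWeight

/-! ### No increment forces a large pairing. -/

section Core

variable {G : Type*} [AddCommGroup G] [Fintype G]

/-- The large spectrum of `p` controls the change under a shift of the Fourier transform of an
iterated smoothing along `p`. -/
lemma norm_charSum_iterate_smoothing_shift_le {p f : G → ℝ} (hp : ∀ x, 0 ≤ p x)
    (hp1 : ∑ x, p x = 1) (hf : ∀ x, 0 ≤ f x) (hf1 : ∑ x, f x = 1) (l : ℕ) {t : G} {δ : ℝ}
    (hδ : ∀ γ : AddChar G ℂ, 1 / 2 ≤ ‖charSum p γ‖ → ‖γ t - 1‖ ≤ δ) (hδ0 : 0 ≤ δ)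
    (χ : AddChar G ℂ) :
    ‖charSum (fun v => (smoothing p)^[l] f (v - t) - (smoothing p)^[l] f v) χ‖ ≤
      2 * (1 / 4) ^ l + δ := by
  rw [charSum_shift_sub, norm_mul, norm_charSum_iterate_smoothing]
  have h1 : ‖charSum f χ‖ ≤ 1 := (norm_charSum_le hf χ).trans_eq hf1
  have h2 : ‖charSum p χ‖ ≤ 1 := (norm_charSum_le hp χ).trans_eq hp1
  have h3 : ‖χ t - 1‖ ≤ 2 := by
    refine (norm_sub_le _ _).trans ?_
    rw [AddChar.norm_apply, norm_one]
    norm_num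
  have h4 : (0 : ℝ) ≤ 2 * (1 / 4) ^ l := by positivity
  by_cases hc : 1 / 2 ≤ ‖charSum p χ‖
  · calc _ ≤ δ * (1 * 1 ^ (2 * l)) := by
          gcongr
          exact hδ χ hc
      _ ≤ 2 * (1 / 4) ^ l + δ := by
          rw [one_pow, mul_one, mul_one]
          linarith
  · calc _ ≤ 2 * (1 * (1 / 2 : ℝ) ^ (2 * l)) := by
          have := (not_le.1 hc).le
          gcongr
      _ = 2 * (1 / 4) ^ l := by rw [one_mul, pow_mul]; norm_num
      _ ≤ 2 * (1 / 4) ^ l + δ := by linarith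

/-- Numerical conditions tying together the parameters of the density increment argument: `a` is a
lower bound for the density, `l` the number of smoothings, `k` the number of samples, `n` the number
of new characters and `θ` the accuracy to which scales are separated. -/
structure IncrementParams (a θ : ℝ) (k l n : ℕ) : Prop where
  a_pos : 0 < a
  θ_pos : 0 < θ
  l_pos : 0 < l
  k_pos : 0 < k
  smoothing_le : 2 * (1 / 4) ^ l ≤ a / 100
  sampling_le : 9600 * l * Real.exp (-(k * (1 / (300 * l)) ^ 2 * a / 4)) ≤ a ^ 2
  spectrum_lt : 32 * (2 / a) ^ k < Real.exp (n / 32)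
  θ_mul_l_le : 3800 * θ * l ≤ a
  θ_mul_k_le : k * θ ≤ 1 / 2
  θ_mul_n_le : n * θ ≤ 1 / 4
  θ_le : 1000 * θ ≤ a

/-- If `h` has no density increment on the weights that refine `N₅` by at most `n` characters, then
the mean of `weightedConv N₁ h` along a bounded local density `f` is at least half of the expected
value. -/
lemma half_le_sum_mul_weightedConv {a₀ a θ : ℝ} {k l n : ℕ} (hpar : IncrementParams a₀ θ k l n)
    (ha₀ : a₀ ≤ a) (ha1 : a ≤ 1) {N₁ Q N₃ N₅ : AddGroupSeminorm G} {h f : G → ℝ}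
    (h0 : ∀ x, 0 ≤ h x) (h1 : ∀ x, h x ≤ 1) (hN₁Q : ∀ x, N₁ x ≤ Q x) (hQN₅ : ∀ x, Q x ≤ N₅ x)
    (hf₃ : IsFiner θ Q N₃) (hf₅ : IsFiner θ N₃ N₅)
    (hb1 : (1 - 2 / 100) * a ≤ localDensity N₁ h 0)
    (hf0 : ∀ u, 0 ≤ f u) (hf1 : ∑ u, f u = 1)
    (hfQ : ∀ u, f u ≤ 2 / a * expWeight Q u) (hfN : ∀ u, f u ≠ 0 → N₁ u ≤ 2 * θ)
    (hinc : ∀ Λ : Finset (AddChar G ℂ), Λ.card ≤ n → ∃ N₄ : AddGroupSeminorm G,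
      1 - θ ≤ ∑ t with N₅ t + ∑ χ ∈ Λ, ‖χ t - 1‖ ≤ θ, expWeight N₄ t ∧
      ∀ x, localDensity N₄ h x ≤ (1 + 1 / 100) * a) :
    a / 2 ≤ ∑ u, f u * weightedConv N₁ h u := by
  classical
  obtain ⟨ha₀0, hθ, hl, hk, hsm, hsa, hsp, hθl, hθk, hθn, hθa⟩ := hpar
  have ha : 0 < a := ha₀0.trans_le ha₀
  have hl1 : (1 : ℝ) ≤ l := by exact_mod_cast hl
  have hθs : θ ≤ 1 / 1000 := by linarith
  set b := localDensity N₁ h 0 with hbdef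
  have hb0 : 0 < b := by nlinarith
  set ε : ℝ := 1 / (300 * l) with hε
  have hε0 : 0 < ε := by positivity
  have hε1 : ε ≤ 1 / 300 := by
    rw [hε]
    gcongr
    linarith
  have hεl : l * ε = 1 / 300 := by rw [hε]; field_simp
  set e := 4 * Real.exp (-(k * ε ^ 2 * a / 4)) with he
  have he0 : 0 ≤ e := by positivity
  -- The smoothing error with `B = 2 / a` and `e` four times the exponential: `12 * 2 * 4 * 100 =
  -- 9600`.
  have hel : l * (12 * (2 / a) * e) ≤ a / 100 := by
    have h2 : Real.exp (-(k * ε ^ 2 * a / 4)) ≤ Real.exp (-(k * ε ^ 2 * a₀ / 4)) := by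
      gcongr
    have h3 : 9600 * l * Real.exp (-(k * ε ^ 2 * a / 4)) ≤ a ^ 2 := by
      calc _ ≤ 9600 * l * Real.exp (-(k * ε ^ 2 * a₀ / 4)) := by gcongr
        _ ≤ a₀ ^ 2 := hsa
        _ ≤ a ^ 2 := by gcongr
    have h4 : l * (12 * (2 / a) * e) =
        (9600 * l * Real.exp (-(k * ε ^ 2 * a / 4))) / (100 * a) := by
      rw [he]; field_simp; ring
    rw [h4, div_le_iff₀ (by positivity)]
    calc _ ≤ a ^ 2 := h3
      _ = _ := by ring
  obtain ⟨g, T, hTS, hTr, hTbad⟩ := exists_shift_set (N := N₁) (ω := expWeight Q)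
    (r := expWeight N₃) (S := univ.filter fun t => Q t ≤ θ) h0 h1 (expWeight_nonneg Q)
    (sum_expWeight Q) (expWeight_nonneg N₃) (by have := hf₃.one_sub_le; linarith)
    (fun t ht => (hN₁Q t).trans (mem_filter.1 ht).2) hθk hε0.le (by linarith) ha.le
    (localDensity_zero N₁ h).symm hb0 (Φ := weightedConv N₁ h) (fun u => rfl)
  rw [← hbdef] at hTr
  set τ := ∑ t ∈ T, expWeight N₃ t with hτ
  have hτ0 : 0 < τ := lt_of_lt_of_le (by positivity) hTr
  set p := condWeight (expWeight N₃) T with hp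
  have hp0 : ∀ t, 0 ≤ p t := condWeight_nonneg (expWeight_nonneg N₃) T
  have hp1 : ∑ t, p t = 1 := sum_condWeight hτ0
  have hpT : ∀ t, p t ≠ 0 → t ∈ T := fun t ht => mem_of_condWeight_ne_zero ht
  have hpQ : ∀ t, p t ≠ 0 → Q t ≤ θ := fun t ht => (mem_filter.1 (hTS (hpT t ht))).2
  have hpN : ∀ t, p t ≠ 0 → N₁ t ≤ θ := fun t ht => (hN₁Q t).trans (hpQ t ht)
  have hspec : 4 / τ < Real.exp (n / 32) := by
    refine lt_of_le_of_lt ?_ hsp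
    have hba : a₀ / 2 ≤ b := by linarith
    calc 4 / τ ≤ 4 / (b ^ k / 8) := by gcongr
      _ = 32 / b ^ k := by field_simp; norm_num
      _ ≤ 32 / (a₀ / 2) ^ k := by gcongr
      _ = 32 * (2 / a₀) ^ k := by rw [div_eq_mul_inv, ← inv_pow, inv_div]
  obtain ⟨Λ, hΛn, hΛ⟩ := exists_finset_control_spectrum hf₅ hθ.le hθn (by linarith) hp0 hp1 hτ0
    (condWeight_le (expWeight_nonneg N₃)) hspec
  obtain ⟨N₄, hN₄S, hN₄⟩ := hinc Λ hΛn
  set S := univ.filter fun t => N₅ t + ∑ χ ∈ Λ, ‖χ t - 1‖ ≤ θ with hS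
  set σ := ∑ t ∈ S, expWeight N₄ t with hσ
  have hσ0 : 0 < σ := by linarith
  set q := condWeight (expWeight N₄) S with hq
  have hq0 : ∀ t, 0 ≤ q t := condWeight_nonneg (expWeight_nonneg N₄) S
  have hq1 : ∑ t, q t = 1 := sum_condWeight hσ0
  have hqS : ∀ t, q t ≠ 0 → N₅ t + ∑ χ ∈ Λ, ‖χ t - 1‖ ≤ θ := fun t ht =>
    (mem_filter.1 (mem_of_condWeight_ne_zero ht)).2
  have hN₁₅ : ∀ t, N₁ t ≤ N₅ t := fun t => (hN₁Q t).trans (hQN₅ t)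
  have hq5 : ∀ t, q t ≠ 0 → N₅ t ≤ θ := fun t ht => by
    have := hqS t ht
    have : 0 ≤ ∑ χ ∈ Λ, ‖χ t - 1‖ := Finset.sum_nonneg fun _ _ => norm_nonneg _
    linarith
  have hqN : ∀ t, q t ≠ 0 → N₁ t ≤ θ := fun t ht => (hN₁₅ t).trans (hq5 t ht)
  set β := (1 + 2 / 100) * a with hβdef
  -- Conditioning on a set of mass at least `1 - θ` raises the bound `1.01 a` to at most `1.02 a`.
  have hβ : ∀ z, ∑ t, q t * h (z + t) ≤ β := fun z => by
    rw [hq, sum_condWeight_mul, ← hσ, div_le_iff₀ hσ0]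
    calc ∑ t ∈ S, expWeight N₄ t * h (z + t) ≤ localDensity N₄ h z :=
          Finset.sum_le_sum_of_subset_of_nonneg (subset_univ _)
            fun t _ _ => mul_nonneg (expWeight_nonneg N₄ t) (h0 _)
      _ ≤ (1 + 1 / 100) * a := hN₄ z
      _ ≤ β * (1 - θ) := by rw [hβdef]; nlinarith
      _ ≤ β * σ := by gcongr
  set F := (smoothing p)^[l] f with hF
  have hF0 : ∀ u, 0 ≤ F u := iterate_smoothing_nonneg hp0 hf0 l
  have hF1 : ∑ u, F u = 1 := (sum_iterate_smoothing hp1 f l).trans hf1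
  have hFN : ∀ u, F u ≠ 0 → N₁ u ≤ 2 * θ + 2 * θ * l := fun u hu =>
    iterate_smoothing_ne_zero hpN hfN l hu
  -- `ε = 1/(300 l)` makes the `l` factors `1 + 3ε` multiply to at most `exp (1/100)`.
  have upper : ∑ u, F u * weightedConv N₁ h u ≤
      (1 + 2 / 100) * (∑ u, f u * weightedConv N₁ h u + 2 / 100 * a) := by
    have := sum_iterate_smoothing_mul_le hp0 hp1 hθ.le hpQ (by positivity) hf0 hf1 hfQ
      (weightedConv_nonneg N₁ h0) (weightedConv_le_one h0 h1 hb0) (k := k) (by exact_mod_cast hk)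
      hε0.le (by linarith) ha.le he0 (fun t ht => hTbad t (hpT t ht)) (l := l) (by linarith)
      (by linarith)
    refine this.trans ?_
    have h5 : (1 + 3 * ε) ^ l ≤ 1 + 2 / 100 := by
      calc (1 + 3 * ε) ^ l ≤ Real.exp (3 * ε) ^ l := by
            gcongr
            have := Real.add_one_le_exp (3 * ε)
            linarith
        _ = Real.exp (1 / 100) := by
            rw [← Real.exp_nat_mul]
            congr 1
            linarith
        _ ≤ 1 + 2 * (1 / 100) := exp_le_one_add_two_mul (by norm_num) (by norm_num)
        _ = _ := by norm_num
    have h6 : l * (3 * ε * a + 12 * (2 / a) * e) ≤ 2 / 100 * a := by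
      have : l * (3 * ε * a + 12 * (2 / a) * e) =
          3 * (l * ε) * a + l * (12 * (2 / a) * e) := by ring
      rw [this, hεl]
      linarith
    have h7 : 0 ≤ ∑ u, f u * weightedConv N₁ h u :=
      Finset.sum_nonneg fun u _ => mul_nonneg (hf0 u) (weightedConv_nonneg N₁ h0 u)
    have h8 : 0 ≤ l * (3 * ε * a + 12 * (2 / a) * e) := by positivity
    gcongr
  have hΛadd : ∀ t t', ∑ χ ∈ Λ, ‖χ (t + t') - 1‖ ≤ ∑ χ ∈ Λ, ‖χ t - 1‖ + ∑ χ ∈ Λ, ‖χ t' - 1‖ := by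
    intro t t'
    rw [← Finset.sum_add_distrib]
    refine Finset.sum_le_sum fun χ _ => ?_
    have : χ (t + t') - 1 = χ t * (χ t' - 1) + (χ t - 1) := by
      rw [AddChar.map_add_eq_mul]; ring
    rw [this]
    refine (norm_add_le _ _).trans ?_
    rw [norm_mul, AddChar.norm_apply, one_mul, add_comm]
  have hshift : ∀ t t', q t ≠ 0 → q t' ≠ 0 →
      ∑ v, F v * weightedConv N₁ h (v + (t + t')) ≤
        ∑ v, F v * weightedConv N₁ h v + 2 / 100 * a := by
    intro t t' ht ht'
    have s1 := hqS t ht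
    have s2 := hqS t' ht'
    have s3 : N₅ (t + t') ≤ 2 * θ := by
      have := map_add_le_add N₅ t t'
      have := hq5 t ht
      have := hq5 t' ht'
      linarith
    have s4 : ∑ χ ∈ Λ, ‖χ (t + t') - 1‖ ≤ 2 * θ := by
      have := hΛadd t t'
      have := apply_nonneg N₅ t
      have := apply_nonneg N₅ t'
      linarith
    have s5 : Real.exp (N₅ (t + t')) - 1 ≤ 4 * θ := by
      have := exp_le_one_add_two_mul (x := 2 * θ) (by linarith) (by linarith)
      have := Real.exp_le_exp.2 s3
      linarith
    -- `14θ` is `3 * 4θ` from the seminorm `N₅` plus `2θ` from the characters of `Λ`.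
    have hM := norm_charSum_iterate_smoothing_shift_le hp0 hp1 hf0 hf1 l (t := t + t')
      (δ := 14 * θ) (fun γ hγ => (hΛ γ hγ _).trans (by linarith)) (by linarith)
    have hlθ : θ ≤ θ * l := le_mul_of_one_le_right hθ.le hl1
    -- The support of `F` and the shift give `4θ + 2θl ≤ 6θl`. The error `14θ + 4 * 6θl` is then at
    -- most `38θl ≤ a / 100`.
    have := abs_sum_weightedConv_shift_sub_le h0 h1 hb0 hF0 hF1 (R := 6 * (θ * l)) (by linarith)
      (t := t + t') (fun v hv => by
        have := hFN v hv
        have := hN₁₅ (t + t')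
        linarith) hM
    have := (abs_le.1 this).2
    linarith
  have lower : (1 + 2 / 100) * a - 49 / 1000 * a ≤
      ∑ v, F v * weightedConv N₁ h v + 2 / 100 * a := by
    have hlθ : θ ≤ θ * l := le_mul_of_one_le_right hθ.le hl1
    have hpoint : ∀ v, F v ≠ 0 → (1 + 2 / 100) * a - 49 / 1000 * a ≤
        ∑ t, ∑ t', q t * q t' * weightedConv N₁ h (v + t + t') := by
      intro v hv
      have hR : N₁ v ≤ 4 * (θ * l) := by
        have := hFN v hv
        linarith
      refine le_trans ?_ (le_sum_weightedConv_average h0 hb0 hq0 hq1 hqN hβ (by positivity) hR)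
      rw [← hbdef]
      have c1 : Real.exp (θ + 4 * (θ * l)) ≤ 1 + 1 / 100 := by
        have hx : θ + 4 * (θ * l) ≤ 1 / 200 := by linarith
        have := exp_le_one_add_two_mul (x := θ + 4 * (θ * l)) (by positivity) (by linarith)
        linarith
      have c2 : β / b ≤ 1 + 5 / 100 := by
        rw [div_le_iff₀ hb0, hβdef]
        linarith
      have c3 : β - Real.exp (-θ) * b ≤ 45 / 1000 * a := by
        have h9 := Real.add_one_le_exp (-θ)
        have h10 : (999 / 1000) * b ≤ Real.exp (-θ) * b := by
          gcongr
          linarith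
        rw [hβdef]
        linarith
      have c4 : Real.exp (θ + 4 * (θ * l)) * (β / b) ≤ 107 / 100 := by
        calc _ ≤ (1 + 1 / 100) * (1 + 5 / 100 : ℝ) := by gcongr
          _ ≤ _ := by norm_num
      have c5 : 0 ≤ Real.exp (θ + 4 * (θ * l)) * (β / b) := by positivity
      -- The total loss is `1.07 * 0.045 a`, which is below `0.049 a`.
      have c6 : Real.exp (θ + 4 * (θ * l)) * (β / b) * (β - Real.exp (-θ) * b) ≤
          107 / 100 * (45 / 1000 * a) := by
        calc _ ≤ Real.exp (θ + 4 * (θ * l)) * (β / b) * (45 / 1000 * a) := by gcongr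
          _ ≤ _ := by gcongr
      linarith
    calc (1 + 2 / 100) * a - 49 / 1000 * a
        = ∑ v, F v * ((1 + 2 / 100) * a - 49 / 1000 * a) := by
          rw [← Finset.sum_mul, hF1, one_mul]
      _ ≤ ∑ v, F v * ∑ t, ∑ t', q t * q t' * weightedConv N₁ h (v + t + t') := by
          refine Finset.sum_le_sum fun v _ => ?_
          by_cases hv : F v = 0
          · simp [hv]
          · exact mul_le_mul_of_nonneg_left (hpoint v hv) (hF0 v)
      _ = ∑ t, ∑ t', q t * q t' * ∑ v, F v * weightedConv N₁ h (v + (t + t')) := by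
          simp only [Finset.mul_sum]
          rw [Finset.sum_comm]
          refine Finset.sum_congr rfl fun t _ => ?_
          rw [Finset.sum_comm]
          refine Finset.sum_congr rfl fun t' _ => Finset.sum_congr rfl fun v _ => ?_
          rw [add_assoc]
          ring
      _ ≤ _ := sum_sum_mul_le hq0 hq1 hshift
  linarith

end Core

/-! ### Bohr seminorms and their mass. -/

section Bohr

variable {G : Type*} [AddCommGroup G]

/-- The seminorm whose balls are the Bohr sets with frequencies `Γ`, scaled by `K`. -/
noncomputable def bohrSeminorm [Finite G] (K : ℕ) (Γ : Multiset (AddChar G ℂ)) :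
    AddGroupSeminorm G where
  toFun x := K * (Γ.map fun γ => ‖γ x - 1‖).sum
  map_zero' := by simp
  add_le' x y := by
    rw [← mul_add, ← Multiset.sum_map_add]
    refine mul_le_mul_of_nonneg_left (Multiset.sum_map_le_sum_map _ _ fun γ _ => ?_)
      (Nat.cast_nonneg K)
    have : γ (x + y) - 1 = γ x * (γ y - 1) + (γ x - 1) := by
      rw [AddChar.map_add_eq_mul]; ring
    rw [this]
    refine (norm_add_le _ _).trans ?_
    rw [norm_mul, AddChar.norm_apply, one_mul, add_comm]
  neg' x := by
    congr 2
    refine Multiset.map_congr rfl fun γ _ => ?_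
    have hx : γ x ≠ 0 := (AddChar.val_isUnit γ x).ne_zero
    rw [AddChar.map_neg_eq_inv, show (γ x)⁻¹ - 1 = (γ x)⁻¹ * (1 - γ x) by
      rw [mul_sub, inv_mul_cancel₀ hx, mul_one], norm_mul, norm_inv, AddChar.norm_apply, inv_one,
      one_mul, norm_sub_rev]

lemma bohrSeminorm_apply [Finite G] (K : ℕ) (Γ : Multiset (AddChar G ℂ)) (x : G) :
    bohrSeminorm K Γ x = K * (Γ.map fun γ => ‖γ x - 1‖).sum := rfl

lemma bohrSum_nonneg (Γ : Multiset (AddChar G ℂ)) (x : G) :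
    0 ≤ (Γ.map fun γ => ‖γ x - 1‖).sum := by
  refine Multiset.sum_nonneg fun r hr => ?_
  obtain ⟨γ, _, rfl⟩ := Multiset.mem_map.1 hr
  exact norm_nonneg _

lemma bohrSeminorm_mul [Finite G] (m K : ℕ) (Γ : Multiset (AddChar G ℂ)) (x : G) :
    bohrSeminorm (m * K) Γ x = m * bohrSeminorm K Γ x := by
  simp only [bohrSeminorm_apply]
  push_cast
  ring

lemma bohrSeminorm_mono [Finite G] {K K' : ℕ} (hK : K ≤ K') (Γ : Multiset (AddChar G ℂ)) (x : G) :
    bohrSeminorm K Γ x ≤ bohrSeminorm K' Γ x := by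
  simp only [bohrSeminorm_apply]
  have := bohrSum_nonneg Γ x
  gcongr

/-- On a large subset, finitely many characters are all nearly constant. -/
lemma exists_large_subset_close [Finite G] (Γ : Multiset (AddChar G ℂ)) {m : ℕ} (hm : 0 < m)
    (S : Finset G) : ∃ S' ⊆ S, (S.card : ℝ) ≤ (2 * m + 1) ^ (2 * Γ.card) * S'.card ∧
      ∀ γ ∈ Γ, ∀ x ∈ S', ∀ y ∈ S', ‖γ x - γ y‖ ≤ 2 / m := by
  classical
  have hm' : (0 : ℝ) < m := by exact_mod_cast hm
  induction Γ using Multiset.induction_on with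
  | empty => exact ⟨S, Subset.rfl, by simp, by simp⟩
  | cons γ Γ ih =>
    obtain ⟨S₁, hS₁, hcard, hclose⟩ := ih
    -- Pigeonhole on a grid of mesh `1 / m` for the real and imaginary parts of `γ`.
    let F : G → ℤ × ℤ := fun x => (⌊m * (γ x).re⌋, ⌊m * (γ x).im⌋)
    let B : Finset (ℤ × ℤ) := Icc (-(m : ℤ)) m ×ˢ Icc (-(m : ℤ)) m
    have hfl : ∀ r : ℝ, |r| ≤ 1 → ⌊m * r⌋ ∈ Icc (-(m : ℤ)) m := by
      intro r hr
      obtain ⟨h1, h2⟩ := abs_le.1 hr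
      rw [mem_Icc]
      constructor
      · rw [Int.le_floor]
        push_cast
        nlinarith
      · have : (⌊m * r⌋ : ℝ) ≤ m := (Int.floor_le _).trans (by nlinarith)
        exact_mod_cast this
    have hmaps : ∀ x ∈ S₁, F x ∈ B := fun x _ => by
      refine mem_product.2 ⟨hfl _ ?_, hfl _ ?_⟩
      · exact (Complex.abs_re_le_norm _).trans_eq (AddChar.norm_apply _ _)
      · exact (Complex.abs_im_le_norm _).trans_eq (AddChar.norm_apply _ _)
    have hBcard : (B.card : ℝ) = (2 * m + 1) ^ 2 := by
      have : (Icc (-(m : ℤ)) m).card = 2 * m + 1 := by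
        rw [Int.card_Icc]; omega
      simp only [B]
      rw [card_product, this]
      push_cast
      ring
    have hB0 : (0 : ℝ) < B.card := by rw [hBcard]; positivity
    obtain ⟨c, _, hc⟩ := Finset.exists_le_card_fiber_of_nsmul_le_card_of_maps_to
      (b := (S₁.card : ℝ) / B.card) hmaps (by exact card_pos.1 (by exact_mod_cast hB0))
      (by rw [nsmul_eq_mul, mul_div_cancel₀ _ hB0.ne'])
    refine ⟨S₁.filter fun x => F x = c, (filter_subset _ _).trans hS₁, ?_, ?_⟩
    · rw [div_le_iff₀ hB0, hBcard] at hc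
      rw [Multiset.card_cons]
      calc (S.card : ℝ) ≤ (2 * m + 1) ^ (2 * Γ.card) * S₁.card := hcard
        _ ≤ (2 * m + 1) ^ (2 * Γ.card) * ((S₁.filter fun x => F x = c).card * (2 * m + 1) ^ 2) := by
            gcongr
        _ = _ := by ring
    · intro δ hδ x hx y hy
      obtain ⟨hx1, hx2⟩ := mem_filter.1 hx
      obtain ⟨hy1, hy2⟩ := mem_filter.1 hy
      rcases Multiset.mem_cons.1 hδ with rfl | hδ
      · have hxy := hx2.trans hy2.symm
        simp only [F, Prod.mk.injEq] at hxy
        have h1 := Int.abs_sub_lt_one_of_floor_eq_floor hxy.1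
        have h2 := Int.abs_sub_lt_one_of_floor_eq_floor hxy.2
        rw [← mul_sub, abs_mul, abs_of_pos hm'] at h1 h2
        have h3 := Complex.norm_le_abs_re_add_abs_im (δ x - δ y)
        rw [Complex.sub_re, Complex.sub_im] at h3
        rw [le_div_iff₀ hm']
        nlinarith
      · exact hclose δ hδ x hx1 y hy1

/-- With mesh `1 / (2Kd + 1)`, the pigeonhole set translated to the origin lies in the unit ball of
the seminorm, so each of its points contributes at least `exp (-1)` to the mass. -/
lemma exp_neg_mul_card_le_expMass_bohrSeminorm [Fintype G] {K d : ℕ} {Γ : Multiset (AddChar G ℂ)}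
    (hΓ : Γ.card ≤ d) {H : ℝ} (hH : 1 + 2 * d * Real.log (4 * K * d + 3) ≤ H) :
    Real.exp (-H) * Fintype.card G ≤ expMass (bohrSeminorm K Γ) := by
  classical
  obtain ⟨S, -, hS, hclose⟩ := exists_large_subset_close Γ (m := 2 * K * d + 1) (by omega)
    (univ : Finset G)
  set M : ℝ := 4 * K * d + 3 with hM
  have hM1 : 1 ≤ M := by
    have : (0 : ℝ) ≤ 4 * K * d := by positivity
    linarith
  have hMm : (2 * ((2 * K * d + 1 : ℕ) : ℝ) + 1) = M := by rw [hM]; push_cast; ring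
  rw [hMm, card_univ] at hS
  have hS' : (Fintype.card G : ℝ) ≤ M ^ (2 * d) * S.card := by
    refine hS.trans ?_
    gcongr
  have hne : S.Nonempty := by
    rw [nonempty_iff_ne_empty]
    rintro rfl
    have : (0 : ℝ) < Fintype.card G := by exact_mod_cast Fintype.card_pos
    simp at hS'
  obtain ⟨y, hy⟩ := hne
  have hN : ∀ x ∈ S, bohrSeminorm K Γ (x - y) ≤ 1 := by
    intro x hx
    have hm0 : (0 : ℝ) < (2 * K * d + 1 : ℕ) := by positivity
    have h1 : (Γ.map fun γ => ‖γ (x - y) - 1‖).sum ≤ Γ.card * (2 / (2 * K * d + 1 : ℕ)) := by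
      rw [← nsmul_eq_mul, ← Multiset.card_map (fun γ : AddChar G ℂ => ‖γ (x - y) - 1‖) Γ]
      refine Multiset.sum_le_card_nsmul _ _ fun r hr => ?_
      obtain ⟨γ, hγ, rfl⟩ := Multiset.mem_map.1 hr
      have h2 := hclose γ hγ x hx y hy
      have hy0 : γ y ≠ 0 := (AddChar.val_isUnit γ y).ne_zero
      have h3 : γ (x - y) - 1 = (γ x - γ y) / γ y := by
        rw [AddChar.map_sub_eq_div, sub_div, div_self hy0]
      rwa [h3, norm_div, AddChar.norm_apply, div_one]
    rw [bohrSeminorm_apply]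
    calc (K : ℝ) * (Γ.map fun γ => ‖γ (x - y) - 1‖).sum
        ≤ K * (d * (2 / (2 * K * d + 1 : ℕ))) := by
          gcongr
          refine h1.trans ?_
          gcongr
      _ = 2 * K * d / (2 * K * d + 1 : ℕ) := by ring
      _ ≤ 1 := by
          rw [div_le_one hm0]
          push_cast
          linarith
  have hmass : Real.exp (-1) * S.card ≤ expMass (bohrSeminorm K Γ) := by
    calc Real.exp (-1) * S.card = ∑ _x ∈ S, Real.exp (-1) := by
          rw [sum_const, nsmul_eq_mul, mul_comm]
      _ ≤ ∑ x ∈ S, Real.exp (-bohrSeminorm K Γ (x - y)) := by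
          refine Finset.sum_le_sum fun x hx => ?_
          have := hN x hx
          gcongr
      _ ≤ ∑ x, Real.exp (-bohrSeminorm K Γ (x - y)) :=
          Finset.sum_le_sum_of_subset_of_nonneg (subset_univ _) fun _ _ _ => (Real.exp_pos _).le
      _ = expMass (bohrSeminorm K Γ) := by
          rw [expMass,
            ← Equiv.sum_comp (Equiv.subRight y) (fun x => Real.exp (-bohrSeminorm K Γ x))]
          rfl
  refine le_trans ?_ hmass
  have hexp : Real.exp (-H) * M ^ (2 * d) ≤ Real.exp (-1) := by
    have h4 : M ^ (2 * d) = Real.exp (2 * d * Real.log M) := by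
      rw [← Real.exp_log (show 0 < M by linarith), ← Real.exp_nat_mul, Real.log_exp]
      push_cast
      rfl
    rw [h4, ← Real.exp_add]
    apply Real.exp_le_exp.2
    linarith
  calc Real.exp (-H) * Fintype.card G ≤ Real.exp (-H) * (M ^ (2 * d) * S.card) := by gcongr
    _ = Real.exp (-H) * M ^ (2 * d) * S.card := by ring
    _ ≤ Real.exp (-1) * S.card := by gcongr

end Bohr

/-! ### Halved frequencies and one increment step. -/

section Step

variable {G : Type*} [AddCommGroup G] [Fintype G]

lemma two_nsmul_half (hodd : Odd (Fintype.card G)) (x : G) :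
    2 • ((Fintype.card G + 1) / 2) • x = x := by
  obtain ⟨r, hr⟩ := hodd
  rw [← mul_nsmul', show 2 * ((Fintype.card G + 1) / 2) = Fintype.card G + 1 by omega, add_nsmul,
    card_nsmul_eq_zero, zero_add, one_nsmul]

/-- Doubling, as a permutation of a finite abelian group of odd order. -/
def doublingEquiv (hodd : Odd (Fintype.card G)) : G ≃ G where
  toFun x := 2 • x
  invFun x := ((Fintype.card G + 1) / 2) • x
  left_inv x := (smul_comm _ _ x).trans (two_nsmul_half hodd x)
  right_inv x := two_nsmul_half hodd x

/-- The frequencies `γ ^ (1 / 2)` for `γ` in `Γ`. -/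
noncomputable def halfFreq (Γ : Multiset (AddChar G ℂ)) : Multiset (AddChar G ℂ) :=
  Γ.map fun γ => γ ^ ((Fintype.card G + 1) / 2)

lemma card_halfFreq (Γ : Multiset (AddChar G ℂ)) : (halfFreq Γ).card = Γ.card :=
  Multiset.card_map _ _

lemma bohrSeminorm_halfFreq (K : ℕ) (Γ : Multiset (AddChar G ℂ)) (x : G) :
    bohrSeminorm K (halfFreq Γ) x = bohrSeminorm K Γ (((Fintype.card G + 1) / 2) • x) := by
  simp only [bohrSeminorm_apply, halfFreq, Multiset.map_map, Function.comp_def, AddChar.pow_apply,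
    AddChar.map_nsmul_eq_pow]

lemma bohrSeminorm_halfFreq_two_nsmul (hodd : Odd (Fintype.card G)) (K : ℕ)
    (Γ : Multiset (AddChar G ℂ)) (x : G) :
    bohrSeminorm K (halfFreq Γ) (2 • x) = bohrSeminorm K Γ x := by
  rw [bohrSeminorm_halfFreq]
  exact congrArg _ ((doublingEquiv hodd).left_inv x)

lemma map_two_nsmul_le {G : Type*} [AddCommGroup G] (N : AddGroupSeminorm G) (x : G) :
    N (2 • x) ≤ 2 * N x := by
  rw [two_nsmul, two_mul]
  exact map_add_le_add N x x

lemma bohrSeminorm_le_two_mul_halfFreq (hodd : Odd (Fintype.card G)) (K : ℕ)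
    (Γ : Multiset (AddChar G ℂ)) (x : G) :
    bohrSeminorm K Γ x ≤ 2 * bohrSeminorm K (halfFreq Γ) x := by
  have := map_two_nsmul_le (bohrSeminorm K Γ) (((Fintype.card G + 1) / 2) • x)
  rwa [two_nsmul_half hodd, ← bohrSeminorm_halfFreq] at this

/-- Doubling carries a Bohr weight to the one with halved frequencies. Doubled mid-points thus
follow a Bohr weight of the same rank and scale. -/
lemma expWeight_halfFreq_two_nsmul (hodd : Odd (Fintype.card G)) (K : ℕ)
    (Γ : Multiset (AddChar G ℂ)) (x : G) :
    expWeight (bohrSeminorm K (halfFreq Γ)) (2 • x) = expWeight (bohrSeminorm K Γ) x := by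
  have hmass : expMass (bohrSeminorm K (halfFreq Γ)) = expMass (bohrSeminorm K Γ) := by
    unfold expMass
    rw [← Equiv.sum_comp (doublingEquiv hodd)]
    exact Finset.sum_congr rfl fun y _ =>
      congrArg (fun z => Real.exp (-z)) (bohrSeminorm_halfFreq_two_nsmul hodd K Γ y)
  rw [expWeight, expWeight, hmass, bohrSeminorm_halfFreq_two_nsmul hodd]

/-- The weighted number of three-term progressions in `h`. -/
noncomputable def apCount (h : G → ℝ) : ℝ := ∑ y, ∑ x, h y * (h x * h (2 • y - x))

lemma apCount_translate (h : G → ℝ) (s : G) : apCount (fun x => h (s + x)) = apCount h := by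
  unfold apCount
  rw [← Equiv.sum_comp (Equiv.addLeft s) (fun y => ∑ x, h y * (h x * h (2 • y - x)))]
  refine Finset.sum_congr rfl fun y _ => ?_
  rw [← Equiv.sum_comp (Equiv.addLeft s)
    (fun x => h (Equiv.addLeft s y) * (h x * h (2 • (Equiv.addLeft s y) - x)))]
  refine Finset.sum_congr rfl fun x _ => ?_
  simp only [Equiv.coe_addLeft]
  congr 3
  rw [nsmul_add, two_nsmul s]
  abel

/-- The progressions counted with local weights are a small multiple of all progressions. -/
lemma sum_weightedConv_le_apCount {N P : AddGroupSeminorm G} {H : ℝ}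
    (hN : Real.exp (-H) * Fintype.card G ≤ expMass N)
    (hP : Real.exp (-H) * Fintype.card G ≤ expMass P) {h h₂ : G → ℝ} (h0 : ∀ x, 0 ≤ h x)
    (hb : 0 < localDensity N h 0) (h₂0 : ∀ x, 0 ≤ h₂ x) (h₂h : ∀ x, h₂ x ≤ h x) :
    localDensity N h 0 * ∑ y, expWeight P y * h₂ y * weightedConv N h (2 • y) ≤
      (Real.exp H / Fintype.card G) ^ 2 * apCount h := by
  unfold apCount weightedConv
  simp only [Finset.mul_sum]
  refine Finset.sum_le_sum fun y _ => Finset.sum_le_sum fun x _ => ?_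
  have e1 : localDensity N h 0 * (expWeight P y * h₂ y *
      (expWeight N x * h x / localDensity N h 0 * h (2 • y - x))) =
      (expWeight P y * expWeight N x) * (h₂ y * (h x * h (2 • y - x))) := by
    field_simp
  rw [e1]
  have h3 : expWeight P y * expWeight N x ≤ (Real.exp H / Fintype.card G) ^ 2 := by
    rw [sq]
    exact mul_le_mul (expWeight_le_of_expMass hP y) (expWeight_le_of_expMass hN x)
      (expWeight_nonneg N x) (by positivity)
  have h4 : h₂ y * (h x * h (2 • y - x)) ≤ h y * (h x * h (2 • y - x)) :=
    mul_le_mul_of_nonneg_right (h₂h y) (mul_nonneg (h0 _) (h0 _))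
  exact mul_le_mul h3 h4 (mul_nonneg (h₂0 y) (mul_nonneg (h0 _) (h0 _))) (by positivity)

lemma localDensity_translate (N : AddGroupSeminorm G) (h : G → ℝ) (s x : G) :
    localDensity N (fun z => h (s + z)) x = localDensity N h (s + x) := by
  simp only [localDensity, add_assoc]

/-- The weight of mid-points: `g` weighted by a Bohr weight, truncated to a ball of `N` and pushed
forward under doubling. -/
lemma exists_doubled_weight (hodd : Odd (Fintype.card G)) {θ a : ℝ} {N : AddGroupSeminorm G}
    {K : ℕ} {Γ : Multiset (AddChar G ℂ)} (hfin : IsFiner θ N (bohrSeminorm K Γ)) (ha : 0 < a)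
    (hθa : 1000 * θ ≤ a) {g : G → ℝ} (g0 : ∀ x, 0 ≤ g x) (g1 : ∀ x, g x ≤ 1)
    (hbP : (1 - 2 / 100) * a ≤ localDensity (bohrSeminorm K Γ) g 0) :
    ∃ g₂ f : G → ℝ, (∀ y, 0 ≤ g₂ y) ∧ (∀ y, g₂ y ≤ g y) ∧ (∀ u, 0 ≤ f u) ∧ ∑ u, f u = 1 ∧
      (∀ u, f u ≤ 2 / a * expWeight (bohrSeminorm K (halfFreq Γ)) u) ∧
      (∀ u, f u ≠ 0 → N u ≤ 2 * θ) ∧ ∀ Φ : G → ℝ, (∀ u, 0 ≤ Φ u) →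
        a / 2 * ∑ u, f u * Φ u ≤ ∑ y, expWeight (bohrSeminorm K Γ) y * g₂ y * Φ (2 • y) := by
  set P := bohrSeminorm K Γ with hP
  set Q := bohrSeminorm K (halfFreq Γ) with hQ
  obtain ⟨g₂, hg₂⟩ : ∃ g₂ : G → ℝ, ∀ y, g₂ y = if N y ≤ θ then g y else 0 := ⟨_, fun _ => rfl⟩
  have g₂0 : ∀ y, 0 ≤ g₂ y := fun y => by
    rw [hg₂]
    split_ifs
    · exact g0 y
    · exact le_rfl
  have g₂g : ∀ y, g₂ y ≤ g y := fun y => by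
    rw [hg₂]
    split_ifs
    · exact le_rfl
    · exact g0 y
  obtain ⟨b₂, hb₂⟩ : ∃ b₂, b₂ = ∑ y, expWeight P y * g₂ y := ⟨_, rfl⟩
  have hb₂a : a / 2 ≤ b₂ := by
    have e1 : localDensity P g 0 ≤ b₂ + ∑ y with θ < N y, expWeight P y := by
      rw [localDensity_zero, hb₂, Finset.sum_filter, ← Finset.sum_add_distrib]
      refine Finset.sum_le_sum fun y _ => ?_
      have := expWeight_nonneg P y
      by_cases hy : N y ≤ θ
      · simp [hg₂, hy, not_lt.2 hy]
      · simp only [hg₂, hy, not_le.1 hy, if_true, if_false, mul_zero, zero_add]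
        exact mul_le_of_le_one_right this (g1 y)
    have e2 : ∑ y with θ < N y, expWeight P y ≤ θ := hfin
    linarith
  have hb₂0 : 0 < b₂ := by linarith
  obtain ⟨f, hf⟩ : ∃ f : G → ℝ, ∀ u,
      f u = expWeight Q u * g₂ ((doublingEquiv hodd).symm u) / b₂ := ⟨_, fun _ => rfl⟩
  have hf2 : ∀ y, f (2 • y) = expWeight P y * g₂ y / b₂ := fun y => by
    have : (doublingEquiv hodd).symm (2 • y) = y := (doublingEquiv hodd).symm_apply_apply y
    rw [hf, this, hQ, expWeight_halfFreq_two_nsmul hodd]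
  have hf1 : ∑ u, f u = 1 := by
    rw [← Equiv.sum_comp (doublingEquiv hodd)]
    change ∑ y, f (2 • y) = 1
    simp only [hf2]
    rw [← Finset.sum_div, ← hb₂, div_self hb₂0.ne']
  refine ⟨g₂, f, g₂0, g₂g, fun u => ?_, hf1, fun u => ?_, fun u hu => ?_, fun Φ hΦ => ?_⟩
  · rw [hf]
    exact div_nonneg (mul_nonneg (expWeight_nonneg Q u) (g₂0 _)) hb₂0.le
  · have e1 : g₂ ((doublingEquiv hodd).symm u) ≤ 1 := (g₂g _).trans (g1 _)
    have e2 : b₂⁻¹ ≤ 2 / a := by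
      rw [inv_le_comm₀ hb₂0 (by positivity), inv_div]
      exact hb₂a
    have e3 := expWeight_nonneg Q u
    rw [hf, div_eq_mul_inv, mul_comm]
    exact mul_le_mul e2 (mul_le_of_le_one_right e3 e1) (mul_nonneg e3 (g₂0 _)) (by positivity)
  · have e1 : g₂ ((doublingEquiv hodd).symm u) ≠ 0 := fun h => hu (by simp [hf, h])
    have e2 : N ((doublingEquiv hodd).symm u) ≤ θ := by
      by_contra hcon
      exact e1 (by simp [hg₂, hcon])
    have e3 := map_two_nsmul_le N ((doublingEquiv hodd).symm u)
    have e4 : 2 • (doublingEquiv hodd).symm u = u := (doublingEquiv hodd).apply_symm_apply u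
    rw [e4] at e3
    linarith
  · have hsum : ∑ u, f u * Φ u = b₂⁻¹ * ∑ y, expWeight P y * g₂ y * Φ (2 • y) := by
      rw [← Equiv.sum_comp (doublingEquiv hodd)]
      change ∑ y, f (2 • y) * Φ (2 • y) = _
      simp only [hf2, Finset.mul_sum]
      exact Finset.sum_congr rfl fun y _ => by ring
    have h0 : 0 ≤ ∑ y, expWeight P y * g₂ y * Φ (2 • y) := Finset.sum_nonneg fun y _ =>
      mul_nonneg (mul_nonneg (expWeight_nonneg P y) (g₂0 y)) (hΦ _)
    rw [hsum, ← mul_assoc]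
    refine mul_le_of_le_one_left h0 ?_
    rw [← div_eq_mul_inv, div_le_one hb₂0]
    exact hb₂a

/-- The density increment step: either some Bohr weight with few more frequencies and a comparable
scale sees a larger density, or there are many three-term progressions. -/
lemma exists_increment_or_le_apCount (hodd : Odd (Fintype.card G)) {a₀ a θ H : ℝ} {k l n : ℕ}
    (hpar : IncrementParams a₀ θ k l n) (ha₀ : a₀ ≤ a) {K m : ℕ} (hK : 0 < K) (hm : 2 ≤ m)
    {Γ : Multiset (AddChar G ℂ)}
    (hbig : ∀ (K' : ℕ) (Γ' : Multiset (AddChar G ℂ)), K' ≤ m ^ 5 * K → Γ'.card ≤ Γ.card + n →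
      Real.exp (-H) * Fintype.card G ≤ expMass (bohrSeminorm K' Γ'))
    (hmθ : H + Real.log (1 / θ) ≤ m * θ) {h : G → ℝ} (h0 : ∀ x, 0 ≤ h x) (h1 : ∀ x, h x ≤ 1)
    {x₀ : G} (hx₀ : a ≤ localDensity (bohrSeminorm K Γ) h x₀) :
    (∃ K' : ℕ, 0 < K' ∧ K' ≤ m ^ 5 * K ∧ ∃ Γ' : Multiset (AddChar G ℂ), Γ'.card ≤ Γ.card + n ∧
      ∃ x, (1 + 1 / 100) * a ≤ localDensity (bohrSeminorm K' Γ') h x) ∨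
    a ^ 3 / 8 * Real.exp (-(2 * H)) * (Fintype.card G : ℝ) ^ 2 ≤ apCount h := by
  classical
  by_cases hinc : ∃ K' : ℕ, 0 < K' ∧ K' ≤ m ^ 5 * K ∧ ∃ Γ' : Multiset (AddChar G ℂ),
      Γ'.card ≤ Γ.card + n ∧ ∃ x, (1 + 1 / 100) * a ≤ localDensity (bohrSeminorm K' Γ') h x
  · exact Or.inl hinc
  right
  push Not at hinc
  have ha : 0 < a := hpar.a_pos.trans_le ha₀
  have ha1 : a ≤ 1 := hx₀.trans (localDensity_le_one _ h1 _)
  have hθ := hpar.θ_pos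
  have hθa := hpar.θ_le
  have hm1 : 1 ≤ m := by omega
  have hmR : (1 : ℝ) ≤ m := by exact_mod_cast hm1
  have hpow : ∀ {i j : ℕ}, i ≤ j → m ^ i * K ≤ m ^ j * K := fun hij =>
    Nat.mul_le_mul_right K (Nat.pow_le_pow_right (by omega) hij)
  have hpos : ∀ i : ℕ, 0 < m ^ i * K := fun i => by positivity
  have hsucc : ∀ (i : ℕ) (Γ : Multiset (AddChar G ℂ)) (x : G),
      m * bohrSeminorm (m ^ i * K) Γ x = bohrSeminorm (m ^ (i + 1) * K) Γ x := fun i Γ x => by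
    rw [← bohrSeminorm_mul, pow_succ', mul_assoc]
  have hcardH : (halfFreq Γ).card ≤ Γ.card + n := by rw [card_halfFreq]; omega
  -- A tower of scales with ratio `m`: `N₁` carries the end-points, `P` the mid-points and `Q` their
  -- doubles, `N₃` the almost-periods, and `N₅` defines dissociativity. Scale `m ^ 5 * K` is left
  -- for the weight with new frequencies.
  set N₁ := bohrSeminorm (m ^ 1 * K) Γ with hN₁
  set P := bohrSeminorm (m ^ 2 * K) Γ with hP
  set Q := bohrSeminorm (m ^ 2 * K) (halfFreq Γ) with hQ
  set N₃ := bohrSeminorm (m ^ 3 * K) (halfFreq Γ) with hN₃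
  set N₅ := bohrSeminorm (m ^ 4 * K) (halfFreq Γ) with hN₅
  have bigN₁ := hbig (m ^ 1 * K) Γ (hpow (by norm_num)) (by omega)
  have bigP := hbig (m ^ 2 * K) Γ (hpow (by norm_num)) (by omega)
  have hfin : ∀ (N N' : AddGroupSeminorm G), Real.exp (-H) * Fintype.card G ≤ expMass N' →
      (∀ x, m * N x ≤ N' x) → IsFiner θ N N' := fun N N' hN' hle =>
    isFiner_of_le hθ (Nat.cast_nonneg m) hN' hle hmθ
  have hf01 : IsFiner θ (bohrSeminorm K Γ) N₁ := hfin _ _ bigN₁ fun x => by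
    rw [hN₁, pow_one, bohrSeminorm_mul]
  have hf0P : IsFiner θ (bohrSeminorm K Γ) P := hfin _ _ bigP fun x => by
    rw [hP, bohrSeminorm_mul]
    have := apply_nonneg (bohrSeminorm K Γ) x
    gcongr
    nlinarith
  have hf1P : IsFiner θ N₁ P := hfin _ _ bigP fun x => (hsucc 1 Γ x).le
  have hfQ3 : IsFiner θ Q N₃ := hfin _ _ (hbig _ _ (hpow (by norm_num)) hcardH)
    fun x => (hsucc 2 _ x).le
  have hf35 : IsFiner θ N₃ N₅ := hfin _ _ (hbig _ _ (hpow (by norm_num)) hcardH)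
    fun x => (hsucc 3 _ x).le
  -- One factor `m ≥ 2` pays for the 2 lost in halving the frequencies.
  have hN₁Q : ∀ x, N₁ x ≤ Q x := fun x => by
    have e1 := bohrSeminorm_le_two_mul_halfFreq hodd (m ^ 1 * K) Γ x
    have e2 := hsucc 1 (halfFreq Γ) x
    have e3 := apply_nonneg (bohrSeminorm (m ^ 1 * K) (halfFreq Γ)) x
    have e4 : (2 : ℝ) ≤ m := by exact_mod_cast hm
    have e5 := mul_le_mul_of_nonneg_right e4 e3
    rw [hN₁, hQ]
    norm_num at e2 ⊢
    norm_num at e1 e5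
    linarith
  have hQN₅ : ∀ x, Q x ≤ N₅ x := fun x => bohrSeminorm_mono (hpow (by norm_num)) _ x
  obtain ⟨s, hs1, hsP⟩ := exists_simultaneous_localDensity (c := 1 / 100) hf01 hf0P hθ.le
    (by linarith) (by linarith) ha.le h0 hx₀
    (fun y => (hinc _ (hpos 1) (hpow (by norm_num)) Γ (by omega) y).le)
    (fun y => (hinc _ (hpos 2) (hpow (by norm_num)) Γ (by omega) y).le)
  rw [← apCount_translate h s]
  set g : G → ℝ := fun x => h (s + x) with hg
  have g0 : ∀ x, 0 ≤ g x := fun x => h0 _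
  have g1 : ∀ x, g x ≤ 1 := fun x => h1 _
  have hgd : ∀ (N : AddGroupSeminorm G) (x : G), localDensity N g x = localDensity N h (s + x) :=
    fun N x => localDensity_translate N h s x
  have hb1 : (1 - 2 / 100) * a ≤ localDensity N₁ g 0 := by
    rw [hgd, add_zero]
    linarith
  have hbP : (1 - 2 / 100) * a ≤ localDensity P g 0 := by
    rw [hgd, add_zero]
    linarith
  have hb0 : 0 < localDensity N₁ g 0 := by linarith
  obtain ⟨g₂, f, g₂0, g₂g, hf0, hf1, hfQ, hfN, hfΦ⟩ :=
    exists_doubled_weight hodd hf1P ha (by linarith) g0 g1 hbP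
  have hcore := half_le_sum_mul_weightedConv hpar ha₀ ha1 (f := f) g0 g1 hN₁Q hQN₅ hfQ3 hf35 hb1
    hf0 hf1 hfQ hfN
    (fun Λ hΛ => by
      have hcard : (halfFreq Γ + Λ.val).card ≤ Γ.card + n := by
        rw [Multiset.card_add, card_halfFreq]
        exact Nat.add_le_add_left hΛ _
      refine ⟨bohrSeminorm (m ^ 5 * K) (halfFreq Γ + Λ.val), ?_, fun x => ?_⟩
      · have e1 : IsFiner θ (N₅ + bohrSeminorm 1 Λ.val)
            (bohrSeminorm (m ^ 5 * K) (halfFreq Γ + Λ.val)) :=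
          hfin _ _ (hbig _ _ le_rfl hcard) fun x => by
            rw [add_apply, mul_add, hsucc 4]
            simp only [bohrSeminorm_apply, Multiset.map_add, Multiset.sum_add]
            rw [mul_add, ← mul_assoc]
            have e2 := bohrSum_nonneg Λ.val x
            gcongr
            push_cast
            rw [mul_one]
            have e3 : (1 : ℝ) ≤ K := by exact_mod_cast hK
            have e4 : (m : ℝ) ≤ m ^ 5 := le_self_pow₀ hmR (by norm_num)
            nlinarith
        have e5 := e1.one_sub_le
        simp only [add_apply, bohrSeminorm_apply 1, Nat.cast_one, one_mul] at e5
        exact e5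
      · rw [hgd]
        exact (hinc _ (hpos 5) le_rfl _ hcard _).le)
  have hap := sum_weightedConv_le_apCount bigN₁ bigP g0 hb0 g₂0 g₂g
  have hfX := hfΦ _ (weightedConv_nonneg N₁ g0)
  set X := ∑ y, expWeight P y * g₂ y * weightedConv N₁ g (2 • y)
  -- One factor `a / 2` each comes from the end-point density, the mid-point mass and the core
  -- estimate.
  have hX : a ^ 3 / 8 ≤ localDensity N₁ g 0 * X := by
    have e1 : a / 2 * (a / 2) ≤ X := 
      (mul_le_mul_of_nonneg_left hcore (by linarith)).trans hfX
    have e2 : a / 2 * (a / 2 * (a / 2)) ≤ localDensity N₁ g 0 * X :=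
      mul_le_mul (by linarith) e1 (by positivity) hb0.le
    calc a ^ 3 / 8 = a / 2 * (a / 2 * (a / 2)) := by ring
      _ ≤ _ := e2
  have hcard : (0 : ℝ) < Fintype.card G := by exact_mod_cast Fintype.card_pos
  calc a ^ 3 / 8 * Real.exp (-(2 * H)) * (Fintype.card G : ℝ) ^ 2
      ≤ (Real.exp H / Fintype.card G) ^ 2 * apCount g * Real.exp (-(2 * H)) *
          (Fintype.card G : ℝ) ^ 2 := by
        gcongr
        exact hX.trans hap
    _ = apCount g * (Real.exp H ^ 2 * Real.exp (-(2 * H))) := by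
        field_simp
    _ = apCount g := by
        rw [← Real.exp_nat_mul, ← Real.exp_add]
        simp

end Step

/-! ### Iterating the increment. -/

section Iteration

variable {G : Type*} [AddCommGroup G] [Fintype G]

/-- `hH` bounds below the mass of every weight reachable in `J` steps, and `hJ` rules out `J`
consecutive increments. The parameters are fixed by the initial density and remain valid as it
grows. -/
lemma le_apCount_of_params (hodd : Odd (Fintype.card G)) {a θ H : ℝ} {k l n J m : ℕ}
    (hpar : IncrementParams a θ k l n) (hm : 2 ≤ m) (hmθ : H + Real.log (1 / θ) ≤ m * θ)
    (hJ : 1 < (1 + 1 / 100) ^ J * a)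
    (hH : 1 + 2 * (J * n : ℕ) * Real.log (4 * (m ^ (5 * J) : ℕ) * (J * n : ℕ) + 3) ≤ H)
    {h : G → ℝ} (h0 : ∀ x, 0 ≤ h x) (h1 : ∀ x, h x ≤ 1)
    (ha : a ≤ localDensity (bohrSeminorm 1 0) h 0) :
    a ^ 3 / 8 * Real.exp (-(2 * H)) * (Fintype.card G : ℝ) ^ 2 ≤ apCount h := by
  by_contra hcon
  have hbig : ∀ (K : ℕ) (Γ : Multiset (AddChar G ℂ)), K ≤ m ^ (5 * J) → Γ.card ≤ J * n →
      Real.exp (-H) * Fintype.card G ≤ expMass (bohrSeminorm K Γ) := by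
    intro K Γ hK hΓ
    refine exp_neg_mul_card_le_expMass_bohrSeminorm hΓ (le_trans ?_ hH)
    gcongr
  have key : ∀ j ≤ J, ∃ K : ℕ, 0 < K ∧ K ≤ m ^ (5 * j) ∧ ∃ Γ : Multiset (AddChar G ℂ),
      Γ.card ≤ j * n ∧ ∃ x, (1 + 1 / 100) ^ j * a ≤ localDensity (bohrSeminorm K Γ) h x := by
    intro j
    induction j with
    | zero => exact fun _ => ⟨1, one_pos, by simp, 0, by simp, 0, by simpa using ha⟩
    | succ j ih =>
      intro hj
      obtain ⟨K, hK0, hK, Γ, hΓ, x, hx⟩ := ih (by omega)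
      have hKm : m ^ 5 * K ≤ m ^ (5 * (j + 1)) := by
        calc m ^ 5 * K ≤ m ^ 5 * m ^ (5 * j) := Nat.mul_le_mul_left _ hK
          _ = m ^ (5 * (j + 1)) := by ring
      have hΓn : Γ.card + n ≤ (j + 1) * n := by rw [add_one_mul]; omega
      have haj : a ≤ (1 + 1 / 100) ^ j * a :=
        le_mul_of_one_le_left hpar.a_pos.le (one_le_pow₀ (by norm_num))
      rcases exists_increment_or_le_apCount hodd hpar haj hK0 hm
        (fun K' Γ' hK' hΓ' => hbig K' Γ'
          (hK'.trans (hKm.trans (Nat.pow_le_pow_right (by omega) (by omega))))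
          (hΓ'.trans (hΓn.trans (Nat.mul_le_mul_right n hj)))) hmθ h0 h1 hx with
        ⟨K', hK'0, hK', Γ', hΓ', y, hy⟩ | hap
      · refine ⟨K', hK'0, hK'.trans hKm, Γ', hΓ'.trans hΓn, y, ?_⟩
        rwa [pow_succ', mul_assoc]
      · refine absurd (le_trans ?_ hap) hcon
        have := hpar.a_pos
        gcongr
  obtain ⟨K, -, -, Γ, -, x, hx⟩ := key J le_rfl
  have := localDensity_le_one (bohrSeminorm K Γ) h1 x
  linarith

end Iteration

/-! ### Choice of parameters. -/

section Parameters

lemma two_le_log_eight_div {a : ℝ} (ha0 : 0 < a) (ha1 : a ≤ 1) : 2 ≤ Real.log (8 / a) := by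
  rw [Real.le_log_iff_exp_le (by positivity)]
  have h1 : Real.exp 2 ≤ 8 := by
    have : Real.exp 2 = Real.exp 1 ^ 2 := by rw [← Real.exp_nat_mul]; norm_num
    rw [this]
    calc Real.exp 1 ^ 2 ≤ 2.7182818286 ^ 2 := by
          gcongr
          exact Real.exp_one_lt_d9.le
      _ ≤ 8 := by norm_num
  exact h1.trans (by rw [le_div_iff₀ ha0]; nlinarith)

/-- The sizes are `l ~ L`, `k ~ l² L / a ~ L³ / a` and `n ~ k L ~ L⁴ / a`. -/
lemma exists_incrementParams {a L : ℝ} (ha0 : 0 < a) (ha1 : a ≤ 1) (hL : L = Real.log (8 / a)) :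
    ∃ θ : ℝ, ∃ k l n : ℕ, IncrementParams a θ k l n ∧ (n : ℝ) ≤ 10 ^ 11 * L ^ 4 / a ∧
      1 / θ ≤ 10 ^ 11 * L ^ 4 / a := by
  have hL2 : 2 ≤ L := hL ▸ two_le_log_eight_div ha0 ha1
  have hexpL : Real.exp L = 8 / a := by rw [hL, Real.exp_log (by positivity)]
  have hexpn : ∀ j : ℕ, Real.exp (j * L) = (8 / a) ^ j := fun j => by
    rw [Real.exp_nat_mul, hexpL]
  have hLa : L ≤ 8 / a := by
    rw [← hexpL]
    have := Real.add_one_le_exp L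
    linarith
  have ha1' : 1 ≤ 1 / a := by rw [le_div_iff₀ ha0]; linarith
  set l : ℕ := ⌈3 * L⌉₊ with hl
  have hl1 : 3 * L ≤ l := Nat.le_ceil _
  have hl2 : (l : ℝ) ≤ 4 * L := by
    have := Nat.ceil_lt_add_one (show 0 ≤ 3 * L by linarith)
    linarith
  have hl0 : (0 : ℝ) < l := by linarith
  -- `360000 = 4 * 300²` inverts the sampling exponent. The resulting `exp (-7L) = (a/8)^7` absorbs
  -- `9600 l ≤ 9600 * 32 / a` and leaves at most `a²`.
  set k : ℕ := ⌈360000 * l ^ 2 * (7 * L) / a⌉₊ with hk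
  have hk1 : 360000 * l ^ 2 * (7 * L) / a ≤ k := Nat.le_ceil _
  have hL3a : 8 ≤ L ^ 3 / a := by
    rw [le_div_iff₀ ha0]
    have : (8 : ℝ) ≤ L ^ 3 := by
      calc (8 : ℝ) = 2 ^ 3 := by norm_num
        _ ≤ L ^ 3 := by gcongr
    nlinarith
  have hk2 : (k : ℝ) ≤ 5 * 10 ^ 7 * (L ^ 3 / a) := by
    have h1 := Nat.ceil_lt_add_one (show 0 ≤ 360000 * (l : ℝ) ^ 2 * (7 * L) / a by positivity)
    have h2 : 360000 * (l : ℝ) ^ 2 * (7 * L) / a ≤ 360000 * (4 * L) ^ 2 * (7 * L) / a := by gcongr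
    have h3 : 360000 * (4 * L) ^ 2 * (7 * L) / a = 40320000 * (L ^ 3 / a) := by ring
    linarith
  have hk0 : (1 : ℝ) ≤ k := by
    refine le_trans ?_ hk1
    rw [le_div_iff₀ ha0]
    have : (1 : ℝ) ≤ l ^ 2 := one_le_pow₀ (by linarith)
    nlinarith
  set n : ℕ := ⌈32 * ((k + 2) * L)⌉₊ with hn
  have hn1 : 32 * ((k + 2) * L) ≤ n := Nat.le_ceil _
  have hn2 : (n : ℝ) ≤ 97 * (k * L) := by
    have h1 := Nat.ceil_lt_add_one (show 0 ≤ 32 * (((k : ℝ) + 2) * L) by positivity)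
    have h2 : ((k : ℝ) + 2) * L ≤ 3 * k * L := by
      gcongr
      linarith
    nlinarith
  have hn3 : (n : ℝ) ≤ 485 * 10 ^ 7 * (L ^ 4 / a) := by
    calc (n : ℝ) ≤ 97 * (k * L) := hn2
      _ ≤ 97 * (5 * 10 ^ 7 * (L ^ 3 / a) * L) := by gcongr
      _ = _ := by ring
  -- Each summand of `D = 1 / θ` enforces an upper bound on `θ`: through `n`, through `k`, and, for
  -- the last, through `a` and `l`.
  set D : ℝ := 4 * n + 4 * k + 4000 * l / a with hD
  have hD0 : 0 < D := by positivity
  have hLa4 : L ^ 3 / a ≤ L ^ 4 / a := by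
    have : L ^ 3 ≤ L ^ 4 := pow_le_pow_right₀ (by linarith) (by norm_num)
    gcongr
  have hLa1 : L / a ≤ L ^ 4 / a := by
    have : L ≤ L ^ 4 := le_self_pow₀ (by linarith) (by norm_num)
    gcongr
  have hDle : D ≤ 10 ^ 11 * (L ^ 4 / a) := by
    have h1 : 4000 * (l : ℝ) / a ≤ 16000 * (L / a) := by
      calc 4000 * (l : ℝ) / a ≤ 4000 * (4 * L) / a := by gcongr
        _ = _ := by ring
    have : 0 ≤ L ^ 4 / a := by positivity
    rw [hD]
    linarith
  refine ⟨1 / D, k, l, n, ⟨ha0, by positivity, by exact_mod_cast hl0,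
    by exact_mod_cast (show (0 : ℝ) < k by linarith), ?_, ?_, ?_, ?_, ?_, ?_, ?_⟩, ?_, ?_⟩
  · have h1 : (8 / a) ^ 3 ≤ 4 ^ l := by
      rw [← hexpn]
      calc Real.exp ((3 : ℕ) * L) ≤ Real.exp (l * 1) := by
            apply Real.exp_le_exp.2
            push_cast
            linarith
        _ = Real.exp 1 ^ l := Real.exp_nat_mul 1 l
        _ ≤ 4 ^ l := by
            gcongr
            exact Real.exp_one_lt_d9.le.trans (by norm_num)
    have h2 : 200 / a ≤ 4 ^ l := by
      refine le_trans ?_ h1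
      rw [div_pow, div_le_div_iff₀ ha0 (by positivity)]
      have : a ^ 3 ≤ a := pow_le_of_le_one ha0.le ha1 (by norm_num)
      nlinarith
    rw [one_div, inv_pow, ← div_eq_mul_inv, div_le_iff₀ (by positivity)]
    calc (2 : ℝ) = a / 100 * (200 / a) := by field_simp; norm_num
      _ ≤ a / 100 * 4 ^ l := by gcongr
  · have h1 : 7 * L ≤ k * (1 / (300 * l)) ^ 2 * a / 4 := by
      calc 7 * L = 360000 * l ^ 2 * (7 * L) / a * (1 / (300 * l)) ^ 2 * a / 4 := by
            field_simp; norm_num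
        _ ≤ _ := by gcongr
    have h2 : Real.exp (-(k * (1 / (300 * l)) ^ 2 * a / 4)) ≤ (a / 8) ^ 7 := by
      calc _ ≤ Real.exp (-((7 : ℕ) * L)) := by
            apply Real.exp_le_exp.2
            push_cast
            linarith
        _ = (a / 8) ^ 7 := by rw [Real.exp_neg, hexpn, ← inv_pow, inv_div]
    have h3 : (l : ℝ) ≤ 32 / a := by
      have : 4 * (8 / a) = 32 / a := by ring
      linarith
    calc _ ≤ 9600 * (32 / a) * (a / 8) ^ 7 := by gcongr
      _ = (9600 * 32 / 8 ^ 7) * a ^ 6 := by field_simp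
      _ ≤ 1 * a ^ 6 := by gcongr; norm_num
      _ ≤ a ^ 2 := by
          rw [one_mul]
          exact pow_le_pow_of_le_one ha0.le ha1 (by norm_num)
  · have h1 : (32 : ℝ) < Real.exp ((2 : ℕ) * L) := by
      rw [hexpn, div_pow, lt_div_iff₀ (by positivity)]
      have : a ^ 2 ≤ 1 := pow_le_one₀ ha0.le ha1
      norm_num
      linarith
    have h2 : (2 / a) ^ k ≤ Real.exp (k * L) := by
      rw [hexpn]
      gcongr
      norm_num
    calc 32 * (2 / a) ^ k < Real.exp ((2 : ℕ) * L) * Real.exp (k * L) :=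
          mul_lt_mul_of_pos_of_nonneg' h1 h2 (by positivity) (by positivity)
      _ = Real.exp ((k + 2) * L) := by
          rw [← Real.exp_add]
          push_cast
          ring_nf
      _ ≤ Real.exp (n / 32) := by
          apply Real.exp_le_exp.2
          linarith
  · have h1 : 4000 * l / a ≤ D := by
      have : (0 : ℝ) ≤ 4 * n + 4 * k := by positivity
      linarith
    rw [div_le_iff₀ ha0] at h1
    rw [mul_one_div, div_mul_eq_mul_div, div_le_iff₀ hD0]
    linarith
  · rw [mul_one_div, div_le_iff₀ hD0]
    have : 0 ≤ 4000 * (l : ℝ) / a := by positivity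
    have : (0 : ℝ) ≤ n := by positivity
    linarith
  · rw [mul_one_div, div_le_iff₀ hD0]
    have : 0 ≤ 4000 * (l : ℝ) / a := by positivity
    linarith
  · have h1 : 4000 * l / a ≤ D := by
      have : (0 : ℝ) ≤ 4 * n + 4 * k := by positivity
      linarith
    rw [div_le_iff₀ ha0] at h1
    rw [mul_one_div, div_le_iff₀ hD0]
    linarith
  · have : 0 ≤ L ^ 4 / a := by positivity
    rw [mul_div_assoc]
    linarith
  · rw [one_div_one_div, mul_div_assoc]
    exact hDle

lemma exists_ge_affine_log (A B : ℝ) : ∃ x : ℝ, 1 ≤ x ∧ A + B * Real.log x ≤ x := by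
  have h1 := (Real.isLittleO_log_id_atTop.const_mul_left B).def (show (0 : ℝ) < 1 / 2 by norm_num)
  obtain ⟨x, hx, hx1, hxA⟩ := (h1.and ((Filter.eventually_ge_atTop 1).and
    (Filter.eventually_ge_atTop (2 * A)))).exists
  refine ⟨x, hx1, ?_⟩
  simp only [Real.norm_eq_abs, id] at hx
  rw [abs_of_nonneg (show 0 ≤ x by linarith)] at hx
  have := le_abs_self (B * Real.log x)
  linarith

/-- The dependence is circular: `m` must exceed roughly `H / θ`, while `H` must dominate rank times
log-scale, hence `log m`. Since `C₀` re-enters only through its logarithm, a large `C₀` closes the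
loop. The power 7 is `L ^ 5 / a` for the rank times `L ^ 2` for the log-scale. -/
lemma exists_scale_and_size {C : ℝ} (hC : 1 ≤ C) : ∃ C₀ : ℝ, 1 ≤ C₀ ∧
    ∀ a L : ℝ, 0 < a → a ≤ 1 → L = Real.log (8 / a) → ∀ (θ : ℝ) (n J : ℕ), 0 < θ →
      (n : ℝ) ≤ C * L ^ 4 / a → 1 / θ ≤ C * L ^ 4 / a → (J : ℝ) ≤ 201 * L →
      ∃ m : ℕ, 2 ≤ m ∧ C₀ * L ^ 7 / a + Real.log (1 / θ) ≤ m * θ ∧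
        1 + 2 * (J * n : ℕ) * Real.log (4 * (m ^ (5 * J) : ℕ) * (J * n : ℕ) + 3) ≤
          C₀ * L ^ 7 / a := by
  obtain ⟨C₀, hC₀, hle⟩ := exists_ge_affine_log
    (1 + 402 * C * (Real.log (1407 * C) + 6 + 1005 * (Real.log (5 * C ^ 2) + 13)))
    (402 * C * 1005)
  refine ⟨C₀, hC₀, fun a L ha0 ha1 hL θ n J hθ hn hθL hJ => ?_⟩
  have hL2 : 2 ≤ L := hL ▸ two_le_log_eight_div ha0 ha1
  have hexpL : Real.exp L = 8 / a := by rw [hL, Real.exp_log (by positivity)]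
  have hLe : L ≤ Real.exp L := by
    have := Real.add_one_le_exp L
    linarith
  have hae : 1 / a ≤ Real.exp L := by
    rw [hexpL]
    gcongr
    norm_num
  set E := Real.exp L with hE
  have hE1 : 1 ≤ E := by linarith
  have hpoly : ∀ j : ℕ, L ^ j / a ≤ E ^ (j + 1) := fun j => by
    calc L ^ j / a = L ^ j * (1 / a) := by ring
      _ ≤ E ^ j * E := by gcongr
      _ = _ := (pow_succ _ _).symm
  set H := C₀ * L ^ 7 / a with hH
  have hH1 : H ≤ C₀ * E ^ 8 := by
    rw [hH, mul_div_assoc]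
    exact mul_le_mul_of_nonneg_left (hpoly 7) (by linarith)
  have hH0 : 0 ≤ H := by positivity
  have hθE : 1 / θ ≤ C * E ^ 5 := by
    refine hθL.trans ?_
    rw [mul_div_assoc]
    exact mul_le_mul_of_nonneg_left (hpoly 4) (by linarith)
  have hlogθ : Real.log (1 / θ) ≤ C * E ^ 5 :=
    (Real.log_le_self (by positivity)).trans hθE
  -- `C * E ^ 5` majorises `log (1 / θ)`, and the final 2 secures `2 ≤ m`.
  set m : ℕ := ⌈(H + C * E ^ 5) * (1 / θ)⌉₊ + 2 with hm
  have hm1 : (H + C * E ^ 5) * (1 / θ) ≤ m := by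
    rw [hm]
    push_cast
    have := Nat.le_ceil ((H + C * E ^ 5) * (1 / θ))
    linarith
  have hm2 : (m : ℝ) ≤ 5 * C ^ 2 * C₀ * E ^ 13 := by
    have h1 := Nat.ceil_lt_add_one (show 0 ≤ (H + C * E ^ 5) * (1 / θ) by positivity)
    have h2 : (H + C * E ^ 5) * (1 / θ) ≤ (C₀ * E ^ 8 + C * E ^ 5) * (C * E ^ 5) := by gcongr
    have h3 : C * E ^ 5 * (C * E ^ 5) ≤ C ^ 2 * C₀ * E ^ 13 := by
      calc C * E ^ 5 * (C * E ^ 5) = C ^ 2 * 1 * E ^ 10 := by ring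
        _ ≤ C ^ 2 * C₀ * E ^ 13 := by
          gcongr
          norm_num
    have h4 : C₀ * E ^ 8 * (C * E ^ 5) ≤ C ^ 2 * C₀ * E ^ 13 := by
      calc C₀ * E ^ 8 * (C * E ^ 5) = C * C₀ * E ^ 13 := by ring
        _ ≤ C ^ 2 * C₀ * E ^ 13 := by
          gcongr
          exact le_self_pow₀ hC (by norm_num)
    have h5 : 1 ≤ C ^ 2 * C₀ * E ^ 13 :=
      one_le_mul_of_one_le_of_one_le (one_le_mul_of_one_le_of_one_le (one_le_pow₀ hC) hC₀)
        (one_le_pow₀ hE1)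
    rw [hm]
    push_cast
    linarith
  have hm0 : (0 : ℝ) < m := by rw [hm]; positivity
  set q := Real.log (5 * C ^ 2) + Real.log C₀ + 13 with hq
  have hlogC : 0 ≤ Real.log (5 * C ^ 2) := by
    apply Real.log_nonneg
    have : 1 ≤ C ^ 2 := one_le_pow₀ hC
    linarith
  have hlogC₀ : 0 ≤ Real.log C₀ := Real.log_nonneg hC₀
  have hlogm : Real.log m ≤ q * L := by
    calc Real.log m ≤ Real.log (5 * C ^ 2 * C₀ * E ^ 13) := Real.log_le_log hm0 hm2
      _ = Real.log (5 * C ^ 2) + Real.log C₀ + 13 * L := by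
          rw [Real.log_mul (by positivity) (by positivity), Real.log_mul (by positivity)
            (by positivity), Real.log_pow, hE, Real.log_exp]
          norm_num
      _ ≤ q * L := by
          rw [hq]
          nlinarith
  have hJn : ((J * n : ℕ) : ℝ) ≤ 201 * C * (L ^ 5 / a) := by
    push_cast
    calc (J : ℝ) * n ≤ 201 * L * (C * L ^ 4 / a) := by gcongr
      _ = _ := by ring
  have hJnE : ((J * n : ℕ) : ℝ) ≤ 201 * C * E ^ 6 :=
    hJn.trans (mul_le_mul_of_nonneg_left (hpoly 5) (by linarith))
  refine ⟨m, by omega, ?_, ?_⟩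
  · calc H + Real.log (1 / θ) ≤ H + C * E ^ 5 := by linarith
      _ = (H + C * E ^ 5) * (1 / θ) * θ := by field_simp
      _ ≤ m * θ := by gcongr
  · have hM1 : (1 : ℝ) ≤ (m ^ (5 * J) : ℕ) := by
      exact_mod_cast Nat.one_le_pow _ _ (by omega)
    have h1 : 4 * ((m ^ (5 * J) : ℕ) : ℝ) * (J * n : ℕ) + 3 ≤
        1407 * C * E ^ 6 * (m ^ (5 * J) : ℕ) := by
      have h2 : 1 ≤ C * E ^ 6 := one_le_mul_of_one_le_of_one_le hC (one_le_pow₀ hE1)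
      have h3 : 4 * ((m ^ (5 * J) : ℕ) : ℝ) * (J * n : ℕ) ≤
          4 * (m ^ (5 * J) : ℕ) * (201 * C * E ^ 6) := by gcongr
      have h4 : 1 ≤ C * E ^ 6 * (m ^ (5 * J) : ℕ) := one_le_mul_of_one_le_of_one_le h2 hM1
      nlinarith
    have h5 : Real.log (4 * ((m ^ (5 * J) : ℕ) : ℝ) * (J * n : ℕ) + 3) ≤
        (Real.log (1407 * C) + 6 + 1005 * q) * L ^ 2 := by
      have hlog7 : 0 ≤ Real.log (1407 * C) := Real.log_nonneg (by linarith)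
      calc _ ≤ Real.log (1407 * C * E ^ 6 * (m ^ (5 * J) : ℕ)) :=
            Real.log_le_log (by positivity) h1
        _ = Real.log (1407 * C) + 6 * L + 5 * J * Real.log m := by
            rw [Real.log_mul (by positivity) (by positivity), Real.log_mul (by positivity)
              (by positivity), Real.log_pow, hE, Real.log_exp, Nat.cast_pow, Real.log_pow]
            norm_num
        _ ≤ Real.log (1407 * C) + 6 * L + 5 * (201 * L) * (q * L) := by gcongr
        _ ≤ _ := by
            have : (1 : ℝ) ≤ L ^ 2 := one_le_pow₀ (by linarith)
            nlinarith
    set r := Real.log (1407 * C) + 6 + 1005 * q with hr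
    have hr0 : 0 ≤ r := by
      have hlog7 : 0 ≤ Real.log (1407 * C) := Real.log_nonneg (by linarith)
      positivity
    have h6 : 1 ≤ L ^ 7 / a := by
      rw [le_div_iff₀ ha0]
      have : (1 : ℝ) ≤ L ^ 7 := one_le_pow₀ (by linarith)
      linarith
    have hlog0 : 0 ≤ Real.log (4 * ((m ^ (5 * J) : ℕ) : ℝ) * (J * n : ℕ) + 3) := by
      have : 0 ≤ 4 * ((m ^ (5 * J) : ℕ) : ℝ) * (J * n : ℕ) := by positivity
      exact Real.log_nonneg (by linarith)
    calc 1 + 2 * ((J * n : ℕ) : ℝ) * Real.log (4 * (m ^ (5 * J) : ℕ) * (J * n : ℕ) + 3)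
        ≤ 1 * (L ^ 7 / a) + 2 * (201 * C * (L ^ 5 / a)) * (r * L ^ 2) := by
          gcongr
          rwa [one_mul]
      _ = (1 + 402 * C * r) * (L ^ 7 / a) := by ring
      _ ≤ C₀ * (L ^ 7 / a) := by
          gcongr
          rw [hr, hq]
          linarith
      _ = H := by rw [hH]; ring

end Parameters

/-! ### Indicator functions and the two theorems. -/

lemma apCount_indicator {G : Type*} [AddCommGroup G] [Fintype G] [DecidableEq G] (A : Finset G) :
    apCount (fun x => if x ∈ A then (1 : ℝ) else 0) = threeAPCount A A A := by
  have h1 : threeAPCount A A A = ((A ×ˢ A).filter fun p => 2 • p.1 - p.2 ∈ A).card := by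
    unfold threeAPCount
    refine Finset.card_bij' (fun p _ => (p.2.1, p.1)) (fun p _ => (p.2, p.1, 2 • p.1 - p.2))
      ?_ ?_ ?_ ?_
    · rintro ⟨x, y, z⟩ hp
      simp only [mem_filter, mem_product] at hp ⊢
      obtain ⟨⟨hx, hy, hz⟩, hxz⟩ := hp
      refine ⟨⟨hy, hx⟩, ?_⟩
      rwa [← hxz, add_sub_cancel_left]
    · rintro ⟨y, x⟩ hp
      simp only [mem_filter, mem_product] at hp ⊢
      exact ⟨⟨hp.1.2, hp.1.1, hp.2⟩, add_sub_cancel _ _⟩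
    · rintro ⟨x, y, z⟩ hp
      simp only [mem_filter, mem_product] at hp
      simp only [Prod.mk.injEq, true_and]
      rw [← hp.2, add_sub_cancel_left]
    · rintro ⟨y, x⟩ _
      rfl
  rw [h1, Finset.card_filter, Finset.sum_product]
  push_cast
  unfold apCount
  simp only [← ite_and, mul_ite, mul_one, mul_zero]
  rw [← Finset.sum_subset (subset_univ A)]
  · refine Finset.sum_congr rfl fun y hy => ?_
    rw [← Finset.sum_subset (subset_univ A)]
    · refine Finset.sum_congr rfl fun x hx => ?_
      by_cases hz : 2 • y - x ∈ A <;> simp [hx, hy, hz]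
    · intro x _ hx
      simp [hx]
  · intro y _ hy
    simp [hy]

lemma localDensity_bohrSeminorm_zero {G : Type*} [AddCommGroup G] [Fintype G] (h : G → ℝ) :
    localDensity (bohrSeminorm 1 0) h 0 = (∑ x, h x) / Fintype.card G := by
  simp [localDensity, expWeight, expMass, bohrSeminorm_apply, Finset.mul_sum, div_eq_inv_mul]

/-- A set of density `α` in a finite abelian group of odd order contains at least
`exp (-C α⁻¹ log (2 / α) ^ 7) |A| ^ 2` three-term progressions. -/
theorem exists_exp_mul_sq_le_threeAPCount : ∃ C > (0 : ℝ),
    ∀ (G : Type*) [AddCommGroup G] [Fintype G] [DecidableEq G], Odd (Fintype.card G) →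
      ∀ (A : Finset G) (α : ℝ), density A = α → 0 < α →
        Real.exp (-(C * α⁻¹ * Real.log (2 / α) ^ 7)) * (A.card : ℝ) ^ 2 ≤
          (threeAPCount A A A : ℝ) := by
  obtain ⟨C₀, hC₀, hscale⟩ := exists_scale_and_size (C := 10 ^ 11) (by norm_num)
  -- `2 * C₀` comes from `exp (-(2 * H))` and 3 from `a ^ 3 / 8`; `2187 = 3 ^ 7` converts `log (8 /
  -- a)` to `log (2 / a)`.
  refine ⟨2187 * (2 * C₀ + 3), by positivity, ?_⟩
  intro G _ _ _ hodd A a hA ha0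
  have hcard : (0 : ℝ) < Fintype.card G := by exact_mod_cast Fintype.card_pos
  have hAG : (A.card : ℝ) ≤ Fintype.card G := by exact_mod_cast Finset.card_le_univ A
  have ha1 : a ≤ 1 := by
    rw [← hA, density, div_le_one hcard]
    exact hAG
  obtain ⟨L, hL⟩ : ∃ L, L = Real.log (8 / a) := ⟨_, rfl⟩
  have hL2 : 2 ≤ L := hL ▸ two_le_log_eight_div ha0 ha1
  have hexpL : Real.exp L = 8 / a := by rw [hL, Real.exp_log (by positivity)]
  obtain ⟨θ, k, l, n, hpar, hn, hθ⟩ := exists_incrementParams ha0 ha1 hL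
  -- `log (1 + 1/100) ≥ 1/200`, so after `200 L` steps the density would have grown by a factor at
  -- least `8 / a`.
  obtain ⟨J, hJ⟩ : ∃ J, J = ⌈200 * L⌉₊ := ⟨_, rfl⟩
  have hJ1 : 200 * L ≤ J := hJ ▸ Nat.le_ceil _
  have hJ2 : (J : ℝ) ≤ 201 * L := by
    have := Nat.ceil_lt_add_one (show 0 ≤ 200 * L by linarith)
    rw [← hJ] at this
    linarith
  obtain ⟨m, hm, hmθ, hH⟩ := hscale a L ha0 ha1 hL θ n J hpar.θ_pos hn hθ hJ2
  have hJa : 1 < (1 + 1 / 100) ^ J * a := by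
    have h1 : 8 / a ≤ (1 + 1 / 100) ^ J := by
      calc 8 / a = Real.exp L := hexpL.symm
        _ ≤ Real.exp (J * (1 / 200)) := by
            apply Real.exp_le_exp.2
            linarith
        _ = Real.exp (1 / 200) ^ J := Real.exp_nat_mul _ _
        _ ≤ (1 + 1 / 100) ^ J := by
            gcongr
            exact (exp_le_one_add_two_mul (by norm_num) (by norm_num)).trans (by norm_num)
    rw [div_le_iff₀ ha0] at h1
    linarith
  have hmain := le_apCount_of_params hodd hpar hm hmθ hJa hH
    (h := fun x => if x ∈ A then (1 : ℝ) else 0)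
    (fun x => by split_ifs <;> norm_num) (fun x => by split_ifs <;> norm_num) (by
      rw [localDensity_bohrSeminorm_zero, ← hA, density]
      simp)
  rw [apCount_indicator] at hmain
  refine le_trans ?_ hmain
  have hlog : L ≤ 3 * Real.log (2 / a) := by
    have h1 : 3 * Real.log (2 / a) = Real.log ((2 / a) ^ 3) := by
      rw [Real.log_pow]; norm_num
    rw [h1, hL]
    apply Real.log_le_log (by positivity)
    rw [div_pow, div_le_div_iff₀ ha0 (by positivity)]
    have : a ^ 3 ≤ a := pow_le_of_le_one ha0.le ha1 (by norm_num)
    norm_num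
    linarith
  have hpow : L ^ 7 ≤ 2187 * Real.log (2 / a) ^ 7 := by
    calc L ^ 7 ≤ (3 * Real.log (2 / a)) ^ 7 := by gcongr
      _ = _ := by ring
  have h3L : 3 * L ≤ 3 * (L ^ 7 / a) := by
    have h1 : L ≤ L ^ 7 := le_self_pow₀ (by linarith) (by norm_num)
    have h2 : L ^ 7 ≤ L ^ 7 / a := le_div_self (by positivity) ha0 ha1
    linarith
  have hcube : Real.exp (-(3 * L)) ≤ a ^ 3 / 8 := by
    have h1 : Real.exp (-(3 * L)) = (a / 8) ^ 3 := by
      rw [Real.exp_neg, show (3 : ℝ) * L = (3 : ℕ) * L by norm_num, Real.exp_nat_mul, hexpL,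
        ← inv_pow, inv_div]
    rw [h1, div_pow]
    gcongr
    norm_num
  calc Real.exp (-(2187 * (2 * C₀ + 3) * a⁻¹ * Real.log (2 / a) ^ 7)) * (A.card : ℝ) ^ 2
      ≤ Real.exp (-(3 * L) + -(2 * (C₀ * L ^ 7 / a))) * (Fintype.card G : ℝ) ^ 2 := by
        gcongr
        have h1 : L ^ 7 / a ≤ 2187 * Real.log (2 / a) ^ 7 / a := by gcongr
        have h2 := mul_le_mul_of_nonneg_left h1 (show 0 ≤ 2 * C₀ + 3 by linarith)
        have h3 : 2187 * (2 * C₀ + 3) * a⁻¹ * Real.log (2 / a) ^ 7 =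
            (2 * C₀ + 3) * (2187 * Real.log (2 / a) ^ 7 / a) := by ring
        have h4 : 2 * (C₀ * L ^ 7 / a) = 2 * C₀ * (L ^ 7 / a) := by ring
        rw [h3, h4]
        linarith
    _ ≤ a ^ 3 / 8 * Real.exp (-(2 * (C₀ * L ^ 7 / a))) * (Fintype.card G : ℝ) ^ 2 := by
        rw [Real.exp_add]
        gcongr

lemma threeAPCount_le_card_of_not_hasNontrivialThreeAP {G : Type*} [AddCommGroup G]
    [DecidableEq G] {A : Finset G} (hA : ¬ HasNontrivialThreeAP A) :
    threeAPCount A A A ≤ A.card := by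
  unfold threeAPCount
  refine Finset.card_le_card_of_injOn (fun p => p.1) ?_ ?_
  · rintro ⟨x, y, z⟩ hp
    simp only [coe_filter, mem_product, Set.mem_ofPred_eq] at hp
    exact hp.1.1
  · have htriv : ∀ x y z, x ∈ A → y ∈ A → z ∈ A → x + z = 2 • y → x = y ∧ y = z := by
      intro x y z hx hy hz hxz
      by_contra hne
      exact hA ⟨x, hx, y, hy, z, hz, hxz, hne⟩
    rintro ⟨x, y, z⟩ hp ⟨x', y', z'⟩ hp' hxx
    simp only [coe_filter, mem_product, Set.mem_ofPred_eq] at hp hp' hxx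
    obtain ⟨rfl, rfl⟩ := htriv x y z hp.1.1 hp.1.2.1 hp.1.2.2 hp.2
    obtain ⟨rfl, rfl⟩ := htriv x' y' z' hp'.1.1 hp'.1.2.1 hp'.1.2.2 hp'.2
    rw [hxx]

/-- A fixed margin above 1 lets one power of `log log |G|` beat a given constant for all admissible
groups at once. -/
lemma log_log_seventeen_le {x : ℝ} (hx : 17 ≤ x) : 101 / 100 ≤ Real.log (Real.log x) := by
  have h1 : 275 / 100 ≤ Real.log 17 := by
    have h2 : (11 : ℝ) ≤ Real.log (17 ^ 4) := by
      rw [Real.le_log_iff_exp_le (by norm_num)]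
      calc Real.exp 11 = Real.exp 1 ^ 11 := by rw [← Real.exp_nat_mul]; norm_num
        _ ≤ 2.7182818286 ^ 11 := by
            gcongr
            exact Real.exp_one_lt_d9.le
        _ ≤ 17 ^ 4 := by norm_num
    rw [Real.log_pow] at h2
    push_cast at h2
    linarith
  have h3 : Real.log 17 ≤ Real.log x := Real.log_le_log (by norm_num) hx
  rw [Real.le_log_iff_exp_le (by linarith)]
  have h4 : Real.exp (101 / 100) ≤ 275 / 100 := by
    have h5 : Real.exp (1 / 100) ≤ 1 + 1 / 100 + (1 / 100) ^ 2 := by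
      have := (abs_le.1 (Real.abs_exp_sub_one_sub_id_le (x := 1 / 100) (by
        rw [abs_of_pos] <;> norm_num))).2
      linarith
    calc Real.exp (101 / 100) = Real.exp 1 * Real.exp (1 / 100) := by
          rw [← Real.exp_add]; norm_num
      _ ≤ 2.7182818286 * (1 + 1 / 100 + (1 / 100) ^ 2) := by
          gcongr
          exact Real.exp_one_lt_d9.le
      _ ≤ _ := by norm_num
  linarith

/-- Sets of density at least `(log log |G|) ^ C / log |G|` contain a non-trivial three-term
progression. -/
theorem exists_hasNontrivialThreeAP_of_density : ∃ C₃ > (0 : ℝ),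
    ∀ (G : Type*) [AddCommGroup G] [Fintype G], Odd (Fintype.card G) →
      17 ≤ Fintype.card G → ∀ (A : Finset G) (α : ℝ), density A = α →
        Real.log (Real.log (Fintype.card G)) ^ C₃ / Real.log (Fintype.card G) ≤ α →
          HasNontrivialThreeAP A := by
  obtain ⟨C, hC, hcount⟩ := exists_exp_mul_sq_le_threeAPCount
  -- Of the exponent `7 + t`, the 7 cancels the logarithms in the counting bound; the remaining `y ^
  -- t` would have to be at most `256 * C`, against this choice of `t`.
  obtain ⟨t, ht⟩ := pow_unbounded_of_one_lt (256 * C) (show (1 : ℝ) < 101 / 100 by norm_num)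
  refine ⟨((7 + t : ℕ) : ℝ), by positivity, ?_⟩
  intro G _ _ hodd h17 A a hA ha
  classical
  by_contra hno
  have hcard : (17 : ℝ) ≤ Fintype.card G := by exact_mod_cast h17
  obtain ⟨M, hM⟩ : ∃ M : ℝ, M = Fintype.card G := ⟨_, rfl⟩
  rw [← hM] at hcard ha
  have hy := log_log_seventeen_le hcard
  obtain ⟨S, hS⟩ : ∃ S, S = Real.log M := ⟨_, rfl⟩
  obtain ⟨y, hydef⟩ : ∃ y, y = Real.log S := ⟨_, rfl⟩
  rw [← hS, ← hydef] at hy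
  rw [← hS, ← hydef, Real.rpow_natCast] at ha
  have hS0 : 0 < S := hS ▸ Real.log_pos (by linarith)
  have hexpS : Real.exp S = M := by rw [hS, Real.exp_log (by linarith)]
  have hexpy : Real.exp y = S := by rw [hydef, Real.exp_log hS0]
  have hy1 : 1 ≤ y := by linarith
  have hyS : y ≤ S / 2 := by
    have h1 := Real.add_one_le_exp (y - 1)
    have h2 : Real.exp y = Real.exp 1 * Real.exp (y - 1) := by rw [← Real.exp_add]; ring_nf
    have h3 : (2 : ℝ) ≤ Real.exp 1 := by
      have := Real.add_one_le_exp 1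
      linarith
    rw [← hexpy, h2]
    nlinarith
  have ha0 : 0 < a := lt_of_lt_of_le (by positivity) ha
  have hypow : 1 ≤ y ^ (7 + t) := one_le_pow₀ hy1
  have haS : 1 / S ≤ a := le_trans (by gcongr) ha
  have hAcard : (A.card : ℝ) = a * M := by
    rw [← hA, density, ← hM]
    field_simp
  have hM0 : 0 < M := by linarith
  have hA0 : (0 : ℝ) < A.card := by rw [hAcard]; positivity
  have hle := hcount G hodd A a hA ha0
  have htriv : (threeAPCount A A A : ℝ) ≤ A.card := by
    exact_mod_cast threeAPCount_le_card_of_not_hasNontrivialThreeAP hno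
  have h1 : Real.exp (-(C * a⁻¹ * Real.log (2 / a) ^ 7)) * A.card ≤ 1 := by
    refine le_of_mul_le_mul_right ?_ hA0
    rw [mul_assoc, ← sq, one_mul]
    exact hle.trans htriv
  have hloga : -y ≤ Real.log a := by
    have := Real.log_le_log (by positivity) haS
    rwa [one_div, Real.log_inv, ← hydef] at this
  -- Logarithms of `exp (-…) * |A| ≤ 1`, with `|A| = a * M` and `a ≥ 1 / S`.
  have h2 : S - y ≤ C * a⁻¹ * Real.log (2 / a) ^ 7 := by
    have h3 : Real.exp (-(C * a⁻¹ * Real.log (2 / a) ^ 7) + (Real.log a + S)) ≤ Real.exp 0 := by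
      rw [Real.exp_add, Real.exp_add, Real.exp_log ha0, hexpS, ← hAcard, Real.exp_zero]
      exact h1
    have := Real.exp_le_exp.1 h3
    linarith
  have hlog2 : Real.log (2 / a) ≤ 2 * y := by
    have h3 : Real.log 2 ≤ 1 := Real.log_two_lt_d9.le.trans (by norm_num)
    rw [Real.log_div (by norm_num) ha0.ne']
    linarith
  have ha1 : a ≤ 1 := by
    have : (A.card : ℝ) ≤ M := by rw [hM]; exact_mod_cast Finset.card_le_univ A
    rw [hAcard] at this
    exact le_of_mul_le_mul_right (by linarith) hM0
  have hlog0 : 0 ≤ Real.log (2 / a) := by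
    apply Real.log_nonneg
    rw [le_div_iff₀ ha0]
    linarith
  have hainv : a⁻¹ ≤ S / y ^ (7 + t) := by
    rw [inv_le_comm₀ ha0 (by positivity), inv_div]
    exact ha
  have h4 : S / 2 ≤ C * (S / y ^ (7 + t)) * (2 * y) ^ 7 := by
    calc S / 2 ≤ S - y := by linarith
      _ ≤ C * a⁻¹ * Real.log (2 / a) ^ 7 := h2
      _ ≤ _ := by gcongr
  have h5 : C * (S / y ^ (7 + t)) * (2 * y) ^ 7 = S * (128 * C / y ^ t) := by
    rw [pow_add]
    field_simp
    norm_num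
  rw [h5] at h4
  have h6 : 1 / 2 ≤ 128 * C / y ^ t := by
    refine le_of_mul_le_mul_left ?_ hS0
    linarith
  rw [le_div_iff₀ (by positivity)] at h6
  have h7 : (101 / 100 : ℝ) ^ t ≤ y ^ t := by gcongr
  linarith

theorem theorem2 :
    (∃ C₁ > (0 : ℝ), ∃ C₂ > (0 : ℝ),
      ∀ (G : Type*) [AddCommGroup G] [Fintype G] [DecidableEq G], Odd (Fintype.card G) →
        ∀ (A : Finset G) (α : ℝ), density A = α → 0 < α →
          Real.exp (-(C₁ * α⁻¹ * Real.log (2 / α) ^ C₂)) * (A.card : ℝ) ^ 2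
            ≤ (threeAPCount A A A : ℝ)) ∧
    (∃ C₃ > (0 : ℝ),
      ∀ (G : Type*) [AddCommGroup G] [Fintype G], Odd (Fintype.card G) →
        17 ≤ Fintype.card G →
        ∀ (A : Finset G) (α : ℝ), density A = α →
          Real.log (Real.log (Fintype.card G)) ^ C₃ / Real.log (Fintype.card G) ≤ α →
            HasNontrivialThreeAP A) := by
  refine ⟨?_, exists_hasNontrivialThreeAP_of_density⟩
  obtain ⟨C, hC, hcount⟩ := exists_exp_mul_sq_le_threeAPCount
  refine ⟨C, hC, (7 : ℕ), by norm_num, ?_⟩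
  intro G _ _ _ hodd A α hA hα
  rw [Real.rpow_natCast]
  exact hcount G hodd A α hA hα
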